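/- Let $S$ be a smooth proper integral surface over $\mathbb R$ that is rational over $\mathbb R$, let $\pi\colon S\to\mathbb P^1_{\mathbb R}$ be a morphism over $\mathbb R$ all of whose scheme-theoretic fibres are conics (i.e. isomorphic, over the residue field $\kappa$ of the point, to a plane conic $\{q=0\}\subset\mathbb P^2_\kappa$ with $q\neq 0$ a quadratic form), and let $\tau\colon S\to S$ be a nontrivial biregular involution with $\pi\circ\tau=\pi$. Assume that the group $\mathrm{Pic}(S)^{\langle\tau\rangle}$ of $\tau$-invariant classes in the Picard group of $S$ is isomorphic to $\mathbb Z^2$. For $d\ge 0$ and a homogeneous polynomial $f\in\mathbb R[z,t]$ of degree $2d$, let $Y_f$ be the hypersurface $\{xy=f(z,t)\}$ in the weighted projective space $\mathbb P(d,d,1,1)$ over $\mathbb R$ with coordinates $x,y,z,t$ of weights $d,d,1,1$, i.e. $Y_f=\operatorname{Proj}\mathbb R[x,y,z,t]/(xy-f)$, with the involution $[x:y:z:t]\mapsto[y:x:z:t]$ and the rational map $Y_f\dashrightarrow\mathbb P^1$, $[x:y:z:t]\mapsto[z:t]$. (For $d=0$ this Proj is $\{xy=f\}\times\mathbb P^1\subset\mathbb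 A^2\times\mathbb P^1$.) The involution $\tau$ of the conic bundle $\pi$ is called a de Jonquières involution if, for some $d\ge0$ and some homogeneous $f$ of degree $2d$ without multiple roots (i.e. squarefree and nonzero), there is a birational map $S\dashrightarrow Y_f$ over $\mathbb P^1$ that is equivariant with respect to $\tau$ and the involution of $Y_f$. Then $\tau$ is a de Jonquières involution if and only if $\pi(S(\mathbb R))=\mathbb P^1(\mathbb R)$. -/

import Mathlib

open CategoryTheory AlgebraicGeometry MvPolynomial

attribute [local instance] MvPolynomial.weightedGradedAlgebra

noncomputable section

namespace RealConic

/-! ### Hypersurfaces in weighted projective spaces -/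

section QuotientGrading

variable {k A B : Type} [CommRing k] [CommRing A] [Algebra k A] [CommRing B] [Algebra k B]

/-- The grading on `A / I` induced by a grading on `A`, for a homogeneous ideal `I`. -/
def quotientGrading (𝒜 : ℕ → Submodule k A) [GradedAlgebra 𝒜] (I : HomogeneousIdeal 𝒜) (i : ℕ) :
    Submodule k (A ⧸ I.toIdeal) :=
  (𝒜 i).map (Ideal.Quotient.mkₐ k I.toIdeal).toLinearMap

variable (𝒜 : ℕ → Submodule k A) [GradedAlgebra 𝒜] (I : HomogeneousIdeal 𝒜)
variable (ℬ : ℕ → Submodule k B) [GradedAlgebra ℬ] (J : HomogeneousIdeal ℬ)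

lemma mk_mem_quotientGrading {i : ℕ} {a : A} (ha : a ∈ 𝒜 i) :
    Ideal.Quotient.mk I.toIdeal a ∈ quotientGrading 𝒜 I i :=
  ⟨a, ha, rfl⟩

/-- The class of a degree `i` element, as a degree `i` element of the quotient. -/
def toQuotientPiece (i : ℕ) : 𝒜 i →+ quotientGrading 𝒜 I i where
  toFun a := ⟨Ideal.Quotient.mk I.toIdeal a, mk_mem_quotientGrading 𝒜 I a.2⟩
  map_zero' := by ext; simp
  map_add' a b := by ext; simp

/-- The decomposition of an element of `A`, reduced modulo `I`. -/
def decomposeMod : A →+ DirectSum ℕ (fun i => quotientGrading 𝒜 I i) :=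
  (DirectSum.map (toQuotientPiece 𝒜 I)).comp (DirectSum.decomposeAddEquiv 𝒜).toAddMonoidHom

lemma decomposeMod_apply (a : A) (i : ℕ) :
    ((decomposeMod 𝒜 I a i : quotientGrading 𝒜 I i) : A ⧸ I.toIdeal) =
      Ideal.Quotient.mk I.toIdeal (DirectSum.decompose 𝒜 a i) := by
  simp [decomposeMod, toQuotientPiece, DirectSum.map_apply]

lemma decomposeMod_eq_zero {a : A} (ha : a ∈ I.toIdeal) : decomposeMod 𝒜 I a = 0 := by
  ext i
  rw [decomposeMod_apply, DirectSum.zero_apply, ZeroMemClass.coe_zero]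
  exact Ideal.Quotient.eq_zero_iff_mem.mpr (I.isHomogeneous i ha)

/-- The decomposition map on the quotient. -/
def quotientDecompose : A ⧸ I.toIdeal →+ DirectSum ℕ (fun i => quotientGrading 𝒜 I i) :=
  QuotientAddGroup.lift I.toIdeal.toAddSubgroup (decomposeMod 𝒜 I)
    (fun _ ha => decomposeMod_eq_zero 𝒜 I ha)

lemma quotientDecompose_mk (a : A) :
    quotientDecompose 𝒜 I (Ideal.Quotient.mk I.toIdeal a) = decomposeMod 𝒜 I a := rfl

instance quotientGradedAlgebra : GradedAlgebra (quotientGrading 𝒜 I) where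
  one_mem := ⟨1, SetLike.GradedOne.one_mem, map_one (Ideal.Quotient.mk I.toIdeal)⟩
  mul_mem := by
    rintro i j _ _ ⟨a, ha, rfl⟩ ⟨b, hb, rfl⟩
    exact ⟨a * b, SetLike.GradedMul.mul_mem ha hb, map_mul (Ideal.Quotient.mk I.toIdeal) a b⟩
  toDecomposition := .ofAddHom _ (quotientDecompose 𝒜 I)
    (by
      ext x
      obtain ⟨a, rfl⟩ := Ideal.Quotient.mk_surjective x
      rw [AddMonoidHom.comp_apply, quotientDecompose_mk, AddMonoidHom.id_apply]
      induction a using DirectSum.Decomposition.inductionOn 𝒜 with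
      | zero => simp
      | @homogeneous i m =>
        have h : decomposeMod 𝒜 I (m : A) =
            DirectSum.of (fun i => quotientGrading 𝒜 I i) i (toQuotientPiece 𝒜 I i m) := by
          simp [decomposeMod, DirectSum.map_of]
        rw [h, DirectSum.coeAddMonoidHom_of]
        rfl
      | add m n hm hn =>
        rw [map_add, map_add, map_add, hm, hn])
    (by
      ext i ⟨_, a, ha, rfl⟩ : 2
      have h : decomposeMod 𝒜 I a = DirectSum.of (fun i => quotientGrading 𝒜 I i) i
          (toQuotientPiece 𝒜 I i ⟨a, ha⟩) := by
        simp [decomposeMod, DirectSum.decompose_of_mem _ ha, DirectSum.map_of]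
      simp only [AddMonoidHom.comp_apply, AddMonoidHom.id_apply, DirectSum.coeAddMonoidHom_of]
      exact (quotientDecompose_mk 𝒜 I a).trans h)

variable {𝒜 ℬ}

/-- The graded map `A / I → B / J` induced by a graded map `A → B` sending `I` into `J`. -/
def quotientMap (φ : 𝒜 →+*ᵍ ℬ) (h : I.toIdeal ≤ J.toIdeal.comap φ.toRingHom) :
    quotientGrading 𝒜 I →+*ᵍ quotientGrading ℬ J where
  toRingHom := Ideal.quotientMap J.toIdeal φ.toRingHom h
  map_mem := by
    rintro i _ ⟨a, ha, rfl⟩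
    exact ⟨φ a, φ.map_mem ha, rfl⟩

end QuotientGrading

/-- The structure morphism `Proj A ⟶ Spec k` for a graded `k`-algebra `A`. -/
def projToSpec {k A : Type} [CommRing k] [CommRing A] [Algebra k A] (𝒜 : ℕ → Submodule k A)
    [GradedAlgebra 𝒜] : Proj 𝒜 ⟶ Spec (.of k) :=
  Proj.toSpecZero 𝒜 ≫ Spec.map (CommRingCat.ofHom (algebraMap k (𝒜 0)))

section Hypersurface

variable {k : Type} [Field k] {n : ℕ} {w : Fin n → ℕ} {F : MvPolynomial (Fin n) k} {m : ℕ}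

/-- The homogeneous ideal generated by a weighted homogeneous polynomial. -/
def hypersurfaceIdeal (hF : F.IsWeightedHomogeneous w m) :
    HomogeneousIdeal (weightedHomogeneousSubmodule k w) where
  toSubmodule := Ideal.span {F}
  is_homogeneous' := Ideal.homogeneous_span _ _ (by rintro _ rfl; exact ⟨m, hF⟩)

/-- The graded coordinate ring `k[x₁, …, xₙ] / (F)`, with `xᵢ` of weight `w i`. -/
abbrev coordinateGrading (hF : F.IsWeightedHomogeneous w m) :=
  quotientGrading (weightedHomogeneousSubmodule k w) (hypersurfaceIdeal hF)

/-- The hypersurface `F = 0` in the weighted projective space `ℙ(w)` over `k`, as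
`Proj (k[x₁, …, xₙ] / (F))`. -/
abbrev Hypersurface (hF : F.IsWeightedHomogeneous w m) : Scheme.{0} :=
  Proj (coordinateGrading hF)

end Hypersurface

/-! ### The projective line, conics, conic bundles -/

/-- The standard grading on `ℝ[z, t]`. -/
abbrev lineGrading : ℕ → Submodule ℝ (MvPolynomial (Fin 2) ℝ) :=
  weightedHomogeneousSubmodule ℝ 1

/-- The real projective line `Proj ℝ[z, t]`; `z` and `t` are the variables `X 0` and `X 1`. -/
abbrev P1 : Scheme.{0} := Proj lineGrading

/-- The structure morphism of `ℙ¹` over `ℝ`. -/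
abbrev P1.toSpec : P1 ⟶ Spec (.of ℝ) := projToSpec lineGrading

/-- The `k`-scheme `C` is isomorphic to a plane conic `{q = 0} ⊆ ℙ²` with `q` a nonzero
quadratic form. -/
def IsConic {k : Type} [Field k] {C : Scheme.{0}} (p : C ⟶ Spec (.of k)) : Prop :=
  ∃ (q : MvPolynomial (Fin 3) k) (hq : q.IsWeightedHomogeneous (1 : Fin 3 → ℕ) 2), q ≠ 0 ∧
    ∃ e : C ≅ Hypersurface hq, e.hom ≫ projToSpec (coordinateGrading hq) = p

/-- All scheme-theoretic fibres of `π : S ⟶ ℙ¹` are conics. -/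
def IsConicBundle {S : Scheme.{0}} (π : S ⟶ P1) : Prop :=
  ∀ b : P1, IsConic (k := P1.residueField b) (π.fiberToSpecResidueField b)

/-- The set of real points of a real scheme. -/
def realPoints {X : Scheme.{0}} (sX : X ⟶ Spec (.of ℝ)) : Set (Spec (.of ℝ) ⟶ X) :=
  {p | p ≫ sX = 𝟙 _}

/-! ### The Picard group of an integral scheme

On an integral scheme `X` with function field `K`, the group of isomorphism classes of invertible
sheaves is the group of Cartier divisors, i.e. of global sections of `K^×/𝒪_X^×`, modulo the
principal ones. -/

section Picard

variable (X : Scheme.{0}) [IsIntegral X]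

/-- The inclusion of the local ring at `x` into the function field. -/
def stalkToFunctionField (x : X) : X.presheaf.stalk x ⟶ X.functionField :=
  X.presheaf.stalkSpecializes ((genericPoint_spec X).specializes trivial)

/-- `𝒪_{X,x}^×` as a subgroup of `K^×`. -/
def localUnits (x : X) : Subgroup X.functionFieldˣ :=
  (Units.map (stalkToFunctionField X x).hom.toMonoidHom).range

/-- The group of Cartier divisors: families of elements of `K^×/𝒪_{X,x}^×`, `x ∈ X`, which are
locally given by a single rational function. -/
def cartierDivisors : Subgroup (∀ x : X, X.functionFieldˣ ⧸ localUnits X x) where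
  carrier := {D | ∀ x : X, ∃ U : X.Opens, x ∈ U ∧
    ∃ g : X.functionFieldˣ, ∀ y ∈ U, D y = (g : X.functionFieldˣ ⧸ localUnits X y)}
  one_mem' _ := ⟨⊤, trivial, 1, fun _ _ => rfl⟩
  mul_mem' {D E} hD hE x := by
    obtain ⟨U, hU, g, hg⟩ := hD x
    obtain ⟨V, hV, h, hh⟩ := hE x
    refine ⟨U ⊓ V, ⟨hU, hV⟩, g * h, fun y hy => ?_⟩
    rw [Pi.mul_apply, hg y hy.1, hh y hy.2]
    rfl
  inv_mem' {D} hD x := by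
    obtain ⟨U, hU, g, hg⟩ := hD x
    refine ⟨U, hU, g⁻¹, fun y hy => ?_⟩
    rw [Pi.inv_apply, hg y hy]
    rfl

/-- The principal Cartier divisor of a nonzero rational function. -/
def principalDivisor : X.functionFieldˣ →* cartierDivisors X where
  toFun g := ⟨fun _ => g, fun _ => ⟨⊤, trivial, g, fun _ _ => rfl⟩⟩
  map_one' := rfl
  map_mul' _ _ := rfl

lemma cartierDivisors_mul_comm (D E : cartierDivisors X) : D * E = E * D := by
  ext x
  obtain ⟨g, hg⟩ := QuotientGroup.mk_surjective (D.1 x)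
  obtain ⟨h, hh⟩ := QuotientGroup.mk_surjective (E.1 x)
  change D.1 x * E.1 x = E.1 x * D.1 x
  rw [← hg, ← hh, ← QuotientGroup.mk_mul, ← QuotientGroup.mk_mul, mul_comm]

instance principalDivisor_range_normal : (principalDivisor X).range.Normal where
  conj_mem D hD E := by rwa [cartierDivisors_mul_comm X E D, mul_inv_cancel_right]

/-- The Picard group, written multiplicatively. -/
abbrev Pic : Type := cartierDivisors X ⧸ (principalDivisor X).range

variable {X}

lemma map_genericPoint_specializes (τ : X ≅ X) : τ.hom (genericPoint X) ⤳ genericPoint X :=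
  (Inseparable.of_eq (genericPoint_eq_of_isOpenImmersion τ.hom)).specializes

/-- Pullback of rational functions along an automorphism. -/
def pullbackFunctionField (τ : X ≅ X) : X.functionField ⟶ X.functionField :=
  X.presheaf.stalkSpecializes (map_genericPoint_specializes τ) ≫ τ.hom.stalkMap (genericPoint X)

lemma stalkToFunctionField_pullback (τ : X ≅ X) (x : X) :
    stalkToFunctionField X (τ.hom x) ≫ pullbackFunctionField τ =
      τ.hom.stalkMap x ≫ stalkToFunctionField X x := by
  have h := Scheme.Hom.stalkSpecializes_stalkMap τ.hom (genericPoint X) x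
    ((genericPoint_spec X).specializes trivial)
  rw [stalkToFunctionField, stalkToFunctionField, pullbackFunctionField, ← h, ← Category.assoc,
    TopCat.Presheaf.stalkSpecializes_comp]

/-- Pullback of nonzero rational functions along an automorphism. -/
def pullbackUnits (τ : X ≅ X) : X.functionFieldˣ →* X.functionFieldˣ :=
  Units.map (pullbackFunctionField τ).hom.toMonoidHom

lemma localUnits_le_comap (τ : X ≅ X) (x : X) :
    localUnits X (τ.hom x) ≤ (localUnits X x).comap (pullbackUnits τ) := by
  rintro _ ⟨u, rfl⟩
  refine ⟨Units.map (τ.hom.stalkMap x).hom.toMonoidHom u, Units.ext ?_⟩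
  exact (congr($(stalkToFunctionField_pullback τ x).hom (u : X.presheaf.stalk (τ.hom x)))).symm

/-- Pullback of Cartier divisors along an automorphism:
`(τ^* D)_x` is the pullback of `D_{τ(x)}`. -/
def pullbackDivisor (τ : X ≅ X) : cartierDivisors X →* cartierDivisors X where
  toFun D := ⟨fun x => QuotientGroup.map _ _ (pullbackUnits τ) (localUnits_le_comap τ x)
      (D.1 (τ.hom x)), fun x => by
    obtain ⟨U, hU, g, hg⟩ := D.2 (τ.hom x)
    refine ⟨τ.hom ⁻¹ᵁ U, hU, pullbackUnits τ g, fun y hy => ?_⟩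
    change QuotientGroup.map _ _ _ _ (D.1 (τ.hom y)) = _
    rw [hg _ hy]
    rfl⟩
  map_one' := by ext x; simp
  map_mul' D E := by ext x; simp

lemma principalDivisor_le_comap (τ : X ≅ X) :
    (principalDivisor X).range ≤ (principalDivisor X).range.comap (pullbackDivisor τ) := by
  rintro _ ⟨g, rfl⟩
  exact ⟨pullbackUnits τ g, rfl⟩

/-- The pullback `τ^* : Pic(X) → Pic(X)`. -/
def picPullback (τ : X ≅ X) : Pic X →* Pic X :=
  QuotientGroup.map _ _ (pullbackDivisor τ) (principalDivisor_le_comap τ)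

/-- The subgroup `Pic(X)^{⟨τ⟩}` of classes fixed by `τ`. -/
def invariantPic (τ : X ≅ X) : Subgroup (Pic X) where
  carrier := {L | picPullback τ L = L}
  one_mem' := map_one _
  mul_mem' {L M} hL hM := by
    rw [Set.mem_ofPred_eq] at hL hM ⊢
    rw [map_mul, hL, hM]
  inv_mem' {L} hL := by
    rw [Set.mem_ofPred_eq] at hL ⊢
    rw [map_inv, hL]

end Picard

/-! ### The de Jonquières model -/

section Model

variable {d : ℕ} {f : MvPolynomial (Fin 2) ℝ}

/-- The weights `(d, d, 1, 1)` of the coordinates `x, y, z, t`. -/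
abbrev modelWeights (d : ℕ) : Fin 4 → ℕ := ![d, d, 1, 1]

/-- The polynomial `x y - f(z, t)`, where `x, y, z, t` are `X 0, X 1, X 2, X 3`. -/
def modelPoly (f : MvPolynomial (Fin 2) ℝ) : MvPolynomial (Fin 4) ℝ :=
  X 0 * X 1 - rename ![2, 3] f

lemma rename_isWeightedHomogeneous (d : ℕ) {m : ℕ} (hf : f.IsHomogeneous m) :
    (rename ![2, 3] f : MvPolynomial (Fin 4) ℝ).IsWeightedHomogeneous (modelWeights d) m := by
  rw [← f.support_sum_monomial_coeff, map_sum]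
  refine (weightedHomogeneousSubmodule ℝ (modelWeights d) m).sum_mem fun s hs => ?_
  rw [rename_monomial, mem_weightedHomogeneousSubmodule]
  refine isWeightedHomogeneous_monomial _ _ _ ?_
  have h := hf (mem_support_iff.mp hs)
  rw [← h, Finsupp.weight_apply, Finsupp.weight_apply, Finsupp.sum_mapDomain_index (by simp)
    (by intros; simp [add_mul])]
  refine Finsupp.sum_congr fun i _ => ?_
  fin_cases i <;> simp [modelWeights]

lemma modelPoly_isWeightedHomogeneous (hf : f.IsHomogeneous (2 * d)) :
    (modelPoly f).IsWeightedHomogeneous (modelWeights d) (2 * d) := by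
  have h0 := isWeightedHomogeneous_X ℝ (modelWeights d) 0
  have h1 := isWeightedHomogeneous_X ℝ (modelWeights d) 1
  have h := h0.mul h1
  have e : modelWeights d 0 + modelWeights d 1 = 2 * d := by simp [modelWeights, two_mul]
  rw [e] at h
  exact (weightedHomogeneousSubmodule ℝ (modelWeights d) (2 * d)).sub_mem h
    (rename_isWeightedHomogeneous d hf)

/-- The hypersurface `Y = {x y = f(z, t)}` of degree `2 d` in `ℙ(d, d, 1, 1)` over `ℝ`. -/
abbrev Model (hf : f.IsHomogeneous (2 * d)) : Scheme.{0} :=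
  Hypersurface (modelPoly_isWeightedHomogeneous hf)

/-- The graded coordinate ring of `Y`. -/
abbrev modelGrading (hf : f.IsHomogeneous (2 * d)) :=
  coordinateGrading (modelPoly_isWeightedHomogeneous hf)

/-- The permutation of the variables exchanging `x` and `y`. -/
abbrev swapXY : Equiv.Perm (Fin 4) := Equiv.swap 0 1

/-- The exchange of `x` and `y` as a graded automorphism of `ℝ[x, y, z, t]`. -/
def polySwap (d : ℕ) : weightedHomogeneousSubmodule ℝ (modelWeights d) →+*ᵍ
    weightedHomogeneousSubmodule ℝ (modelWeights d) where
  toRingHom := (rename (R := ℝ) swapXY).toRingHom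
  map_mem {m p} hp := by
    change (rename swapXY p).IsWeightedHomogeneous (modelWeights d) m
    rw [← p.support_sum_monomial_coeff, map_sum]
    refine (weightedHomogeneousSubmodule ℝ (modelWeights d) m).sum_mem fun s hs => ?_
    rw [rename_monomial, mem_weightedHomogeneousSubmodule]
    refine isWeightedHomogeneous_monomial _ _ _ ?_
    have h := hp (mem_support_iff.mp hs)
    rw [← h, Finsupp.weight_apply, Finsupp.weight_apply, Finsupp.sum_mapDomain_index (by simp)
      (by intros; simp [add_mul])]
    refine Finsupp.sum_congr fun i _ => ?_
    fin_cases i <;> simp [modelWeights, Equiv.swap_apply_def]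

lemma polySwap_modelPoly (f : MvPolynomial (Fin 2) ℝ) :
    rename swapXY (modelPoly f) = modelPoly f := by
  have h : (swapXY : Fin 4 → Fin 4) ∘ ![2, 3] = ![2, 3] := by
    ext i; fin_cases i <;> simp [Equiv.swap_apply_def]
  simp only [modelPoly, map_sub, map_mul, rename_X, rename_rename, h]
  simp [mul_comm]

/-- The exchange of `x` and `y` on the coordinate ring of `Y`. -/
def modelRingSwap (hf : f.IsHomogeneous (2 * d)) : modelGrading hf →+*ᵍ modelGrading hf :=
  quotientMap _ _ (polySwap d) (by
    refine Ideal.span_le.mpr ?_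
    rintro _ rfl
    change rename swapXY (modelPoly f) ∈ Ideal.span {modelPoly f}
    rw [polySwap_modelPoly]
    exact Ideal.mem_span_singleton_self _)

lemma modelRingSwap_modelRingSwap (hf : f.IsHomogeneous (2 * d)) (a) :
    modelRingSwap hf (modelRingSwap hf a) = a := by
  obtain ⟨p, rfl⟩ := Ideal.Quotient.mk_surjective a
  change Ideal.Quotient.mk _ (rename swapXY (rename swapXY p)) = Ideal.Quotient.mk _ p
  rw [rename_rename]
  have h : (swapXY : Fin 4 → Fin 4) ∘ swapXY = id := by
    ext i; simp
  rw [h, rename_id_apply]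

/-- The involution `[x : y : z : t] ↦ [y : x : z : t]` of `Y`. -/
def modelSwap (hf : f.IsHomogeneous (2 * d)) : Model hf ⟶ Model hf :=
  Proj.map (modelRingSwap hf) (by
    rw [HomogeneousIdeal.irrelevant_le]
    intro i hi a ha
    have h : modelRingSwap hf a ∈ (HomogeneousIdeal.irrelevant (modelGrading hf)) :=
      HomogeneousIdeal.mem_irrelevant_of_mem _ hi ((modelRingSwap hf).map_mem ha)
    have h' := Ideal.mem_map_of_mem (modelRingSwap hf) h
    rwa [modelRingSwap_modelRingSwap] at h')

/-- The graded map `ℝ[z, t] → ℝ[x, y, z, t] / (x y - f)`. -/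
def lineToModel (hf : f.IsHomogeneous (2 * d)) : lineGrading →+*ᵍ modelGrading hf where
  toRingHom := (Ideal.Quotient.mk _).comp (rename (R := ℝ) ![2, 3]).toRingHom
  map_mem hp := mk_mem_quotientGrading _ _ (rename_isWeightedHomogeneous d hp)

lemma X_one_mem : (X 1 : MvPolynomial (Fin 2) ℝ) ∈ lineGrading 1 := isHomogeneous_X ℝ 1

/-- The dense open subset `t ≠ 0` of `Y`. -/
def modelChart (hf : f.IsHomogeneous (2 * d)) : (Model hf).Opens :=
  Proj.basicOpen (modelGrading hf) (lineToModel hf (X 1))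

/-- The restriction of the rational map `Y ⇢ ℙ¹`, `[x : y : z : t] ↦ [z : t]`, to the open subset
`t ≠ 0`, on which it is regular. In terms of the coordinate rings it is given by
`ℝ[z, t]_{(t)} → (ℝ[x, y, z, t] / (x y - f))_{(t)}`. -/
def modelProj (hf : f.IsHomogeneous (2 * d)) : (modelChart hf).toScheme ⟶ P1 :=
  (Proj.basicOpenIsoSpec (modelGrading hf) (lineToModel hf (X 1))
      ((lineToModel hf).map_mem X_one_mem) one_pos).hom ≫
    Spec.map (CommRingCat.ofHom (HomogeneousLocalization.Away.map (lineToModel hf) (X 1))) ≫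
      Proj.awayι lineGrading (X 1) X_one_mem one_pos

end Model

/-- The involution `τ` of the conic bundle `π : S ⟶ ℙ¹` is a de Jonquières involution: there are
`d` and a homogeneous polynomial `f(z, t)` of degree `2 d` without multiple factors, and a
`τ`-equivariant birational map `φ : S ⇢ Y` over `ℙ¹`, where `Y = {x y = f(z, t)} ⊆ ℙ(d, d, 1, 1)`
carries the involution `[x : y : z : t] ↦ [y : x : z : t]` and the rational map
`[x : y : z : t] ↦ [z : t]`.

The birational map is represented by an isomorphism between dense open subsets, shrunk so that its
source is `τ`-stable and so that the rational map `Y ⇢ ℙ¹` is regular on its target. -/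
def IsDeJonquieres {S : Scheme.{0}} (π : S ⟶ P1) (τ : S ≅ S) : Prop :=
  ∃ (d : ℕ) (f : MvPolynomial (Fin 2) ℝ) (hf : f.IsHomogeneous (2 * d)), Squarefree f ∧
    ∃ (φ : S.PartialIso (Model hf)) (hτ : φ.source ≤ τ.hom ⁻¹ᵁ φ.source)
      (hY : φ.target ≤ modelChart hf),
      τ.hom.resLE φ.source φ.source hτ ≫ φ.iso.hom ≫ φ.target.ι =
        φ.iso.hom ≫ φ.target.ι ≫ modelSwap hf ∧
      φ.iso.hom ≫ (Model hf).homOfLE hY ≫ modelProj hf = φ.source.ι ≫ π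

end RealConic

end

/-! ### Witt's theorem for ternary forms over `ℝ(s)` -/

section Witt

open scoped Polynomial

/-! Write K = ℝ(s) for the function field of the line and L for that of S. A de Jonquières structure
turns out to exist exactly when π has a rational section, and over ℝ(s) the existence of such a
section is detected on real points.

Suppose S is birational over the line to x y = f. For a general constant c, the curve x = c, y = f/c
is a rational section (`exists_rational_section_model`). Since π is proper, the valuative criterion
extends it over the local ring of each real point of the line (`exists_lift_of_isProper`), so every
real point lifts.

Conversely, suppose all real points lift. The generic fibre is a conic over K, and it is
nondegenerate: a singular point of it would give the smooth surface S three independent tangent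
directions (`diagonal_ne_zero`). So L is generated by the coordinate ratios of a nonzero solution of
a x² + b y² = z² with nonzero a, b in ℝ[s]. If a and b were both negative at some s₀, take a real
point of S above s₀. In its local ring the leading forms of x, y, z would satisfy a definite
relation over ℝ, forcing x = y = z = 0 (`RingHom.FormallyEtale.eq_zero_of_sq_add_sq`), which is
absurd. Hence a and b are never both negative, and Legendre's descent yields a zero over K
(`isotropicDiag_of_forall_eval`). Projection from this zero gives L = K(t)
(`IsotropicDiag.exists_parameter`).

Now τ acts on K(t) as a Möbius transformation of order two, hence of trace zero, and a suitable
generator x satisfies x · τ(x) = f in K (`exists_generator_mul_apply_eq`). Rescaling x changes f by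
a square, so f may be taken to be a squarefree polynomial, and then a squarefree form of even degree
(`exists_squarefree_homogenization`). With y = τ(x), L becomes the function field of the model. This
isomorphism spreads out to open subschemes (`exists_isOpenImmersion_of_functionField`), and
compatibility with the involutions and with the line is checked at the generic point
(`isDeJonquieres_of_genericPoint`). -/

lemma Polynomial.exists_eq_squarefree_mul_sq {F : Type*} [Field F] (p : F[X]) (hp : p ≠ 0) :
    ∃ a h : F[X], p = a * h ^ 2 ∧ Squarefree a ∧ h ≠ 0 := by
  induction hn : p.natDegree using Nat.strong_induction_on generalizing p with
  | _ n ih =>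
    by_cases hs : Squarefree p
    · exact ⟨p, 1, by simp, hs, one_ne_zero⟩
    · simp only [Squarefree, not_forall] at hs
      obtain ⟨x, ⟨q, hq⟩, hx⟩ := hs
      have hx0 : x ≠ 0 := by rintro rfl; simp at hq; exact hp hq
      have hq0 : q ≠ 0 := by rintro rfl; simp at hq; exact hp hq
      have hdeg : 0 < x.natDegree := by
        rw [Nat.pos_iff_ne_zero]
        intro h0
        exact hx (Polynomial.isUnit_iff_degree_eq_zero.mpr
          ((Polynomial.degree_eq_iff_natDegree_eq hx0).mpr h0))
      have hd : p.natDegree = x.natDegree + x.natDegree + q.natDegree := by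
        rw [hq, Polynomial.natDegree_mul (mul_ne_zero hx0 hx0) hq0,
          Polynomial.natDegree_mul hx0 hx0]
      obtain ⟨a, h, rfl, ha, hh⟩ := ih q.natDegree (by omega) q hq0 rfl
      exact ⟨a, h * x, by rw [hq]; ring, ha, mul_ne_zero hh hx0⟩

lemma Polynomial.dvd_of_irreducible_of_aeval_eq_zero {p q : ℝ[X]} (hp : Irreducible p) {z : ℂ}
    (hz : Polynomial.aeval z p = 0) (hq : Polynomial.aeval z q = 0) : p ∣ q := by
  have h := minpoly.dvd ℝ z hq
  rw [← minpoly.eq_of_irreducible hp hz] at h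
  exact dvd_of_mul_right_dvd h

/-- The residue field of p embeds in ℂ through a root z. If z is real, b(z) ≥ 0 has a real square
root. If z is not real, the residue field is all of ℂ, where everything is a square. -/
lemma Irreducible.exists_dvd_sq_sub {p b : ℝ[X]} (hp : Irreducible p)
    (hb : ∀ r, p.eval r = 0 → 0 ≤ b.eval r) : ∃ c : ℝ[X], p ∣ c ^ 2 - b := by
  obtain ⟨z, hz⟩ := IsAlgClosed.exists_aeval_eq_zero ℂ p
    (by exact (Polynomial.degree_pos_of_irreducible hp).ne')
  suffices h : ∃ c : ℝ[X], (Polynomial.aeval z c) ^ 2 = Polynomial.aeval z b by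
    obtain ⟨c, hc⟩ := h
    exact ⟨c, Polynomial.dvd_of_irreducible_of_aeval_eq_zero hp hz (by simp [hc])⟩
  by_cases him : z.im = 0
  · obtain ⟨r, rfl⟩ : ∃ r : ℝ, z = r := ⟨z.re, by apply Complex.ext <;> simp [him]⟩
    have e (q : ℝ[X]) : Polynomial.aeval (r : ℂ) q = ((q.eval r : ℝ) : ℂ) := by
      rw [← Polynomial.coe_aeval_eq_eval]
      exact Polynomial.aeval_algebraMap_apply ℂ r q
    rw [e] at hz
    refine ⟨Polynomial.C √(b.eval r), ?_⟩
    rw [e, e, ← Complex.ofReal_pow, Polynomial.eval_C, Real.sq_sqrt (hb r (by exact_mod_cast hz))]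
  · obtain ⟨w, hw⟩ := IsAlgClosed.exists_pow_nat_eq (Polynomial.aeval z b) (n := 2) (by norm_num)
    -- 1 and z form a real basis of ℂ; this linear polynomial is the one with value w at z.
    refine ⟨Polynomial.C (w.re - w.im / z.im * z.re) + Polynomial.C (w.im / z.im) * Polynomial.X, ?_⟩
    rw [← hw]
    congr 1
    apply Complex.ext <;> simp
    field_simp

/-- Chinese remainder theorem: square roots of b modulo the distinct prime factors of a are glued.
-/
lemma Squarefree.exists_dvd_sq_sub {a b : ℝ[X]} (ha : Squarefree a)
    (hb : ∀ r, a.eval r = 0 → 0 ≤ b.eval r) : ∃ c : ℝ[X], a ∣ c ^ 2 - b := by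
  induction a using UniqueFactorizationMonoid.induction_on_prime with
  | h₁ => exact absurd ha not_squarefree_zero
  | h₂ u hu => exact ⟨0, hu.dvd⟩
  | h₃ a p ha0 hp ih =>
    obtain ⟨c₁, hc₁⟩ := ih ha.of_mul_right (fun r hr => hb r (by simp [hr]))
    obtain ⟨c₂, hc₂⟩ := hp.irreducible.exists_dvd_sq_sub (b := b) (fun r hr => hb r (by simp [hr]))
    have hcop : IsCoprime p a := by
      rw [hp.irreducible.coprime_iff_not_dvd]
      rintro ⟨d, rfl⟩
      exact hp.not_isUnit (ha p ⟨d, by ring⟩)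
    obtain ⟨u, v, huv⟩ := hcop
    -- As u p + v a = 1, this is congruent to c₂ modulo p and to c₁ modulo a.
    refine ⟨c₁ * (u * p) + c₂ * (v * a), ?_⟩
    refine IsCoprime.mul_dvd ⟨u, v, huv⟩ ?_ ?_
    · have e : (c₁ * (u * p) + c₂ * (v * a)) ^ 2 - b =
          (c₂ ^ 2 - b) + p * ((c₁ - c₂) * u * ((c₁ - c₂) * (u * p) + 2 * c₂)) := by
        have : v * a = 1 - u * p := by rw [← huv]; ring
        rw [this]; ring
      rw [e]
      exact dvd_add hc₂ (dvd_mul_right _ _)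
    · have e : (c₁ * (u * p) + c₂ * (v * a)) ^ 2 - b =
          (c₁ ^ 2 - b) + a * ((c₂ - c₁) * v * ((c₂ - c₁) * (v * a) + 2 * c₁)) := by
        have : u * p = 1 - v * a := by rw [← huv]; ring
        rw [this]; ring
      rw [e]
      exact dvd_add hc₁ (dvd_mul_right _ _)

/-- The form `a x² + b y² - z²` has a nontrivial zero. -/
def IsotropicDiag {R : Type*} [CommRing R] (a b : R) : Prop :=
  ∃ x y z : R, (x ≠ 0 ∨ y ≠ 0 ∨ z ≠ 0) ∧ a * x ^ 2 + b * y ^ 2 = z ^ 2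

namespace IsotropicDiag

variable {R : Type*} [CommRing R] {a b : R}

lemma symm (h : IsotropicDiag a b) : IsotropicDiag b a := by
  obtain ⟨x, y, z, h0, h⟩ := h
  exact ⟨y, x, z, by tauto, by rw [← h]; ring⟩

variable [IsDomain R]

lemma mul_sq {h : R} (hh : h ≠ 0) (H : IsotropicDiag a b) : IsotropicDiag (a * h ^ 2) b := by
  obtain ⟨x, y, z, h0, e⟩ := H
  refine ⟨x, h * y, h * z, ?_, ?_⟩
  · simpa [hh] using h0
  · rw [mul_pow, mul_pow, ← e]; ring

lemma of_sq (h : R) : IsotropicDiag (h ^ 2) b := ⟨1, 0, h, by simp, by ring⟩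

/-- Multiplicativity of the norm from R[√b]: both a a' = c² - b and a' x² = z² - b y² are norms. The
witness is read off from (c + √b)(z + y√b) = (c z + b y) + (c y + z)√b. If x = 0, the given zero
does not involve a' at all. -/
lemma of_mul_eq {a' c : R} (ha' : a' ≠ 0) (h : a * a' = c ^ 2 - b) (H : IsotropicDiag a' b) :
    IsotropicDiag a b := by
  obtain ⟨x, y, z, h0, e⟩ := H
  by_cases hx : x = 0
  · subst hx
    exact ⟨0, y, z, h0, by simpa using e⟩
  · refine ⟨z ^ 2 - b * y ^ 2, x * (c * y + z), x * (c * z + b * y), Or.inl ?_, ?_⟩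
    · rw [← e]; simp [ha', hx]
    · have : z ^ 2 - b * y ^ 2 = a' * x ^ 2 := by rw [← e]; ring
      have h2 : a * (z ^ 2 - b * y ^ 2) = (c ^ 2 - b) * x ^ 2 := by rw [this, ← h]; ring
      calc a * (z ^ 2 - b * y ^ 2) ^ 2 + b * (x * (c * y + z)) ^ 2
          = (a * (z ^ 2 - b * y ^ 2)) * (z ^ 2 - b * y ^ 2) + b * (x * (c * y + z)) ^ 2 := by ring
        _ = (x * (c * z + b * y)) ^ 2 := by rw [h2]; ring

end IsotropicDiag

/-- The sign conditions are open, so s can be moved off the finitely many roots of h, where h² is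
positive. -/
lemma Polynomial.exists_eval_neg_of_squarefree_mul {a b : ℝ[X]} {h : ℝ[X]} (hh : h ≠ 0)
    {s : ℝ} (ha : a.eval s < 0) (hb : b.eval s < 0) :
    ∃ s', (a * h ^ 2).eval s' < 0 ∧ b.eval s' < 0 := by
  have hU : IsOpen {x : ℝ | a.eval x < 0 ∧ b.eval x < 0} :=
    (isOpen_lt a.continuous continuous_const).inter (isOpen_lt b.continuous continuous_const)
  have hfin : {x : ℝ | h.IsRoot x}.Finite := Polynomial.finite_setOfPred_isRoot hh
  obtain ⟨s', hs', hr⟩ := (infinite_of_mem_nhds s (hU.mem_nhds ⟨ha, hb⟩)).exists_notMem_finite hfin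
  refine ⟨s', ?_, hs'.2⟩
  have hne : h.eval s' ≠ 0 := hr
  rw [Polynomial.eval_mul, Polynomial.eval_pow]
  exact mul_neg_of_neg_of_pos hs'.1 (by positivity)

/-- At a simple root of `a`, a polynomial `b` such that `a` and `b` are never both negative
is nonnegative. -/
lemma Squarefree.eval_nonneg_of_eval_eq_zero {a b : ℝ[X]} (ha : Squarefree a)
    (hab : ∀ s, ¬ (a.eval s < 0 ∧ b.eval s < 0)) {r : ℝ} (hr : a.eval r = 0) : 0 ≤ b.eval r := by
  by_contra! hb
  obtain ⟨q, rfl⟩ := Polynomial.dvd_iff_isRoot.mpr hr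
  have hq : q.eval r ≠ 0 := by
    intro h0
    obtain ⟨q', rfl⟩ := Polynomial.dvd_iff_isRoot.mpr h0
    exact Polynomial.not_isUnit_X_sub_C r (ha _ ⟨q', by ring⟩)
  have hcb : ∀ᶠ x in nhds r, b.eval x < 0 :=
    b.continuous.continuousAt.eventually_lt continuousAt_const hb
  -- Near r the cofactor q keeps its sign, so (X - r) q is negative on one side of r while b is
  -- still negative there.
  rcases hq.lt_or_gt with hq | hq
  · have hcq : ∀ᶠ x in nhds r, q.eval x < 0 :=
      q.continuous.continuousAt.eventually_lt continuousAt_const hq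
    obtain ⟨x, ⟨h1, h2⟩, hx⟩ := (((hcb.and hcq).filter_mono
      (nhdsWithin_le_nhds (s := Set.Ioi r))).and self_mem_nhdsWithin).exists
    refine hab x ⟨?_, h1⟩
    rw [Polynomial.eval_mul]
    exact mul_neg_of_pos_of_neg (by simpa using hx) h2
  · have hcq : ∀ᶠ x in nhds r, 0 < q.eval x :=
      continuousAt_const.eventually_lt q.continuous.continuousAt hq
    obtain ⟨x, ⟨h1, h2⟩, hx⟩ := (((hcb.and hcq).filter_mono
      (nhdsWithin_le_nhds (s := Set.Iio r))).and self_mem_nhdsWithin).exists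
    refine hab x ⟨?_, h1⟩
    rw [Polynomial.eval_mul]
    exact mul_neg_of_neg_of_pos (by simpa using hx) h2

/-- Legendre's descent: `a x² + b y² = z²` is solvable over `ℝ[s]` as soon as it is solvable
at every real point. -/
theorem isotropicDiag_of_forall_eval {a b : ℝ[X]} (ha : a ≠ 0) (hb : b ≠ 0)
    (hab : ∀ s, ¬ (a.eval s < 0 ∧ b.eval s < 0)) : IsotropicDiag a b := by
  induction hn : a.natDegree + b.natDegree using Nat.strong_induction_on generalizing a b with
  | _ n ih =>
    wlog hle : b.natDegree ≤ a.natDegree generalizing a b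
    · exact (this hb ha (fun s => by rw [and_comm]; exact hab s) (by omega) (by omega)).symm
    obtain ⟨a₁, h, rfl, ha₁, hh⟩ := a.exists_eq_squarefree_mul_sq ha
    have ha₁0 : a₁ ≠ 0 := ha₁.ne_zero
    refine .mul_sq hh ?_
    have hdeg : (a₁ * h ^ 2).natDegree = a₁.natDegree + 2 * h.natDegree := by
      rw [Polynomial.natDegree_mul ha₁0 (pow_ne_zero 2 hh), Polynomial.natDegree_pow]
    have hab₁ : ∀ s, ¬ (a₁.eval s < 0 ∧ b.eval s < 0) := by
      rintro s ⟨h1, h2⟩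
      obtain ⟨s', hs'⟩ := Polynomial.exists_eval_neg_of_squarefree_mul hh h1 h2
      exact hab s' hs'
    -- If h is not constant, passing to the squarefree part already lowers the degree. Otherwise a₁
    -- has the degree of a, hence at least that of b.
    by_cases hh0 : h.natDegree = 0
    swap
    · exact ih _ (by omega) ha₁0 hb hab₁ rfl
    by_cases h0 : a₁.natDegree = 0
    · have hb0 : b.natDegree = 0 := by omega
      obtain ⟨α, rfl⟩ := Polynomial.natDegree_eq_zero.mp h0
      obtain ⟨β, rfl⟩ := Polynomial.natDegree_eq_zero.mp hb0
      have hab' := hab₁ 0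
      simp only [Polynomial.eval_C, not_and_or, not_lt] at hab'
      rcases hab' with h | h
      · rw [← Real.sq_sqrt h, map_pow]; exact .of_sq _
      · rw [← Real.sq_sqrt h, map_pow]; exact (IsotropicDiag.of_sq _).symm
    · obtain ⟨c₀, hc₀⟩ := ha₁.exists_dvd_sq_sub (b := b)
        (fun r hr => ha₁.eval_nonneg_of_eval_eq_zero hab₁ hr)
      -- Reducing the square root modulo a₁ makes deg(c² - b) < 2 deg a₁, so the cofactor a' in c² -
      -- b = a₁ a' has smaller degree than a₁.
      set c := c₀ % a₁ with hc
      have hcdeg : c.natDegree < a₁.natDegree := Polynomial.natDegree_mod_lt _ h0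
      have hdvd : a₁ ∣ c ^ 2 - b := by
        have e : c₀ = a₁ * (c₀ / a₁) + c := (EuclideanDomain.div_add_mod c₀ a₁).symm
        have : c ^ 2 - b = (c₀ ^ 2 - b) - a₁ * ((c₀ / a₁) * (c₀ + c)) := by
          have : a₁ * (c₀ / a₁) = c₀ - c := by rw [eq_sub_iff_add_eq, ← e]
          rw [← mul_assoc, this]; ring
        rw [this]
        exact dvd_sub hc₀ (dvd_mul_right _ _)
      obtain ⟨a', ha'⟩ := hdvd
      by_cases ha'0 : a' = 0
      · rw [ha'0, mul_zero, sub_eq_zero] at ha'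
        rw [← ha']
        exact (IsotropicDiag.of_sq c).symm
      · refine .of_mul_eq ha'0 ha'.symm ?_
        have hd' : a₁.natDegree + a'.natDegree ≤ max (2 * c.natDegree) b.natDegree := by
          rw [← Polynomial.natDegree_mul ha₁0 ha'0, ← ha']
          refine (Polynomial.natDegree_sub_le _ _).trans ?_
          rw [Polynomial.natDegree_pow]
        have hlt : a'.natDegree < a₁.natDegree := by
          rcases le_max_iff.mp hd' with h | h <;> omega
        refine ih _ (by omega) ha'0 hb ?_ rfl
        -- The sign condition descends: where b < 0, the product a₁ a' = c² - b is positive, so a₁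
        -- would be negative together with a'.
        rintro s ⟨h1, h2⟩
        refine hab₁ s ⟨?_, h2⟩
        have he := congrArg (Polynomial.eval s) ha'
        simp only [Polynomial.eval_sub, Polynomial.eval_pow, Polynomial.eval_mul] at he
        by_contra! hpos
        nlinarith [sq_nonneg (c.eval s)]

end Witt

/-! ### Function fields of conics and their involutions -/

section FunctionFieldOfConic

open IntermediateField

variable {K L : Type*} [Field K] [Field L] [Algebra K L]

/-- The ratios of the coordinates of a point of an isotropic conic are rational functions of
a single parameter. -/
lemma IsotropicDiag.exists_parameter [NeZero (2 : K)] {a b : K} (ha : a ≠ 0) (hb : b ≠ 0)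
    (hab : IsotropicDiag a b)
    {x y z : L} (h0 : x ≠ 0 ∨ y ≠ 0 ∨ z ≠ 0)
    (h : algebraMap K L a * x ^ 2 + algebraMap K L b * y ^ 2 = z ^ 2) :
    ∃ t c : L, c ≠ 0 ∧ x / c ∈ K⟮t⟯ ∧ y / c ∈ K⟮t⟯ ∧ z / c ∈ K⟮t⟯ := by
  have h2 : (2 : K) ≠ 0 := NeZero.ne 2
  -- Isotropy means that a is a norm from K[√b].
  obtain ⟨p, q, hpq⟩ : ∃ p q : K, a = p ^ 2 - b * q ^ 2 := by
    obtain ⟨x₀, y₀, z₀, h0, h⟩ := hab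
    by_cases hx : x₀ = 0
    · subst hx
      have hy : y₀ ≠ 0 := by
        rintro rfl
        simp at h0 h
        exact h0 (by simpa using h.symm)
      have hz : z₀ ≠ 0 := by
        rintro rfl
        simp [hb, hy] at h
      -- Here b is a square, so the norm form is hyperbolic, and a = ((a + 1)/2)² - ((a - 1)/2)².
      refine ⟨(a + 1) / 2, (a - 1) / 2 * (y₀ / z₀), ?_⟩
      have : b * (y₀ / z₀) ^ 2 = 1 := by
        field_simp
        simpa using h
      rw [mul_pow, mul_left_comm, this]
      field_simp; ring
    · exact ⟨z₀ / x₀, y₀ / x₀, by field_simp; rw [← h]; ring⟩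
  set α := algebraMap K L a with hα
  set β := algebraMap K L b with hβ
  set P := algebraMap K L p
  set Q := algebraMap K L q
  have hα0 : α ≠ 0 := by simpa [hα] using ha
  have hβ0 : β ≠ 0 := by simpa [hβ] using hb
  have hPQ : α = P ^ 2 - β * Q ^ 2 := by simp [α, β, P, Q, hpq]
  have h2L : (2 : L) ≠ 0 := by
    rw [← map_ofNat (algebraMap K L) 2]
    exact (map_ne_zero _).mpr h2
  -- Dividing z + y√β by the element P + Q√β of norm α reduces the conic to x² = z'² - β y'².
  obtain ⟨z', y', hz, hy⟩ : ∃ z' y', z = P * z' + β * Q * y' ∧ y = Q * z' + P * y' := by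
    refine ⟨(P * z - β * Q * y) / α, (P * y - Q * z) / α, ?_, ?_⟩
    · rw [eq_comm, ← mul_right_inj' hα0]; field_simp; rw [hPQ]; ring
    · rw [eq_comm, ← mul_right_inj' hα0]; field_simp; rw [hPQ]; ring
  have hx : x ^ 2 = z' ^ 2 - β * y' ^ 2 := by
    rw [← mul_right_inj' hα0]
    have : α * x ^ 2 = z ^ 2 - β * y ^ 2 := by rw [← h]; ring
    rw [this, hz, hy, hPQ]; ring
  suffices H : ∃ t c : L, c ≠ 0 ∧ x / c ∈ K⟮t⟯ ∧ y' / c ∈ K⟮t⟯ ∧ z' / c ∈ K⟮t⟯ by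
    obtain ⟨t, c, hc, h1, h2, h3⟩ := H
    have hP : P ∈ K⟮t⟯ := IntermediateField.algebraMap_mem _ p
    have hQ : Q ∈ K⟮t⟯ := IntermediateField.algebraMap_mem _ q
    have hB : β ∈ K⟮t⟯ := IntermediateField.algebraMap_mem _ b
    refine ⟨t, c, hc, h1, ?_, ?_⟩
    · rw [hy, add_div, mul_div_assoc, mul_div_assoc]
      exact add_mem (mul_mem hQ h3) (mul_mem hP h2)
    · rw [hz, add_div, mul_div_assoc, mul_div_assoc]
      exact add_mem (mul_mem hP h3) (mul_mem (mul_mem hB hQ) h2)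
  -- Projection from the rational point x = z', y' = 0 has parameter y' / (x - z'). When the
  -- denominator vanishes, the given point is the centre itself and its coordinate ratios lie in K.
  by_cases hc : x - z' = 0
  · rw [sub_eq_zero] at hc
    subst hc
    have hy' : y' = 0 := by
      have : β * y' ^ 2 = 0 := by linear_combination hx
      simpa [hβ0] using this
    have hx0 : x ≠ 0 := by
      rintro rfl
      simp [hy, hz, hy'] at h0
    refine ⟨0, x, hx0, ?_, ?_, ?_⟩
    · rw [div_self hx0]; exact one_mem _
    · rw [hy', zero_div]; exact zero_mem _
    · rw [div_self hx0]; exact one_mem _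
  · set c := x - z'
    set t := y' / c
    have ht : t ∈ K⟮t⟯ := mem_adjoin_simple_self K t
    have hB : β ∈ K⟮t⟯ := IntermediateField.algebraMap_mem _ b
    have e : z' / c = (-(β * t ^ 2) - 1) / 2 := by
      have : c * (c + 2 * z') = -(β * y' ^ 2) := by simp only [c]; linear_combination hx
      simp only [t]
      field_simp
      linear_combination this
    have hz' : z' / c ∈ K⟮t⟯ := by
      rw [e]
      have two : (2 : L) ∈ K⟮t⟯ := by simp
      exact div_mem (sub_mem (neg_mem (mul_mem hB (pow_mem ht 2))) (one_mem _)) two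
    refine ⟨t, c, hc, ?_, ht, hz'⟩
    have : x / c = 1 + z' / c := by field_simp; simp [c]
    rw [this]
    exact add_mem (one_mem _) hz'

/-- An automorphism of a purely transcendental extension of degree one is a Möbius
transformation. -/
lemma exists_moebius {t : L} (ht : Transcendental K t) (htop : K⟮t⟯ = ⊤) (τ : L ≃ₐ[K] L) :
    ∃ α β γ δ : K, τ t * (algebraMap K L γ * t + algebraMap K L δ) =
      algebraMap K L α * t + algebraMap K L β ∧ algebraMap K L γ * t + algebraMap K L δ ≠ 0 := by
  let e : RatFunc K ≃ₐ[K] L := (RatFunc.algEquivOfTranscendental t ht).trans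
    ((IntermediateField.equivOfEq htop).trans IntermediateField.topEquiv)
  have heX : e RatFunc.X = t := by simp [e]
  set u : RatFunc K := e.symm (τ t) with hu
  have hutop : K⟮u⟯ = ⊤ := by
    let σ : RatFunc K ≃ₐ[K] RatFunc K := (e.trans τ).trans e.symm
    have : u = σ RatFunc.X := by simp [σ, hu, heX]
    have h := adjoin_map K {RatFunc.X} σ.toAlgHom
    rw [RatFunc.adjoin_X, Set.image_singleton] at h
    rw [this]
    exact h.symm.trans ((AlgHom.fieldRange_eq_map _).symm.trans (AlgEquiv.fieldRange_eq_top σ))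
  -- The degree [K(X) : K(u)] is the maximum of the degrees of numerator and denominator. It is 1
  -- here, so both are at most linear.
  have hmax := RatFunc.finrank_eq_max_natDegree u
  rw [finrank_eq_one_iff_eq_top.mpr hutop] at hmax
  obtain ⟨hn, hd⟩ := max_le_iff.mp hmax.ge
  obtain ⟨α, β, hn⟩ := Polynomial.exists_eq_X_add_C_of_natDegree_le_one hn
  obtain ⟨γ, δ, hd⟩ := Polynomial.exists_eq_X_add_C_of_natDegree_le_one hd
  have key (α β : K) : e (algebraMap (Polynomial K) (RatFunc K)
      (Polynomial.C α * Polynomial.X + Polynomial.C β)) =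
        algebraMap K L α * t + algebraMap K L β := by
    rw [map_add, map_mul, RatFunc.algebraMap_X, map_add, map_mul, heX, RatFunc.algebraMap_C,
      RatFunc.algebraMap_C]
    have (c : K) : e (RatFunc.C c) = algebraMap K L c := by
      rw [← RatFunc.algebraMap_eq_C]; exact e.commutes c
    rw [this, this]
  have hne : algebraMap (Polynomial K) (RatFunc K) u.denom ≠ 0 := by
    simpa using u.denom_ne_zero
  refine ⟨α, β, γ, δ, ?_, ?_⟩
  · rw [← key, ← key, ← hn, ← hd]
    have : τ t = e u := by simp [hu]
    rw [this, ← map_mul]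
    congr 1
    conv_lhs => rw [← RatFunc.num_div_denom u]
    rw [RatFunc.num_div_denom, ← RatFunc.num_div_denom u]
    simp only [RatFunc.num_div_denom]
    nth_rw 1 [← RatFunc.num_div_denom u]
    exact div_mul_cancel₀ _ hne
  · rw [← key, ← hd]
    simpa using u.denom_ne_zero

/-- An involution of a purely transcendental extension of degree one has the form `x ↦ f / x`
for a suitable generator `x`. -/
theorem exists_generator_mul_apply_eq [NeZero (2 : K)] {t : L} (ht : Transcendental K t)
    (htop : K⟮t⟯ = ⊤)
    (τ : L ≃ₐ[K] L) (hτ : ∀ x, τ (τ x) = x) (hne : ∃ x, τ x ≠ x) :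
    ∃ (x : L) (f : K), K⟮x⟯ = ⊤ ∧ f ≠ 0 ∧ x * τ x = algebraMap K L f := by
  have h2 : (2 : K) ≠ 0 := NeZero.ne 2
  have hinj := (algebraMap K L).injective
  have h2L : (2 : L) ≠ 0 := by
    rw [← map_ofNat (algebraMap K L) 2]
    exact (map_ne_zero _).mpr h2
  have hnet : τ t ≠ t := by
    intro h
    obtain ⟨x, hx⟩ := hne
    refine hx ?_
    have hx' : x ∈ K⟮t⟯ := htop ▸ mem_top
    clear hx
    induction hx' using adjoin_induction with
    | mem y hy => rw [Set.mem_singleton_iff.mp hy, h]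
    | algebraMap y => simp
    | add y z _ _ h1 h2 => rw [map_add, h1, h2]
    | inv y _ h1 => rw [map_inv₀, h1]
    | mul y z _ _ h1 h2 => rw [map_mul, h1, h2]
  have lin {α β : K} (h : algebraMap K L α * t + algebraMap K L β = 0) : α = 0 ∧ β = 0 := by
    have := (transcendental_iff.mp ht) (Polynomial.C α * Polynomial.X + Polynomial.C β) (by simpa)
    have h1 := congrArg (Polynomial.coeff · 1) this
    have h0 := congrArg (Polynomial.coeff · 0) this
    simpa using And.intro h1 h0
  have quad {α β γ : K} (h : algebraMap K L α * t ^ 2 + algebraMap K L β * t +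
      algebraMap K L γ = 0) : α = 0 ∧ β = 0 ∧ γ = 0 := by
    have := (transcendental_iff.mp ht) (Polynomial.C α * Polynomial.X ^ 2 +
      Polynomial.C β * Polynomial.X + Polynomial.C γ) (by simpa)
    have h2 := congrArg (Polynomial.coeff · 2) this
    have h1 := congrArg (Polynomial.coeff · 1) this
    have h0 := congrArg (Polynomial.coeff · 0) this
    simp [Polynomial.coeff_X, Polynomial.coeff_C] at h0 h1 h2
    exact ⟨h2, h1, h0⟩
  have hgen (x : L) (ht : t ∈ K⟮x⟯) : K⟮x⟯ = ⊤ :=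
    top_le_iff.mp (htop ▸ adjoin_simple_le_iff.mpr ht)
  obtain ⟨α, β, γ, δ, h, h0⟩ := exists_moebius ht htop τ
  set A := algebraMap K L α
  set B := algebraMap K L β
  set C := algebraMap K L γ
  set D := algebraMap K L δ
  have h' : t * (C * τ t + D) = A * τ t + B := by
    have := congrArg τ h
    simpa [hτ, A, B, C, D] using this
  -- Eliminating τ t from the relation and its τ-conjugate gives a quadratic equation for t, whose
  -- coefficients must vanish. It expresses that the square of the Möbius matrix is scalar.
  have hq : C * (A + D) * t ^ 2 + (D ^ 2 - A ^ 2) * t + -(B * (A + D)) = 0 := by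
    linear_combination (t * C - A) * (h) * (-1) + (C * t + D) * h'
  obtain ⟨h1, -, h3⟩ := quad (α := γ * (α + δ)) (β := δ ^ 2 - α ^ 2) (γ := -(β * (α + δ)))
    (by simpa [A, B, C, D] using hq)
  -- With nonzero trace the matrix itself would be scalar, and τ would fix t.
  have hsum : α + δ = 0 := by
    by_contra hs
    have hγ : γ = 0 := by simpa [hs] using h1
    have hβ : β = 0 := by simpa [hs] using h3
    have hD : δ ≠ 0 := by
      rintro rfl
      simp [C, D, hγ] at h0
    have hq' := hq
    simp only [C, B, hγ, hβ, map_zero] at hq'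
    obtain ⟨h4, -⟩ := lin (α := δ ^ 2 - α ^ 2) (β := 0) (by simpa [A, D] using hq')
    have h5 : α = δ := by
      have : (α + δ) * (α - δ) = 0 := by linear_combination -h4
      simpa [hs, sub_eq_zero] using this
    refine hnet ?_
    have hD' : D ≠ 0 := by simpa [D] using hD
    apply mul_right_cancel₀ hD'
    simp only [C, B, hγ, hβ, map_zero, A, h5] at h
    linear_combination h
  have hAD : D = -A := by
    have : δ = -α := by linear_combination hsum
    simp [D, A, this]
  rw [hAD] at h h0
  by_cases hγ : γ = 0
  -- Affine case: τ t = -t - 2ρ, so y = t + ρ changes sign and its Cayley transform (1 + y)/(1 - y)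
  -- is inverted. Thus f = 1.
  · have hC : C = 0 := by simp [C, hγ]
    rw [hC, zero_mul, zero_add] at h h0
    have hA : A ≠ 0 := by simpa using h0
    set ρ := algebraMap K L (β / α / 2) with hρ
    have hτt : τ t = -t - 2 * ρ := by
      have : A * (2 * ρ) = B := by
        simp only [hρ, A, B, map_div₀, map_ofNat]
        have : algebraMap K L α ≠ 0 := hA
        field_simp
      apply mul_right_cancel₀ h0
      linear_combination h - this
    have hτy : τ (t + ρ) = -(t + ρ) := by
      rw [map_add, hτt, hρ, AlgEquiv.commutes]; ring
    set y := t + ρ with hy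
    have hy1 : 1 - y ≠ 0 := by
      intro h1
      have := lin (α := -1) (β := 1 - β / α / 2) (by
        rw [← h1, hy, hρ]; simp only [map_sub, map_neg, map_one]; ring)
      simp at this
    have hy2 : 1 + y ≠ 0 := by
      intro h1
      have := lin (α := 1) (β := 1 + β / α / 2) (by
        rw [← h1, hy, hρ]; simp only [map_add, map_one]; ring)
      simp at this
    refine ⟨(1 + y) / (1 - y), 1, hgen _ ?_, one_ne_zero, ?_⟩
    · set x := (1 + y) / (1 - y) with hx
      have hxm : x ∈ K⟮x⟯ := mem_adjoin_simple_self K x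
      have e : t = (x - 1) / (x + 1) - ρ := by
        have hx1 : x + 1 = 2 / (1 - y) := by rw [hx]; field_simp; ring
        have hx2 : x - 1 = 2 * y / (1 - y) := by rw [hx]; field_simp; ring
        rw [hx1, hx2]
        field_simp
        rw [hy]; ring
      have := sub_mem (div_mem (sub_mem hxm (one_mem _)) (add_mem hxm (one_mem _)))
        (IntermediateField.algebraMap_mem K⟮x⟯ (β / α / 2))
      rwa [← hρ, ← e] at this
    · rw [map_div₀, map_add, map_sub, map_one, hτy, map_one, sub_neg_eq_add, ← sub_eq_add_neg]
      field_simp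
  · have hC : C ≠ 0 := by simpa [C] using hγ
    -- The denominator of the Möbius transformation is the required generator; f is minus the
    -- determinant.
    have hx : (C * t + -A) * τ (C * t + -A) = A ^ 2 + C * B := by
      have : τ (C * t + -A) = C * τ t - A := by simp [C, A, sub_eq_add_neg]
      rw [this]
      linear_combination C * h
    refine ⟨C * t + -A, α ^ 2 + γ * β, hgen _ ?_, ?_, by rw [hx]; simp [A, B, C]⟩
    · set x := C * t + -A with hx
      have hxm : x ∈ K⟮x⟯ := mem_adjoin_simple_self K x
      have e : t = (x + A) / C := by rw [hx]; field_simp; ring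
      rw [e]
      exact div_mem (add_mem hxm (IntermediateField.algebraMap_mem _ _)) (IntermediateField.algebraMap_mem _ _)
    · intro hz
      have hz' : A ^ 2 + C * B = 0 := by simpa [A, B, C] using congrArg (algebraMap K L) hz
      rw [hz', mul_eq_zero] at hx
      rcases hx with hx | hx
      · exact h0 hx
      · exact h0 (by simpa only [EmbeddingLike.map_eq_zero_iff] using hx)

end FunctionFieldOfConic

/-! ### Formally étale maps from a polynomial ring in two variables -/

section FormallyEtale

namespace RingHom.FormallyEtale

variable {R B C D : Type} [CommRing R] [CommRing B] [CommRing C] [CommRing D] {g : R →+* B}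

/-- Together with `exists_lift`, this makes infinitesimal lifting available for bare ring
homomorphisms. Different maps from the same ring can then be compared without fixing algebra
instances. -/
lemma eq_of_comp_eq (hg : g.FormallyEtale) {π : C →+* D} (hπ : IsNilpotent (RingHom.ker π))
    {θ₁ θ₂ : B →+* C} (h : π.comp θ₁ = π.comp θ₂) (h' : θ₁.comp g = θ₂.comp g) : θ₁ = θ₂ := by
  algebraize [g, θ₁.comp g]
  let f₁ : B →ₐ[R] C := { θ₁ with commutes' := fun r => rfl }
  let f₂ : B →ₐ[R] C := { θ₂ with commutes' := fun r => (congr($h' r)).symm }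
  have : f₁ = f₂ := Algebra.FormallyUnramified.ext' π hπ f₁ f₂ (fun x => congr($h x))
  ext x
  exact congr($this x)

lemma exists_lift (hg : g.FormallyEtale) {π : C →+* D} (hπ : IsNilpotent (RingHom.ker π))
    (hs : Function.Surjective π) {θ : R →+* C} {φ : B →+* D} (h : φ.comp g = π.comp θ) :
    ∃ ψ : B →+* C, ψ.comp g = θ ∧ π.comp ψ = φ := by
  algebraize [g, θ, π.comp θ]
  let f : B →ₐ[R] D := { φ with commutes' := fun r => congr($h r) }
  let p : C →ₐ[R] D := { π with commutes' := fun r => rfl }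
  refine ⟨(Algebra.FormallySmooth.liftOfSurjective f p hs hπ).toRingHom, ?_, ?_⟩
  · ext x
    exact (Algebra.FormallySmooth.liftOfSurjective f p hs hπ).commutes x
  · ext x
    exact Algebra.FormallySmooth.liftOfSurjective_apply f p hs hπ x

lemma of_bijective (h : Function.Bijective g) : g.FormallyEtale := by
  algebraize [g]
  exact Algebra.FormallyEtale.of_equiv (AlgEquiv.ofBijective (Algebra.ofId R B) h)

end RingHom.FormallyEtale

lemma TrivSqZeroExt.isNilpotent_ker_fstHom (K M : Type) [CommRing K] [AddCommGroup M] [Module K M]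
    [Module Kᵐᵒᵖ M] [IsCentralScalar K M] :
    IsNilpotent (RingHom.ker (TrivSqZeroExt.fstHom K K M).toRingHom) :=
  ⟨2, TrivSqZeroExt.kerIdeal_sq K M⟩

/-- A surface has no three independent tangent vectors. -/
lemma RingHom.FormallyEtale.exists_map_comp_eq {B F : Type} [CommRing B] [Field F]
    {g : MvPolynomial (Fin 2) ℝ →+* B} (hg : g.FormallyEtale)
    (Θ : B →+* TrivSqZeroExt F (Fin 3 → F))
    (hΘ : ∀ r : ℝ, (Θ (g (C r))).snd = 0) :
    ∃ l : (Fin 3 → F) →ₗ[F] F, l ≠ 0 ∧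
      (TrivSqZeroExt.map l).toRingHom.comp Θ =
        (TrivSqZeroExt.map (0 : (Fin 3 → F) →ₗ[F] F)).toRingHom.comp Θ := by
  -- The two tangent components of the étale coordinates cannot span F³, so a nonzero functional
  -- kills both.
  obtain ⟨l, hl, hl0⟩ : ∃ l : (Fin 3 → F) →ₗ[F] F, l ≠ 0 ∧
      ∀ i, l (Θ (g (X i))).snd = 0 := by
    have h := Submodule.exists_le_ker_of_lt_top
      (Submodule.span F (Set.range fun i => (Θ (g (X i))).snd)) (by
        refine Submodule.lt_top_of_finrank_lt_finrank ((finrank_range_le_card _).trans_lt ?_)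
        simp)
    obtain ⟨l, hl, h⟩ := h
    exact ⟨l, hl, fun i => h (Submodule.subset_span ⟨i, rfl⟩)⟩
  refine ⟨l, hl, hg.eq_of_comp_eq (TrivSqZeroExt.isNilpotent_ker_fstHom F F) ?_ ?_⟩
  · ext x
    simp
  · refine MvPolynomial.ringHom_ext (fun r => ?_) (fun i => ?_)
    · ext <;> simp [hΘ]
    · ext <;> simp [hl0]

/-- The function field of a surface is not algebraic over a field `K` of transcendence degree
one. -/
lemma RingHom.FormallyEtale.not_isAlgebraic {K L : Type} [Field K] [Field L] [Algebra K L]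
    [Algebra (Polynomial ℝ) K] [IsFractionRing (Polynomial ℝ) K]
    {g : MvPolynomial (Fin 2) ℝ →+* L} (hg : g.FormallyEtale)
    (hgK : ∀ r : ℝ, g (C r) = algebraMap K L (algebraMap (Polynomial ℝ) K (Polynomial.C r))) :
    ¬ Algebra.IsAlgebraic K L := by
  intro halg
  -- An algebraic extension in characteristic zero is formally étale, so ℝ-derivations of L would be
  -- determined by their value at s and form a space of dimension at most one. Étaleness over ℝ[x,
  -- y] produces a two-dimensional space of them.
  have : CharZero K := by
    let f := (algebraMap (Polynomial ℝ) K).comp Polynomial.C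
    exact charZero_of_injective_ringHom f.injective
  have hKL : (algebraMap K L).FormallyEtale := by
    rw [RingHom.formallyEtale_algebraMap]
    exact Algebra.FormallyEtale.of_isSeparable K L
  have hnil := TrivSqZeroExt.isNilpotent_ker_fstHom L L
  set fst := (TrivSqZeroExt.fstHom L L L).toRingHom with hfst
  have hsurj : Function.Surjective fst := fun x => ⟨TrivSqZeroExt.inl x, rfl⟩
  set s := algebraMap K L (algebraMap (Polynomial ℝ) K Polynomial.X)
  -- homs to the dual numbers are determined by the value at `s`
  have uniq (θ : L →+* TrivSqZeroExt L L) (h1 : fst.comp θ = RingHom.id L)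
      (h2 : (θ s).snd = 0) (h3 : ∀ r : ℝ, (θ (g (C r))).snd = 0) :
      θ = (TrivSqZeroExt.inlHom L L) := by
    refine hKL.eq_of_comp_eq hnil (π := fst) (by rw [h1]; rfl) ?_
    refine IsLocalization.ringHom_ext (nonZeroDivisors (Polynomial ℝ)) ?_
    have hf (x : L) : (θ x).fst = x := congr($h1 x)
    refine Polynomial.ringHom_ext (fun r => ?_) ?_
    · ext
      · simp [hf]
      · simp [← hgK, h3]
    · ext
      · simp [hf]
      · simpa using h2
  -- Sections of the dual numbers over L are derivations; this one has prescribed values v on the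
  -- two étale coordinates.
  have ext (v : Fin 2 → L) : ∃ θ : L →+* TrivSqZeroExt L L, fst.comp θ = RingHom.id L ∧
      (∀ r : ℝ, (θ (g (C r))).snd = 0) ∧ ∀ i, (θ (g (X i))).snd = v i := by
    obtain ⟨ψ, h1, h2⟩ := hg.exists_lift hnil hsurj (φ := RingHom.id L)
      (θ := eval₂Hom ((TrivSqZeroExt.inlHom L L).comp (g.comp C))
        (fun i => TrivSqZeroExt.inl (g (X i)) + TrivSqZeroExt.inr (v i))) (by
        refine MvPolynomial.ringHom_ext (fun r => ?_) (fun i => ?_)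
        · simp [fst]
        · simp [fst])
    refine ⟨ψ, h2, fun r => ?_, fun i => ?_⟩
    · have := congr($h1 (C r))
      simp only [RingHom.comp_apply] at this
      rw [this]; simp
    · have := congr($h1 (X i))
      simp only [RingHom.comp_apply] at this
      rw [this]; simp
  choose θ hθ1 hθ2 hθ3 using ext
  have key (v : Fin 2 → L) (h : (θ v s).snd = 0) : v = 0 := by
    have := uniq (θ v) (hθ1 v) h (hθ2 v)
    ext i
    rw [← hθ3 v i, this]
    simp
  -- the value at `s` is linear in `v`
  have combo (v w : Fin 2 → L) (c d : L) :
      (θ (c • v + d • w) s).snd = c * (θ v s).snd + d * (θ w s).snd := by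
    have hf (v) (x : L) : (θ v x).fst = x := congr($(hθ1 v) x)
    let η : L →+* TrivSqZeroExt L L :=
      { toFun := fun x => TrivSqZeroExt.inl x +
          TrivSqZeroExt.inr (c * (θ v x).snd + d * (θ w x).snd)
        map_one' := by ext <;> simp
        map_zero' := by ext <;> simp
        map_add' := fun x y => by
          ext
          · simp
          · simp; ring
        map_mul' := fun x y => by
          ext
          · simp
          · simp [hf]; ring }
    have : θ (c • v + d • w) = η := by
      refine hg.eq_of_comp_eq hnil (π := fst) ?_ ?_
      · rw [hθ1]; ext x; simp [η, fst]
      · refine MvPolynomial.ringHom_ext (fun r => ?_) (fun i => ?_)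
        · ext
          · simp [hf, η]
          · simp [hθ2, η]
        · ext
          · simp [hf, η]
          · simp [hθ3, η]
    rw [this]
    simp [η]
  set e₀ : Fin 2 → L := ![1, 0]
  set e₁ : Fin 2 → L := ![0, 1]
  -- This combination of the two basic derivations is chosen to vanish at s.
  have h0 := key ((θ e₁ s).snd • e₀ + (-(θ e₀ s).snd) • e₁) (by rw [combo]; ring)
  have h1 : (θ e₁ s).snd = 0 := by simpa [e₀, e₁] using congrFun h0 0
  have := congrFun (key e₁ h1) 1
  simp [e₁] at this

/-! ### Sums of squares in the local ring of a smooth surface at a real point -/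

section RealPoint

variable {B : Type} [CommRing B] {g : MvPolynomial (Fin 2) ℝ →+* B} {p : B →+* ℝ}

/-- The powers of the maximal ideal of a real point pull back to the powers of `(x, y)`. -/
lemma RingHom.FormallyEtale.mem_pow_idealOfVars (hg : g.FormallyEtale)
    (hC : ∀ r, p (g (C r)) = r) (hX : ∀ i, p (g (X i)) = 0) {n : ℕ} {q : MvPolynomial (Fin 2) ℝ}
    (hq : g q ∈ RingHom.ker p ^ n) : q ∈ idealOfVars (Fin 2) ℝ ^ n := by
  set I := idealOfVars (Fin 2) ℝ
  rcases Nat.eq_zero_or_pos n with rfl | hn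
  · simp
  have hI : ∀ x ∈ I, p (g x) = 0 := by
    intro x hx
    have : I ≤ RingHom.ker (p.comp g) := Ideal.span_le.mpr (by rintro _ ⟨i, rfl⟩; exact hX i)
    exact this hx
  have hev : p.comp g = (eval (0 : Fin 2 → ℝ)) :=
    MvPolynomial.ringHom_ext (by simpa using hC) (by simpa using hX)
  have hIev : RingHom.ker (eval (0 : Fin 2 → ℝ)) ≤ I := by
    intro x hx
    rw [← pow_one I, mem_pow_idealOfVars_iff']
    intro d hd
    obtain rfl : d = 0 := by simpa [Finsupp.degree_eq_zero_iff] using hd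
    rw [← constantCoeff_eq]
    have : eval (0 : Fin 2 → ℝ) x = 0 := hx
    rwa [eval_zero] at this
  let π : MvPolynomial (Fin 2) ℝ ⧸ I ^ n →+* ℝ :=
    Ideal.Quotient.lift (I ^ n) (p.comp g) (fun x hx => hI x (Ideal.pow_le_self hn.ne' hx))
  have hker : RingHom.ker π = I.map (Ideal.Quotient.mk (I ^ n)) := by
    refine le_antisymm ?_ ?_
    · intro x hx
      obtain ⟨x, rfl⟩ := Ideal.Quotient.mk_surjective x
      exact Ideal.mem_map_of_mem _ (hIev (by rw [← hev]; exact hx))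
    · rw [Ideal.map_le_iff_le_comap]
      exact fun x hx => hI x hx
  have hnil : IsNilpotent (RingHom.ker π) := by
    refine ⟨n, ?_⟩
    rw [hker, ← Ideal.map_pow, Ideal.map_quotient_self, Ideal.zero_eq_bot]
  have hsurj : Function.Surjective π := fun r => ⟨Ideal.Quotient.mk _ (C r), hC r⟩
  -- The point p lifts to θ from B to the n-th infinitesimal neighbourhood of the origin. Since θ ∘
  -- g is the quotient map and θ kills the n-th power of the maximal ideal, q vanishes modulo Iⁿ.
  obtain ⟨θ, h1, h2⟩ := hg.exists_lift hnil hsurj (θ := Ideal.Quotient.mk (I ^ n)) (φ := p) rfl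
  have hle : RingHom.ker p ≤ (RingHom.ker π).comap θ := by
    intro x hx
    change π (θ x) = 0
    rw [← RingHom.comp_apply, h2]
    exact hx
  have : θ (g q) ∈ RingHom.ker π ^ n :=
    (Ideal.pow_right_mono hle n).trans (Ideal.le_comap_pow θ n) hq
  rw [hker, ← Ideal.map_pow, Ideal.map_quotient_self, Ideal.mem_bot, ← RingHom.comp_apply, h1,
    Ideal.Quotient.eq_zero_iff_mem] at this
  exact this

/-- Let m be the kernel of p and J = (x, y)B + m². The quotient map B → B/J and the map b ↦ p(b)
agree on ℝ[x, y] and modulo the square-zero ideal m/J, so formal unramifiedness makes them equal,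
which gives m ⊆ J. -/
lemma RingHom.FormallyEtale.ker_le (hg : g.FormallyEtale)
    (hC : ∀ r, p (g (C r)) = r) (hX : ∀ i, p (g (X i)) = 0) :
    RingHom.ker p ≤ (idealOfVars (Fin 2) ℝ).map g ⊔ RingHom.ker p ^ 2 := by
  set J := (idealOfVars (Fin 2) ℝ).map g ⊔ RingHom.ker p ^ 2
  have hJ : J ≤ RingHom.ker p := by
    refine sup_le ?_ (Ideal.pow_le_self two_ne_zero)
    rw [Ideal.map_le_iff_le_comap]
    exact Ideal.span_le.mpr (by rintro _ ⟨i, rfl⟩; exact hX i)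
  let π : B ⧸ J →+* ℝ := Ideal.Quotient.lift J p (fun x hx => hJ hx)
  have hker : RingHom.ker π = (RingHom.ker p).map (Ideal.Quotient.mk J) := by
    refine le_antisymm ?_ ?_
    · intro x hx
      obtain ⟨x, rfl⟩ := Ideal.Quotient.mk_surjective x
      exact Ideal.mem_map_of_mem _ hx
    · rw [Ideal.map_le_iff_le_comap]
      exact fun x hx => hx
  have hnil : IsNilpotent (RingHom.ker π) := by
    refine ⟨2, ?_⟩
    rw [hker, ← Ideal.map_pow, Ideal.zero_eq_bot, eq_bot_iff, Ideal.map_le_iff_le_comap]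
    intro x hx
    exact Ideal.Quotient.eq_zero_iff_mem.mpr (le_sup_right (a := (idealOfVars (Fin 2) ℝ).map g) hx)
  have key : Ideal.Quotient.mk J = ((Ideal.Quotient.mk J).comp (g.comp C)).comp p := by
    refine hg.eq_of_comp_eq hnil ?_ ?_
    · ext x
      change p x = p (g (C (p x)))
      rw [hC]
    · refine MvPolynomial.ringHom_ext (fun r => by simp [hC]) (fun i => ?_)
      simp only [RingHom.comp_apply, hX, map_zero]
      exact Ideal.Quotient.eq_zero_iff_mem.mpr (Ideal.mem_sup_left
        (Ideal.mem_map_of_mem _ (Ideal.subset_span ⟨i, rfl⟩)))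
  intro x hx
  rw [← Ideal.Quotient.eq_zero_iff_mem, key, RingHom.comp_apply, RingHom.mem_ker.mp hx, map_zero]

/-- Every element of B has a polynomial leading form. By `ker_le`, mⁿ is generated modulo mⁿ⁺¹ by
polynomials in Iⁿ, and a coefficient in B may be replaced by its value at the point at the cost of
one more order. -/
lemma RingHom.FormallyEtale.exists_sub_mem_pow (hg : g.FormallyEtale)
    (hC : ∀ r, p (g (C r)) = r) (hX : ∀ i, p (g (X i)) = 0) {n : ℕ} {y : B}
    (hy : y ∈ RingHom.ker p ^ n) :
    ∃ q ∈ idealOfVars (Fin 2) ℝ ^ n, y - g q ∈ RingHom.ker p ^ (n + 1) := by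
  set I := idealOfVars (Fin 2) ℝ
  set m := RingHom.ker p
  have hIm : I.map g ≤ m := by
    rw [Ideal.map_le_iff_le_comap]
    exact Ideal.span_le.mpr (by rintro _ ⟨i, rfl⟩; exact hX i)
  have hImn (n : ℕ) : (I ^ n).map g ≤ m ^ n := by
    rw [Ideal.map_pow]
    exact Ideal.pow_right_mono hIm n
  have h1 (n : ℕ) : m ^ n ≤ (I ^ n).map g ⊔ m ^ (n + 1) := by
    induction n with
    | zero => simp [Ideal.map_top]
    | succ n ih =>
      rw [pow_succ]
      refine (Ideal.mul_mono ih (hg.ker_le hC hX)).trans ?_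
      rw [Ideal.sup_mul, Ideal.mul_sup, Ideal.mul_sup]
      refine sup_le (sup_le ?_ ?_) (sup_le ?_ ?_)
      · rw [← Ideal.map_mul, ← pow_succ]
        exact le_sup_left
      · exact ((Ideal.mul_mono_left (hImn n)).trans (by rw [← pow_add])).trans le_sup_right
      · exact ((Ideal.mul_mono_right hIm).trans (by rw [← pow_succ])).trans le_sup_right
      · refine le_trans ?_ le_sup_right
        rw [← pow_add]
        exact Ideal.pow_le_pow_right (by omega)
  have h2 : ∀ y ∈ (I ^ n).map g, ∃ q ∈ I ^ n, y - g q ∈ m ^ (n + 1) := by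
    intro y hy
    induction hy using Submodule.span_induction with
    | mem y hy =>
      obtain ⟨q, hq, rfl⟩ := hy
      exact ⟨q, hq, by simp⟩
    | zero => exact ⟨0, zero_mem _, by simp⟩
    | add y z _ _ hy hz =>
      obtain ⟨q, hq, hy⟩ := hy
      obtain ⟨r, hr, hz⟩ := hz
      refine ⟨q + r, add_mem hq hr, ?_⟩
      have := add_mem hy hz
      rwa [sub_add_sub_comm, ← map_add] at this
    | smul b y _ hy =>
      obtain ⟨q, hq, hy⟩ := hy
      refine ⟨C (p b) * q, Ideal.mul_mem_left _ _ hq, ?_⟩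
      have e : b • y - g (C (p b) * q) = b * (y - g q) + g q * (b - g (C (p b))) := by
        rw [map_mul, smul_eq_mul]; ring
      rw [e]
      refine add_mem (Ideal.mul_mem_left _ _ hy) ?_
      rw [pow_succ]
      exact Ideal.mul_mem_mul (hImn n (Ideal.mem_map_of_mem _ hq))
        (by simp [m, RingHom.mem_ker, hC])
  obtain ⟨u, hu, v, hv, rfl⟩ := Submodule.mem_sup.mp (h1 n hy)
  obtain ⟨q, hq, h⟩ := h2 u hu
  refine ⟨q, hq, ?_⟩
  rw [add_sub_right_comm]
  exact add_mem h hv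

/-- The restriction of a polynomial to the line through the origin with direction `v`. -/
noncomputable abbrev restrictToLine (v : Fin 2 → ℝ) : MvPolynomial (Fin 2) ℝ →ₐ[ℝ] Polynomial ℝ :=
  aeval fun i => Polynomial.C (v i) * Polynomial.X

lemma restrictToLine_apply (v : Fin 2 → ℝ) (q : MvPolynomial (Fin 2) ℝ) (n : ℕ) :
    (restrictToLine v q).coeff n = eval v (homogeneousComponent n q) := by
  induction q using MvPolynomial.induction_on' with
  | monomial d c =>
    have h : restrictToLine v (monomial d c) =
        Polynomial.monomial d.degree (c * eval v (monomial d 1)) := by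
      rw [aeval_monomial, eval_monomial, Finsupp.degree_eq_sum, Finsupp.prod_fintype _ _ (by simp),
        Finsupp.prod_fintype _ _ (by simp), ← Polynomial.C_mul_X_pow_eq_monomial]
      simp only [Fin.prod_univ_two, Fin.sum_univ_two, mul_pow, one_mul, Polynomial.algebraMap_eq,
        map_mul, map_pow, pow_add]
      ring
    rw [h, Polynomial.coeff_monomial,
      homogeneousComponent_of_mem (isHomogeneous_monomial c rfl)]
    by_cases hd : d.degree = n
    · rw [if_pos hd, if_pos hd.symm, eval_monomial, eval_monomial, one_mul]
    · rw [if_neg hd, if_neg (Ne.symm hd), map_zero]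
  | add p q hp hq => rw [map_add, Polynomial.coeff_add, hp, hq, map_add, map_add]

/-- A form over the infinite field ℝ that vanishes at every vector is zero, so the order of
vanishing can be tested on lines through the origin. -/
lemma mem_pow_idealOfVars_succ_iff {n : ℕ} {q : MvPolynomial (Fin 2) ℝ}
    (hq : q ∈ idealOfVars (Fin 2) ℝ ^ n) :
    q ∈ idealOfVars (Fin 2) ℝ ^ (n + 1) ↔ ∀ v, (restrictToLine v q).coeff n = 0 := by
  rw [mem_pow_idealOfVars_iff'] at hq ⊢
  simp_rw [restrictToLine_apply]
  constructor
  · intro h v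
    have : homogeneousComponent n q = 0 := by
      ext d
      rw [coeff_homogeneousComponent]
      split_ifs with hd
      · simpa using h d (by omega)
      · simp
    rw [this, map_zero]
  · intro h d hd
    have h0 : homogeneousComponent n q = 0 := MvPolynomial.funext (by simpa using h)
    rcases Nat.lt_succ_iff_lt_or_eq.mp hd with hd | hd
    · exact hq d hd
    · have := congrArg (coeff d) h0
      rwa [coeff_homogeneousComponent, if_pos hd, coeff_zero] at this

lemma X_pow_dvd_restrictToLine {n : ℕ} {q : MvPolynomial (Fin 2) ℝ}
    (hq : q ∈ idealOfVars (Fin 2) ℝ ^ n) (v : Fin 2 → ℝ) :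
    Polynomial.X ^ n ∣ restrictToLine v q := by
  rw [Polynomial.X_pow_dvd_iff]
  intro d hd
  induction n with
  | zero => omega
  | succ n ih =>
    have hq' := Ideal.pow_le_pow_right (n.le_succ) hq
    rcases Nat.lt_succ_iff_lt_or_eq.mp hd with hd | rfl
    · exact ih hq' hd
    · exact (mem_pow_idealOfVars_succ_iff hq').mp hq v

/-- A polynomial all of whose leading forms satisfy `a x² + b y² = z²` with `a, b < 0`. -/
lemma mem_pow_idealOfVars_succ_of_sq {a b : ℝ} (ha : a < 0) (hb : b < 0) {n : ℕ}
    {x y z : MvPolynomial (Fin 2) ℝ}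
    (hx : x ∈ idealOfVars (Fin 2) ℝ ^ n) (hy : y ∈ idealOfVars (Fin 2) ℝ ^ n)
    (hz : z ∈ idealOfVars (Fin 2) ℝ ^ n)
    (h : C a * x ^ 2 + C b * y ^ 2 - z ^ 2 ∈ idealOfVars (Fin 2) ℝ ^ (2 * n + 1)) :
    x ∈ idealOfVars (Fin 2) ℝ ^ (n + 1) ∧ y ∈ idealOfVars (Fin 2) ℝ ^ (n + 1) ∧
      z ∈ idealOfVars (Fin 2) ℝ ^ (n + 1) := by
  rw [mem_pow_idealOfVars_succ_iff hx, mem_pow_idealOfVars_succ_iff hy,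
    mem_pow_idealOfVars_succ_iff hz, ← forall_and, ← forall_and]
  intro v
  obtain ⟨u, hu⟩ := X_pow_dvd_restrictToLine hx v
  obtain ⟨w, hw⟩ := X_pow_dvd_restrictToLine hy v
  obtain ⟨r, hr⟩ := X_pow_dvd_restrictToLine hz v
  obtain ⟨k, hk⟩ := X_pow_dvd_restrictToLine h v
  have hc (p : Polynomial ℝ) : (Polynomial.X ^ n * p).coeff n = p.coeff 0 := by
    simpa using Polynomial.coeff_X_pow_mul p n 0
  rw [hu, hw, hr, hc, hc, hc]
  have e : Polynomial.C a * u ^ 2 + Polynomial.C b * w ^ 2 - r ^ 2 = Polynomial.X * k := by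
    apply mul_left_cancel₀ (pow_ne_zero (2 * n) (Polynomial.X_ne_zero (R := ℝ)))
    rw [map_sub, map_add, map_mul, map_mul, map_pow, map_pow, map_pow, hu, hw, hr] at hk
    simp only [algHom_C, Polynomial.algebraMap_eq] at hk
    rw [← mul_assoc, ← pow_succ, ← hk]
    ring
  -- The constant terms satisfy a u₀² + b w₀² = r₀² with a, b < 0, so all three vanish.
  have e0 := congrArg (Polynomial.coeff · 0) e
  simp only [Polynomial.coeff_sub, Polynomial.coeff_add, Polynomial.mul_coeff_zero, pow_two,
    Polynomial.coeff_C_zero, Polynomial.coeff_X_zero, zero_mul] at e0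
  have hu0 := mul_nonneg (neg_pos.mpr ha).le (mul_self_nonneg (u.coeff 0))
  have hw0 := mul_nonneg (neg_pos.mpr hb).le (mul_self_nonneg (w.coeff 0))
  have hr0 := mul_self_nonneg (r.coeff 0)
  refine ⟨?_, ?_, ?_⟩
  · have : -a * (u.coeff 0 * u.coeff 0) = 0 := by linarith
    simpa [ha.ne] using this
  · have : -b * (w.coeff 0 * w.coeff 0) = 0 := by linarith
    simpa [hb.ne] using this
  · have : r.coeff 0 * r.coeff 0 = 0 := by linarith
    simpa using this

/-- By induction x, y, z lie in every power of the maximal ideal, because their leading forms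
satisfy a definite relation over ℝ. Krull's intersection theorem then makes them zero. -/
lemma RingHom.FormallyEtale.eq_zero_of_sq_add_sq_aux [IsDomain B] [IsNoetherianRing B]
    (hg : g.FormallyEtale) (hC : ∀ r, p (g (C r)) = r) (hX : ∀ i, p (g (X i)) = 0)
    {a b x y z : B} (ha : p a < 0) (hb : p b < 0) (h : a * x ^ 2 + b * y ^ 2 = z ^ 2) :
    x = 0 ∧ y = 0 ∧ z = 0 := by
  set m := RingHom.ker p with hm
  suffices H : ∀ n, x ∈ m ^ n ∧ y ∈ m ^ n ∧ z ∈ m ^ n by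
    have hbot := Ideal.iInf_pow_eq_bot_of_isDomain m (RingHom.ker_ne_top p)
    refine ⟨?_, ?_, ?_⟩ <;> rw [← Ideal.mem_bot, ← hbot, Ideal.mem_iInf]
    exacts [fun n => (H n).1, fun n => (H n).2.1, fun n => (H n).2.2]
  intro n
  induction n with
  | zero => simp
  | succ n ih =>
    obtain ⟨hx, hy, hz⟩ := ih
    obtain ⟨x', hx', hxx'⟩ := hg.exists_sub_mem_pow hC hX hx
    obtain ⟨y', hy', hyy'⟩ := hg.exists_sub_mem_pow hC hX hy
    obtain ⟨z', hz', hzz'⟩ := hg.exists_sub_mem_pow hC hX hz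
    have hImn : (idealOfVars (Fin 2) ℝ ^ n).map g ≤ m ^ n := by
      rw [Ideal.map_pow]
      refine Ideal.pow_right_mono ?_ n
      rw [Ideal.map_le_iff_le_comap]
      exact Ideal.span_le.mpr (by rintro _ ⟨i, rfl⟩; exact hX i)
    have hIm1 : (idealOfVars (Fin 2) ℝ ^ (n + 1)).map g ≤ m ^ (n + 1) := by
      rw [Ideal.map_pow]
      refine Ideal.pow_right_mono ?_ _
      rw [Ideal.map_le_iff_le_comap]
      exact Ideal.span_le.mpr (by rintro _ ⟨i, rfl⟩; exact hX i)
    -- Replacing a coefficient by its value at the point, and u by its polynomial leading part,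
    -- changes c u² only in order 2n + 1.
    have sq {u u' : B} (c : B) (hu : u ∈ m ^ n) (hu' : u' ∈ m ^ n) (h : u - u' ∈ m ^ (n + 1)) :
        c * u ^ 2 - g (C (p c)) * u' ^ 2 ∈ m ^ (2 * n + 1) := by
      have e : c * u ^ 2 - g (C (p c)) * u' ^ 2 = c * ((u - u') * (u + u')) +
          (c - g (C (p c))) * (u' * u') := by ring
      rw [e]
      refine add_mem (Ideal.mul_mem_left _ _ ?_) ?_
      · have := Ideal.mul_mem_mul h (add_mem hu hu')
        rwa [← pow_add, show n + 1 + n = 2 * n + 1 by ring] at this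
      · have h1 : c - g (C (p c)) ∈ m ^ 1 := by simp [hm, RingHom.mem_ker, hC]
        have := Ideal.mul_mem_mul h1 (Ideal.mul_mem_mul hu' hu')
        rwa [← pow_add, ← pow_add, show 1 + (n + n) = 2 * n + 1 by ring] at this
    have hG : g (C (p a) * x' ^ 2 + C (p b) * y' ^ 2 - z' ^ 2) ∈ m ^ (2 * n + 1) := by
      have h1 := sq a hx (hImn (Ideal.mem_map_of_mem g hx')) hxx'
      have h2 := sq b hy (hImn (Ideal.mem_map_of_mem g hy')) hyy'
      have h3 := sq 1 hz (hImn (Ideal.mem_map_of_mem g hz')) hzz'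
      have := neg_mem (sub_mem (add_mem h1 h2) h3)
      have e : g (C (p a) * x' ^ 2 + C (p b) * y' ^ 2 - z' ^ 2) =
          -(a * x ^ 2 - g (C (p a)) * g x' ^ 2 + (b * y ^ 2 - g (C (p b)) * g y' ^ 2) -
            (1 * z ^ 2 - g (C (p 1)) * g z' ^ 2)) := by
        simp only [map_sub, map_add, map_mul, map_pow, map_one]
        linear_combination h
      rwa [e]
    obtain ⟨h1, h2, h3⟩ := mem_pow_idealOfVars_succ_of_sq ha hb hx' hy' hz'
      (hg.mem_pow_idealOfVars hC hX hG)
    refine ⟨?_, ?_, ?_⟩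
    · simpa using add_mem hxx' (hIm1 (Ideal.mem_map_of_mem g h1))
    · simpa using add_mem hyy' (hIm1 (Ideal.mem_map_of_mem g h2))
    · simpa using add_mem hzz' (hIm1 (Ideal.mem_map_of_mem g h3))

/-- In the local ring of a smooth real surface at a real point, `a x² + b y² = z²` has only the
trivial solution if `a` and `b` are negative at the point. -/
theorem RingHom.FormallyEtale.eq_zero_of_sq_add_sq [IsDomain B] [IsNoetherianRing B]
    (hg : g.FormallyEtale) (hC : ∀ r, p (g (C r)) = r)
    {a b x y z : B} (ha : p a < 0) (hb : p b < 0) (h : a * x ^ 2 + b * y ^ 2 = z ^ 2) :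
    x = 0 ∧ y = 0 ∧ z = 0 := by
  -- Translating the étale coordinates moves the image of the point to the origin.
  let t (c : Fin 2 → ℝ) : MvPolynomial (Fin 2) ℝ →ₐ[ℝ] MvPolynomial (Fin 2) ℝ :=
    aeval fun i => X i + C (c i)
  have ht (c d : Fin 2 → ℝ) (hcd : c + d = 0) : (t c).comp (t d) = AlgHom.id ℝ _ := by
    ext1 i
    have : c i + d i = 0 := congrFun hcd i
    simp [t, add_assoc, ← C_add, this]
  set c : Fin 2 → ℝ := fun i => -p (g (X i))
  let e := AlgEquiv.ofAlgHom (t c) (t (-c)) (ht _ _ (by simp)) (ht _ _ (by simp))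
  have he : (t c).toRingHom.FormallyEtale := by
    exact RingHom.FormallyEtale.of_bijective e.bijective
  refine RingHom.FormallyEtale.eq_zero_of_sq_add_sq_aux (he.comp hg) (p := p) ?_ ?_ ha hb h
  · simp [t, hC]
  · simp [t, hC, c]

end RealPoint

end FormallyEtale

/-! ### Homogenisation of squarefree polynomials -/

section Homogenization

variable {R : Type*} [CommRing R] {σ : Type*}

/-- `p(x) ↦ p(T x)`. -/
noncomputable abbrev scaleVars (σ R : Type*) [CommRing R] :
    MvPolynomial σ R →ₐ[R] Polynomial (MvPolynomial σ R) :=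
  aeval fun i => Polynomial.C (X i) * Polynomial.X

lemma scaleVars_monomial (d : σ →₀ ℕ) (c : R) :
    scaleVars σ R (monomial d c) = Polynomial.monomial d.degree (monomial d c) := by
  rw [aeval_monomial, ← Polynomial.C_mul_X_pow_eq_monomial, monomial_eq, map_mul, mul_assoc]
  congr 1
  simp only [Finsupp.prod, mul_pow, Finset.prod_mul_distrib, map_prod, map_pow,
    Finset.prod_pow_eq_pow_sum, Finsupp.degree_apply]

lemma coeff_scaleVars (q : MvPolynomial σ R) (n : ℕ) :
    (scaleVars σ R q).coeff n = homogeneousComponent n q := by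
  induction q using MvPolynomial.induction_on' with
  | monomial d c =>
    rw [scaleVars_monomial, Polynomial.coeff_monomial,
      homogeneousComponent_of_mem (isHomogeneous_monomial c rfl)]
    simp only [eq_comm]
  | add p q hp hq => rw [map_add, Polynomial.coeff_add, hp, hq, map_add]

lemma scaleVars_ne_zero {q : MvPolynomial σ R} (hq : q ≠ 0) : scaleVars σ R q ≠ 0 := by
  intro h
  refine hq ?_
  rw [← sum_homogeneousComponent q]
  refine Finset.sum_eq_zero fun i _ => ?_
  rw [← coeff_scaleVars, h, Polynomial.coeff_zero]

lemma MvPolynomial.IsHomogeneous.scaleVars_eq {q : MvPolynomial σ R} {n : ℕ}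
    (hq : q.IsHomogeneous n) : scaleVars σ R q = Polynomial.monomial n q := by
  ext1 k
  rw [coeff_scaleVars, Polynomial.coeff_monomial, homogeneousComponent_of_mem hq]
  simp only [eq_comm]

/-- A factor of a nonzero homogeneous polynomial is homogeneous. -/
lemma MvPolynomial.IsHomogeneous.exists_isHomogeneous_left [IsDomain R] {p q : MvPolynomial σ R} {n : ℕ}
    (h : (p * q).IsHomogeneous n) (h0 : p * q ≠ 0) : ∃ k, p.IsHomogeneous k := by
  have hp := scaleVars_ne_zero (left_ne_zero_of_mul h0)
  have hq := scaleVars_ne_zero (right_ne_zero_of_mul h0)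
  have hs := h.scaleVars_eq
  rw [map_mul] at hs
  -- After the scaling x ↦ T x the product is a monomial in T. Degree and trailing degree are both
  -- additive, so they must coincide for each factor.
  have h1 := Polynomial.natDegree_mul hp hq
  have h2 := Polynomial.natTrailingDegree_mul hp hq
  rw [hs, Polynomial.natDegree_monomial_eq _ h0] at h1
  rw [hs, Polynomial.natTrailingDegree_monomial h0] at h2
  have h3 := Polynomial.natTrailingDegree_le_natDegree (scaleVars σ R p)
  have h4 := Polynomial.natTrailingDegree_le_natDegree (scaleVars σ R q)
  refine ⟨(scaleVars σ R p).natDegree, ?_⟩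
  have : p = homogeneousComponent (scaleVars σ R p).natDegree p := by
    conv_lhs => rw [← sum_homogeneousComponent p]
    rw [Finset.sum_eq_single (scaleVars σ R p).natDegree]
    · intro i _ hi
      rw [← coeff_scaleVars]
      rcases lt_or_gt_of_ne hi with hi | hi
      · exact Polynomial.coeff_eq_zero_of_lt_natTrailingDegree (by omega)
      · exact Polynomial.coeff_eq_zero_of_natDegree_lt hi
    · intro hi
      exact homogeneousComponent_eq_zero (h := by simpa using hi)
  have h5 := homogeneousComponent_isHomogeneous (scaleVars σ R p).natDegree p
  rwa [← this] at h5

/-- `F(z, t) ↦ F(s, 1)`. -/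
noncomputable abbrev dehomogenize : MvPolynomial (Fin 2) ℝ →ₐ[ℝ] Polynomial ℝ :=
  aeval ![Polynomial.X, 1]

lemma natDegree_dehomogenize_le (F : MvPolynomial (Fin 2) ℝ) :
    (dehomogenize F).natDegree ≤ F.totalDegree := by
  rw [aeval_def, eval₂_eq]
  refine Polynomial.natDegree_sum_le_of_forall_le _ _ fun d hd => ?_
  refine (Polynomial.natDegree_mul_le).trans ?_
  have h1 := le_totalDegree hd
  rw [Finsupp.sum_fintype _ _ (by simp)] at h1
  simp only [Polynomial.algebraMap_eq, Polynomial.natDegree_C, zero_add]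
  rw [← Finsupp.prod, Finsupp.prod_fintype _ _ (by simp)]
  simp [Fin.sum_univ_two] at h1 ⊢
  omega

lemma MvPolynomial.IsHomogeneous.eq_zero_of_dehomogenize {F : MvPolynomial (Fin 2) ℝ} {n : ℕ}
    (hF : F.IsHomogeneous n) (h : dehomogenize F = 0) : F = 0 := by
  -- The extra factor X₁ disposes of the vectors with v₁ = 0; elsewhere F(v) = v₁ⁿ F(v₀/v₁, 1).
  suffices hX : F * X 1 = 0 by simpa using hX
  refine MvPolynomial.funext fun v => ?_
  rw [map_mul, map_zero, eval_X]
  by_cases hv : v 1 = 0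
  · rw [hv, mul_zero]
  · rw [mul_eq_zero]
    left
    have e : eval v F = v 1 ^ n * (dehomogenize F).eval (v 0 / v 1) := by
      have h1 : (Polynomial.evalRingHom (v 0 / v 1)).comp (dehomogenize : _ →+* _) =
          eval ![v 0 / v 1, 1] := by
        refine MvPolynomial.ringHom_ext (fun r => by simp) (fun i => ?_)
        fin_cases i <;> simp
      have h2 : (dehomogenize F).eval (v 0 / v 1) = eval ![v 0 / v 1, 1] F := congr($h1 F)
      have h3 : v = v 1 • ![v 0 / v 1, 1] := by
        ext i; fin_cases i <;> simp; field_simp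
      rw [h2]
      conv_lhs => rw [h3]
      have h4 : (Polynomial.eval₂RingHom (eval ![v 0 / v 1, 1]) (v 1)).comp
          (scaleVars (Fin 2) ℝ).toRingHom = eval (v 1 • ![v 0 / v 1, 1]) :=
        by
        refine MvPolynomial.ringHom_ext (fun r => ?_) (fun i => ?_)
        · change Polynomial.eval₂ _ _ (scaleVars (Fin 2) ℝ (C r)) = _
          rw [algHom_C, eval_C]
          change Polynomial.eval₂ _ _ (Polynomial.C (C r)) = _
          rw [Polynomial.eval₂_C, eval_C]
        · change Polynomial.eval₂ _ _ (scaleVars (Fin 2) ℝ (X i)) = _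
          rw [aeval_X, eval_X, Polynomial.eval₂_mul, Polynomial.eval₂_C, Polynomial.eval₂_X,
            eval_X, mul_comm]
          rfl
      rw [← h4]
      change Polynomial.eval₂ _ _ (scaleVars (Fin 2) ℝ F) = _
      rw [hF.scaleVars_eq, Polynomial.eval₂_monomial, mul_comm]
    rw [e, h, Polynomial.eval_zero, mul_zero]

/-- Homogenisation of `f` in degree `n`. -/
noncomputable def homogenize (n : ℕ) (f : Polynomial ℝ) : MvPolynomial (Fin 2) ℝ :=
  ∑ i ∈ Finset.range (n + 1), C (f.coeff i) * X 0 ^ i * X 1 ^ (n - i)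

lemma homogenize_isHomogeneous (n : ℕ) (f : Polynomial ℝ) : (homogenize n f).IsHomogeneous n := by
  refine IsHomogeneous.sum _ _ _ fun i hi => ?_
  have := ((isHomogeneous_C (Fin 2) (f.coeff i)).mul (isHomogeneous_X_pow (R := ℝ) (0 : Fin 2) i)).mul
    (isHomogeneous_X_pow (R := ℝ) (1 : Fin 2) (n - i))
  rw [Finset.mem_range] at hi
  rwa [show 0 + i + (n - i) = n by omega] at this

lemma dehomogenize_homogenize {n : ℕ} {f : Polynomial ℝ} (hf : f.natDegree ≤ n) :
    dehomogenize (homogenize n f) = f := by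
  conv_rhs => rw [f.as_sum_range_C_mul_X_pow' (Nat.lt_succ_of_le hf)]
  simp [homogenize]

/-- A squarefree polynomial is the dehomogenisation of a squarefree form of even degree. -/
theorem exists_squarefree_homogenization {f : Polynomial ℝ} (hf : Squarefree f) :
    ∃ (d : ℕ) (F : MvPolynomial (Fin 2) ℝ), F.IsHomogeneous (2 * d) ∧ Squarefree F ∧
      dehomogenize F = f := by
  -- The degree is rounded up to an even number, so at most one factor t is added. This keeps the
  -- form squarefree.
  obtain ⟨d, hd1, hd2⟩ : ∃ d, f.natDegree ≤ 2 * d ∧ 2 * d ≤ f.natDegree + 1 :=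
    ⟨(f.natDegree + 1) / 2, by omega, by omega⟩
  set F := homogenize (2 * d) f with hF
  have hFh : F.IsHomogeneous (2 * d) := homogenize_isHomogeneous _ _
  have hD : dehomogenize F = f := dehomogenize_homogenize hd1
  refine ⟨d, F, hFh, ?_, hD⟩
  have hF0 : F ≠ 0 := by
    intro h
    rw [h, map_zero] at hD
    exact hf.ne_zero hD.symm
  rintro p ⟨q, hq⟩
  obtain ⟨k, hk⟩ := (show (p * (p * q)).IsHomogeneous (2 * d) by
    rwa [← mul_assoc, ← hq]).exists_isHomogeneous_left (by rwa [← mul_assoc, ← hq])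
  have hu : IsUnit (dehomogenize p) := hf _ ⟨dehomogenize q, by rw [← hD, hq, map_mul, map_mul]⟩
  obtain ⟨c, hc, hcp⟩ := Polynomial.isUnit_iff.mp hu
  have hpk : p = C c * X 1 ^ k := by
    rw [← sub_eq_zero]
    have h2 := (isHomogeneous_C (Fin 2) c).mul (isHomogeneous_X_pow (R := ℝ) (1 : Fin 2) k)
    rw [zero_add] at h2
    refine (hk.sub h2).eq_zero_of_dehomogenize ?_
    simp [← hcp]
  rcases Nat.eq_zero_or_pos k with rfl | hk0
  · rw [hpk, pow_zero, mul_one]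
    exact hc.map C
  -- A repeated factor is c tᵏ with k ≥ 1, which would force deg f ≤ 2d - 2, whereas 2d ≤ deg f + 1.
  · exfalso
    have hq0 : q ≠ 0 := by rintro rfl; simp at hq; exact hF0 hq
    have hp0 : p ≠ 0 := by rintro rfl; simp at hq; exact hF0 hq
    have h1 : F.totalDegree = 2 * d := hFh.totalDegree hF0
    rw [hq, totalDegree_mul_of_isDomain (mul_ne_zero hp0 hp0) hq0,
      totalDegree_mul_of_isDomain hp0 hp0, hk.totalDegree hp0] at h1
    have h2 := natDegree_dehomogenize_le q
    have h3 : f = Polynomial.C (c * c) * dehomogenize q := by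
      rw [← hD, hq, map_mul, map_mul, ← hcp, map_mul]
    have h4 := Polynomial.natDegree_C_mul_le (c * c) (dehomogenize q)
    rw [← h3] at h4
    omega

end Homogenization

/-! ### Diagonalisation of ternary quadratic forms -/

section Diagonalization

variable {K : Type} [Field K]

lemma MvPolynomial.IsHomogeneous.exists_linearMap {n : ℕ} {p : MvPolynomial (Fin n) K}
    (hp : p.IsHomogeneous 1) : ∃ f : (Fin n → K) →ₗ[K] K, ∀ v, f v = eval v p := by
  rw [← mem_homogeneousSubmodule, homogeneousSubmodule_one_eq_span_X] at hp
  induction hp using Submodule.span_induction with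
  | mem p hp =>
    obtain ⟨i, rfl⟩ := hp
    exact ⟨LinearMap.proj i, fun v => by simp⟩
  | zero => exact ⟨0, fun v => by simp⟩
  | add p q _ _ hp hq =>
    obtain ⟨f, hf⟩ := hp
    obtain ⟨g, hg⟩ := hq
    exact ⟨f + g, fun v => by simp [hf, hg]⟩
  | smul c p _ hp =>
    obtain ⟨f, hf⟩ := hp
    exact ⟨c • f, fun v => by simp [hf, smul_eval]⟩

lemma MvPolynomial.IsHomogeneous.exists_quadraticForm {n : ℕ} {p : MvPolynomial (Fin n) K}
    (hp : p.IsHomogeneous 2) : ∃ Q : QuadraticForm K (Fin n → K), ∀ v, Q v = eval v p := by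
  rw [← mem_homogeneousSubmodule, ← homogeneousSubmodule_one_pow, pow_two] at hp
  induction hp using Submodule.mul_induction_on' with
  | mem_mul_mem p hp q hq =>
    obtain ⟨f, hf⟩ := IsHomogeneous.exists_linearMap hp
    obtain ⟨g, hg⟩ := IsHomogeneous.exists_linearMap hq
    exact ⟨QuadraticMap.linMulLin f g, fun v => by simp [hf, hg]⟩
  | add p _ q _ hp hq =>
    obtain ⟨f, hf⟩ := hp
    obtain ⟨g, hg⟩ := hq
    exact ⟨f + g, fun v => by simp [hf, hg]⟩

/-- The polynomial identity with explicit inverse matrices can be transported along any ring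
homomorphism out of K, in particular to nonreduced rings. -/
lemma MvPolynomial.IsHomogeneous.exists_diagonalization [CharZero K] {n : ℕ}
    {q : MvPolynomial (Fin n) K} (hq : q.IsHomogeneous 2) :
    ∃ (M N : Matrix (Fin n) (Fin n) K) (w : Fin n → K), M * N = 1 ∧ N * M = 1 ∧
      MvPolynomial.aeval (fun j => ∑ i, C (M j i) * X i) q = ∑ i, C (w i) * X i ^ 2 := by
  obtain ⟨Q, hQ⟩ := hq.exists_quadraticForm
  have : Invertible (2 : K) := invertibleOfNonzero two_ne_zero
  obtain ⟨w, l, hl⟩ : ∃ (w : Fin n → K) (l : (Fin n → K) ≃ₗ[K] (Fin n → K)),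
      ∀ v, Q (l v) = QuadraticMap.weightedSumSquares K w v := by
    have := QuadraticForm.equivalent_weightedSumSquares Q
    rw [Module.finrank_fin_fun] at this
    obtain ⟨w, ⟨e⟩⟩ := this
    exact ⟨w, e.symm.toLinearEquiv, fun v => e.symm.map_app v⟩
  refine ⟨LinearMap.toMatrix' l.toLinearMap, LinearMap.toMatrix' l.symm.toLinearMap, w, ?_, ?_, ?_⟩
  · rw [← LinearMap.toMatrix'_comp, LinearEquiv.comp_symm, LinearMap.toMatrix'_id]
  · rw [← LinearMap.toMatrix'_comp, LinearEquiv.symm_comp, LinearMap.toMatrix'_id]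
  · refine MvPolynomial.funext fun v => ?_
    set M := LinearMap.toMatrix' l.toLinearMap with hM
    have h1 : MvPolynomial.eval v (MvPolynomial.aeval (fun j => ∑ i, C (M j i) * X i) q) =
        MvPolynomial.eval (fun j => ∑ i, M j i * v i) q := by
      have : (MvPolynomial.eval v).comp (MvPolynomial.aeval (R := K) (S₁ := MvPolynomial (Fin n) K)
          (fun j => ∑ i, C (M j i) * X i) : _ →+* _) =
            MvPolynomial.eval (fun j => ∑ i, M j i * v i) :=
        MvPolynomial.ringHom_ext (fun r => by simp) (fun i => by simp)
      exact congr($this q)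
    have h2 : (fun j => ∑ i, M j i * v i) = l v := by
      change M.mulVec v = _
      rw [hM, LinearMap.toMatrix'_mulVec]
      rfl
    rw [h1, h2, ← hQ, hl, QuadraticMap.weightedSumSquares_apply]
    simp [pow_two]

end Diagonalization

/-! ### Points of `Proj` with values in affine schemes -/

namespace AlgebraicGeometry.Proj

open HomogeneousLocalization

noncomputable section

variable {k A B B' : Type} [CommRing k] [CommRing A] [Algebra k A] [CommRing B] [CommRing B']
variable (𝒜 : ℕ → Submodule k A) [GradedAlgebra 𝒜]

/-- The ring homomorphism `(A_t)₀ → B` induced by `h : A → B` with `h t` invertible. -/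
def awayLift (h : A →+* B) {t : A} (hu : IsUnit (h t)) : Away 𝒜 t →+* B :=
  (Localization.awayLift h t hu).comp (algebraMap (Away 𝒜 t) (Localization.Away t))

lemma awayLift_mul_pow (h : A →+* B) {t : A} (hu : IsUnit (h t)) (z : Away 𝒜 t) (n : ℕ) (x : A)
    (hz : z.val * algebraMap A _ t ^ n = algebraMap A (Localization.Away t) x) :
    awayLift 𝒜 h hu z * h t ^ n = h x := by
  have h1 := congr(Localization.awayLift h t hu $hz)
  rwa [map_mul, map_pow, Localization.awayLift, IsLocalization.Away.lift_eq,
    IsLocalization.Away.lift_eq] at h1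

lemma awayLift_mk (h : A →+* B) {t : A} (hu : IsUnit (h t)) {m : ℕ} (ht : t ∈ 𝒜 m) (n : ℕ) (x : A)
    (hx : x ∈ 𝒜 (n • m)) : awayLift 𝒜 h hu (Away.mk 𝒜 ht n x hx) * h t ^ n = h x := by
  refine awayLift_mul_pow 𝒜 h hu _ n x ?_
  rw [Away.val_mk, Localization.mk_eq_mk', ← map_pow]
  exact IsLocalization.mk'_spec _ x (⟨t ^ n, n, rfl⟩ : Submonoid.powers t)

lemma awayLift_eq_iff (h : A →+* B) {t : A} (hu : IsUnit (h t)) {m : ℕ} (ht : t ∈ 𝒜 m)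
    (g : Away 𝒜 t →+* B) : g = awayLift 𝒜 h hu ↔
      ∀ (n : ℕ) (x : A) (hx : x ∈ 𝒜 (n • m)), g (Away.mk 𝒜 ht n x hx) * h t ^ n = h x := by
  refine ⟨?_, fun H => ?_⟩
  · rintro rfl n x hx
    exact awayLift_mk 𝒜 h hu ht n x hx
  · ext z
    obtain ⟨n, x, hx, rfl⟩ := Away.mk_surjective 𝒜 ht z
    exact (hu.pow n).mul_right_cancel ((H n x hx).trans (awayLift_mk 𝒜 h hu ht n x hx).symm)

lemma comp_awayLift (h : A →+* B) {t : A} (hu : IsUnit (h t)) (g : B →+* B') :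
    g.comp (awayLift 𝒜 h hu) = awayLift 𝒜 (g.comp h) (t := t) (hu.map g) := by
  refine RingHom.ext fun z => ?_
  obtain ⟨c, rfl⟩ := HomogeneousLocalization.mk_surjective z
  obtain ⟨n, hn⟩ := c.den_mem
  have hz : (HomogeneousLocalization.mk c).val * algebraMap A _ t ^ n =
      algebraMap A (Localization.Away t) c.num := by
    rw [val_mk, Localization.mk_eq_mk', ← map_pow, show t ^ n = c.den from hn]
    exact IsLocalization.mk'_spec _ _ (⟨c.den, c.den_mem⟩ : Submonoid.powers t)
  refine ((hu.map g).pow n).mul_right_cancel ?_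
  refine Eq.trans ?_ (awayLift_mul_pow 𝒜 (g.comp h) (t := t) (hu.map g) _ n _ hz).symm
  rw [RingHom.comp_apply, RingHom.comp_apply, ← map_pow, ← map_mul, awayLift_mul_pow 𝒜 h hu _ n _ hz]

/-- The morphism `Spec B ⟶ Proj A` given by `h : A → B` with `h t` invertible. -/
def point {m : ℕ} {t : A} (ht : t ∈ 𝒜 m) (hm : 0 < m) (h : A →+* B) (hu : IsUnit (h t)) :
    Spec (.of B) ⟶ Proj 𝒜 :=
  Spec.map (CommRingCat.ofHom (awayLift 𝒜 h hu)) ≫ awayι 𝒜 t ht hm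

lemma Spec_map_point {m : ℕ} {t : A} (ht : t ∈ 𝒜 m) (hm : 0 < m) (h : A →+* B) (hu : IsUnit (h t))
    (g : B →+* B') : Spec.map (CommRingCat.ofHom g) ≫ point 𝒜 ht hm h hu =
      point 𝒜 ht hm (g.comp h) (hu.map g) := by
  rw [point, point, ← Spec.map_comp_assoc, ← CommRingCat.ofHom_comp, comp_awayLift]

lemma point_projToSpec {m : ℕ} {t : A} (ht : t ∈ 𝒜 m) (hm : 0 < m) (h : A →+* B)
    (hu : IsUnit (h t)) : point 𝒜 ht hm h hu ≫ RealConic.projToSpec 𝒜 =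
      Spec.map (CommRingCat.ofHom (h.comp (algebraMap k A))) := by
  rw [point, RealConic.projToSpec, Category.assoc, awayι_toSpecZero_assoc, ← Spec.map_comp,
    ← Spec.map_comp, ← CommRingCat.ofHom_comp, ← CommRingCat.ofHom_comp]
  congr 2
  refine RingHom.ext fun r => ?_
  have h1 : fromZeroRingHom 𝒜 (Submonoid.powers t) (algebraMap k (𝒜 0) r) =
      Away.mk 𝒜 ht 0 (algebraMap k A r) (by simpa using SetLike.algebraMap_mem_graded 𝒜 r) := by
    ext
    rw [Away.val_mk]
    change Localization.mk _ _ = _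
    congr 1
    ext
    simp
  have h2 := awayLift_mk 𝒜 h hu ht 0 (algebraMap k A r)
    (by simpa using SetLike.algebraMap_mem_graded 𝒜 r)
  rw [pow_zero, mul_one] at h2
  rw [RingHom.comp_apply, RingHom.comp_apply, h1, h2, RingHom.comp_apply]

lemma point_eq_point_mul {m m' : ℕ} {t t' : A} (ht : t ∈ 𝒜 m) (hm : 0 < m) (ht' : t' ∈ 𝒜 m')
    (h : A →+* B) (hu : IsUnit (h t)) (hu' : IsUnit (h t')) :
    point 𝒜 ht hm h hu = point 𝒜 (SetLike.mul_mem_graded ht ht') (Nat.add_pos_left hm m') h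
      (by rw [map_mul]; exact hu.mul hu') := by
  rw [point, point, ← SpecMap_awayMap_awayι 𝒜 ht hm ht' rfl, ← Spec.map_comp_assoc,
    ← CommRingCat.ofHom_comp]
  congr 3
  symm
  rw [awayLift_eq_iff 𝒜 h hu ht]
  intro n x hx
  rw [RingHom.comp_apply, awayMap_mk]
  have h1 := awayLift_mk 𝒜 h (t := t * t') (by rw [map_mul]; exact hu.mul hu')
    (SetLike.mul_mem_graded ht ht') n (x * t' ^ n)
    (by rw [nsmul_add]; exact SetLike.mul_mem_graded hx (SetLike.pow_mem_graded _ ht'))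
  refine (hu'.pow n).mul_right_cancel ?_
  have h2 : h x * h t' ^ n = h (x * t' ^ n) := by rw [map_mul, map_pow]
  have h3 : h (t * t') ^ n = h t ^ n * h t' ^ n := by rw [map_mul, mul_pow]
  exact (mul_assoc _ _ _).trans ((congrArg _ h3.symm).trans (h1.trans h2.symm))

/-- Both sides factor through the common chart where t t' is invertible. -/
lemma point_congr {m m' : ℕ} {t t' : A} (ht : t ∈ 𝒜 m) (hm : 0 < m) (ht' : t' ∈ 𝒜 m')
    (hm' : 0 < m') (h : A →+* B) (hu : IsUnit (h t)) (hu' : IsUnit (h t')) :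
    point 𝒜 ht hm h hu = point 𝒜 ht' hm' h hu' := by
  rw [point_eq_point_mul 𝒜 ht hm ht' h hu hu', point_eq_point_mul 𝒜 ht' hm' ht h hu' hu]
  simp only [mul_comm t t', add_comm m m']

/-- Homogeneous coordinates may be rescaled. -/
lemma point_eq_of_scale {m m' : ℕ} {t t' : A} (ht : t ∈ 𝒜 m) (hm : 0 < m) (ht' : t' ∈ 𝒜 m')
    (hm' : 0 < m') (h h' : A →+* B) (hu : IsUnit (h t)) (hu' : IsUnit (h' t')) (c : B)
    (hc : ∀ n, ∀ a ∈ 𝒜 n, h a = c ^ n * h' a) (hc' : IsUnit c) :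
    point 𝒜 ht hm h hu = point 𝒜 ht' hm' h' hu' := by
  have hu2 : IsUnit (h' t) := isUnit_of_mul_isUnit_right (hc m t ht ▸ hu)
  rw [point_congr 𝒜 ht' hm' ht hm h' hu' hu2, point, point]
  congr 3
  rw [awayLift_eq_iff 𝒜 h' hu2 ht]
  intro n x hx
  have h1 := awayLift_mk 𝒜 h hu ht n x hx
  rw [hc m t ht, hc _ x hx, smul_eq_mul, mul_pow, ← pow_mul, mul_comm m n] at h1
  refine (hc'.pow (n * m)).mul_left_cancel ?_
  rw [← h1]
  ring

section Degree

variable {t : A} (ht : t ∈ 𝒜 1)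

/-- Dehomogenisation `a ↦ ∑ aₙ / tⁿ` with respect to an element `t` of degree one. -/
def dehomog : A →+* Away 𝒜 t :=
  (DirectSum.toSemiring
    (fun n => ({ toFun := fun x => Away.mk 𝒜 ht n x (by simp)
                 map_zero' := by ext; simp [Away.val_mk, Localization.mk_zero]
                 map_add' := fun x y => by
                    ext; simp [Away.val_mk, Localization.add_mk_self] } : 𝒜 n →+ Away 𝒜 t))
    (by ext; simp [Away.val_mk])
    (fun {i j} x y => by
      ext
      simp [Away.val_mk, Localization.mk_mul, pow_add])).comp
    (DirectSum.decomposeRingEquiv 𝒜 : A →+* _)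

lemma dehomog_of_mem {n : ℕ} {x : A} (hx : x ∈ 𝒜 n) :
    dehomog 𝒜 ht x = Away.mk 𝒜 ht n x (by simpa using hx) := by
  rw [dehomog, RingHom.comp_apply]
  change DirectSum.toSemiring _ _ _ (DirectSum.decompose 𝒜 x) = _
  rw [DirectSum.decompose_of_mem 𝒜 hx, DirectSum.toSemiring_of]
  rfl

lemma dehomog_self : dehomog 𝒜 ht t = 1 := by
  rw [dehomog_of_mem 𝒜 ht ht]
  ext
  simp [Away.val_mk]

lemma dehomog_surjective : Function.Surjective (dehomog 𝒜 ht) := by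
  intro z
  obtain ⟨n, x, hx, rfl⟩ := Away.mk_surjective 𝒜 ht z
  exact ⟨x, dehomog_of_mem 𝒜 ht (by simpa using hx)⟩

variable {ht} in
lemma eq_awayLift_dehomog (g : Away 𝒜 t →+* B) :
    g = awayLift 𝒜 (g.comp (dehomog 𝒜 ht)) (t := t) (by simp [dehomog_self]) := by
  rw [awayLift_eq_iff 𝒜 _ _ ht]
  intro n x hx
  rw [RingHom.comp_apply, RingHom.comp_apply, dehomog_self, map_one, one_pow, mul_one,
    dehomog_of_mem 𝒜 ht (by simpa using hx)]

lemma awayLift_comp_dehomog (h : A →+* B) (h1 : h t = 1) :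
    (awayLift 𝒜 h (t := t) (by simp [h1])).comp (dehomog 𝒜 ht) = h := by
  refine RingHom.ext fun a => ?_
  induction a using DirectSum.Decomposition.inductionOn 𝒜 with
  | zero => rw [map_zero, map_zero]
  | @homogeneous n x =>
    have := awayLift_mk 𝒜 h (t := t) (by simp [h1]) ht n x (by simp)
    rw [RingHom.comp_apply, dehomog_of_mem 𝒜 ht x.2, ← this]
    exact (mul_one _).symm.trans (congrArg _ (by rw [h1, one_pow]))
  | add a b ha hb => rw [map_add, map_add, ha, hb]

/-- Normalising t to 1 removes the rescaling ambiguity, and the chart inclusion is a monomorphism.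
-/
lemma eq_of_point_eq {h h' : A →+* B} (h1 : h t = 1) (h1' : h' t = 1)
    (H : point 𝒜 ht one_pos h (by simp [h1]) = point 𝒜 ht one_pos h' (by simp [h1'])) :
    h = h' := by
  rw [point, point, cancel_mono, Spec.map_inj] at H
  rw [← awayLift_comp_dehomog 𝒜 ht h h1, ← awayLift_comp_dehomog 𝒜 ht h' h1']
  congr 1
  exact congr($(H).hom)

lemma exists_eq_point (f : Spec (.of B) ⟶ Proj 𝒜)
    (hf : ∀ x, f x ∈ basicOpen 𝒜 t) :
    ∃ (h : A →+* B) (h1 : h t = 1), f = point 𝒜 ht one_pos h (by simp [h1]) := by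
  have hr : Set.range f ⊆ Set.range (awayι 𝒜 t ht one_pos) := by
    rintro _ ⟨x, rfl⟩
    have := hf x
    rwa [← opensRange_awayι 𝒜 t ht one_pos] at this
  set g := IsOpenImmersion.lift (awayι 𝒜 t ht one_pos) f hr with hg
  have h2 : Spec.map (Spec.preimage g) ≫ awayι 𝒜 t ht one_pos = f := by
    rw [Spec.map_preimage, hg, IsOpenImmersion.lift_fac]
  refine ⟨(Spec.preimage g).hom.comp (dehomog 𝒜 ht), ?_, ?_⟩
  · rw [RingHom.comp_apply, dehomog_self, map_one]
  · rw [← h2, point]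
    congr 2
    ext1
    exact eq_awayLift_dehomog 𝒜 _

end Degree

end

end AlgebraicGeometry.Proj

/-! ### Morphisms from spectra of local rings -/

section LocalRing

open IsLocalRing

lemma AlgebraicGeometry.Scheme.exists_eq_map_fromSpecStalk {X : Scheme.{0}} {B : Type} [CommRing B]
    [IsLocalRing B] (f : Spec (.of B) ⟶ X) {x : X} (hx : f (closedPoint B) = x) :
    ∃ φ : X.presheaf.stalk x →+* B, IsLocalHom φ ∧
      f = Spec.map (CommRingCat.ofHom φ) ≫ X.fromSpecStalk x := by
  subst hx
  exact ⟨(Scheme.stalkClosedPointTo f).hom, inferInstance,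
    (Scheme.Spec_stalkClosedPointTo_fromSpecStalk f).symm⟩

lemma AlgebraicGeometry.Scheme.exists_eq_map_fromSpecResidueField {X : Scheme.{0}} {F : Type}
    [Field F] (f : Spec (.of F) ⟶ X) {x : X} (hx : f (closedPoint F) = x) :
    ∃ φ : X.residueField x →+* F,
      f = Spec.map (CommRingCat.ofHom φ) ≫ X.fromSpecResidueField x := by
  subst hx
  exact ⟨_, (Scheme.descResidueField_stalkClosedPointTo_fromSpecResidueField F X f).symm⟩

lemma AlgebraicGeometry.Scheme.mem_of_closedPoint_mem {X : Scheme.{0}} {B : Type} [CommRing B]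
    [IsLocalRing B] (f : Spec (.of B) ⟶ X) {U : X.Opens} (hU : f (closedPoint B) ∈ U)
    (x : Spec (.of B)) : f x ∈ U := by
  have h : x ⤳ closedPoint B :=
    (PrimeSpectrum.le_iff_specializes _ _).mp (IsLocalRing.le_maximalIdeal x.2.ne_top)
  exact (h.map f.continuous).mem_open U.2 hU

end LocalRing

namespace RealConic

noncomputable section

open Proj

/-! ### Points of the projective line -/

section Line

variable {B B' : Type} [CommRing B] [CommRing B']

lemma X_zero_mem : (X 0 : MvPolynomial (Fin 2) ℝ) ∈ lineGrading 1 := isHomogeneous_X ℝ 0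

/-- The point `[ρ(X) : 1]` of the projective line. -/
def affinePoint (ρ : Polynomial ℝ →+* B) : Spec (.of B) ⟶ P1 :=
  point lineGrading X_one_mem one_pos (ρ.comp (dehomogenize : _ →+* _)) (by simp)

/-- The point `[1 : ρ(X)]` of the projective line. -/
def affinePointZero (ρ : Polynomial ℝ →+* B) : Spec (.of B) ⟶ P1 :=
  point lineGrading X_zero_mem one_pos
    (ρ.comp (aeval ![1, Polynomial.X] : MvPolynomial (Fin 2) ℝ →ₐ[ℝ] Polynomial ℝ)) (by simp)

lemma Spec_map_affinePoint (ρ : Polynomial ℝ →+* B) (g : B →+* B') :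
    Spec.map (CommRingCat.ofHom g) ≫ affinePoint ρ = affinePoint (g.comp ρ) :=
  Spec_map_point lineGrading X_one_mem one_pos _ _ g

lemma Spec_map_affinePointZero (ρ : Polynomial ℝ →+* B) (g : B →+* B') :
    Spec.map (CommRingCat.ofHom g) ≫ affinePointZero ρ = affinePointZero (g.comp ρ) :=
  Spec_map_point lineGrading X_zero_mem one_pos _ _ g

lemma affinePoint_toSpec (ρ : Polynomial ℝ →+* B) :
    affinePoint ρ ≫ P1.toSpec = Spec.map (CommRingCat.ofHom (ρ.comp Polynomial.C)) := by
  refine (point_projToSpec lineGrading X_one_mem one_pos _ _).trans ?_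
  congr 2
  ext r
  simp [MvPolynomial.algebraMap_eq]

lemma affinePointZero_toSpec (ρ : Polynomial ℝ →+* B) :
    affinePointZero ρ ≫ P1.toSpec = Spec.map (CommRingCat.ofHom (ρ.comp Polynomial.C)) := by
  refine (point_projToSpec lineGrading X_zero_mem one_pos _ _).trans ?_
  congr 2
  ext r
  simp [MvPolynomial.algebraMap_eq]

lemma affinePoint_injective : Function.Injective (affinePoint (B := B)) := by
  intro ρ ρ' h
  have h1 := eq_of_point_eq lineGrading X_one_mem (by simp) (by simp) h
  refine Polynomial.ringHom_ext (fun r => ?_) ?_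
  · simpa using congr($h1 (C r))
  · simpa using congr($h1 (X 0))

/-- On the overlap of the two charts the coordinates differ by the unit ρ(X). The scaling identity
in degree n is linear, hence it suffices to check it on monomials. -/
lemma affinePoint_eq_affinePointZero (ρ ρ' : Polynomial ℝ →+* B)
    (hC : ∀ r, ρ (Polynomial.C r) = ρ' (Polynomial.C r))
    (h : ρ Polynomial.X * ρ' Polynomial.X = 1) : affinePoint ρ = affinePointZero ρ' := by
  refine point_eq_of_scale lineGrading X_one_mem one_pos X_zero_mem one_pos _ _ _ _
    (ρ Polynomial.X) ?_ (.of_mul_eq_one _ h)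
  intro n a ha
  have ha' : a ∈ Submodule.span ℝ ((fun d => monomial d (1 : ℝ)) '' {d | d.degree = n}) := by
    rw [mem_weightedHomogeneousSubmodule] at ha
    rw [← a.support_sum_monomial_coeff]
    refine Submodule.sum_mem _ fun d hd => ?_
    rw [← mul_one (coeff d a), ← smul_eq_mul, ← smul_monomial]
    refine Submodule.smul_mem _ _ (Submodule.subset_span ⟨d, ?_, rfl⟩)
    rw [Set.mem_ofPred_eq, Finsupp.degree_eq_weight_one]
    exact ha (mem_support_iff.mp hd)
  clear ha
  induction ha' using Submodule.span_induction with
  | mem x hx =>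
    obtain ⟨d, hd, rfl⟩ := hx
    rw [Set.mem_ofPred_eq, Finsupp.degree_eq_sum, Fin.sum_univ_two] at hd
    simp only [RingHom.comp_apply, RingHom.coe_coe, aeval_monomial,
      map_one, one_mul]
    rw [Finsupp.prod_fintype _ _ (by simp), Finsupp.prod_fintype _ _ (by simp)]
    simp only [Fin.prod_univ_two, Matrix.cons_val_zero, Matrix.cons_val_one, one_pow, one_mul,
      mul_one, map_pow, ← hd, pow_add, mul_assoc, ← mul_pow, h]
  | zero => simp
  | add x y _ _ hx hy => rw [map_add, hx, hy, map_add, mul_add]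
  | smul r x _ hx =>
    rw [smul_eq_C_mul, map_mul, map_mul, hx, mul_left_comm]
    congr 1
    simp only [RingHom.comp_apply, RingHom.coe_coe, algHom_C, Polynomial.algebraMap_eq, hC r]

lemma exists_eq_affinePoint [IsLocalRing B] (f : Spec (.of B) ⟶ P1)
    (hf : f (IsLocalRing.closedPoint B) ∈ basicOpen lineGrading (X 1)) :
    ∃ ρ : Polynomial ℝ →+* B, f = affinePoint ρ := by
  obtain ⟨h, h1, rfl⟩ := exists_eq_point lineGrading X_one_mem f
    (Scheme.mem_of_closedPoint_mem f hf)
  refine ⟨Polynomial.eval₂RingHom (h.comp C) (h (X 0)), ?_⟩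
  rw [affinePoint]
  congr 1
  refine MvPolynomial.ringHom_ext (fun r => by simp) (fun i => ?_)
  fin_cases i <;> simp [h1]

lemma exists_eq_affinePointZero [IsLocalRing B] (f : Spec (.of B) ⟶ P1)
    (hf : f (IsLocalRing.closedPoint B) ∈ basicOpen lineGrading (X 0)) :
    ∃ ρ : Polynomial ℝ →+* B, f = affinePointZero ρ := by
  obtain ⟨h, h1, rfl⟩ := exists_eq_point lineGrading X_zero_mem f
    (Scheme.mem_of_closedPoint_mem f hf)
  refine ⟨Polynomial.eval₂RingHom (h.comp C) (h (X 1)), ?_⟩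
  rw [affinePointZero]
  congr 1
  refine MvPolynomial.ringHom_ext (fun r => by simp) (fun i => ?_)
  fin_cases i <;> simp [h1]

lemma affinePoint_mem (ρ : Polynomial ℝ →+* B) (x : Spec (.of B)) :
    affinePoint ρ x ∈ basicOpen lineGrading (X 1) := by
  rw [← opensRange_awayι lineGrading (X 1) X_one_mem one_pos]
  exact ⟨_, rfl⟩

lemma exists_mem_basicOpen (b : P1) :
    b ∈ basicOpen lineGrading (X 0) ∨ b ∈ basicOpen lineGrading (X 1) := by
  have h := iSup_basicOpen_eq_top' lineGrading (X : Fin 2 → MvPolynomial (Fin 2) ℝ)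
    (fun i => ⟨1, isHomogeneous_X ℝ i⟩) (by
      rw [eq_top_iff]
      intro p _
      induction p using MvPolynomial.induction_on with
      | C a =>
        exact Subalgebra.algebraMap_mem _ (⟨C a, isHomogeneous_C _ _⟩ : lineGrading 0)
      | add p q hp hq => exact add_mem (hp trivial) (hq trivial)
      | mul_X p i hp => exact mul_mem (hp trivial) (Algebra.subset_adjoin ⟨i, rfl⟩))
  have hb : b ∈ ⨆ i, basicOpen lineGrading (X i) := h ▸ trivial
  rw [TopologicalSpace.Opens.mem_iSup] at hb
  obtain ⟨i, hi⟩ := hb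
  fin_cases i
  exacts [.inl hi, .inr hi]

end Line

/-! ### The generic point of the projective line -/

/-- The generic point of the projective line. -/
def lineGeneric : P1 :=
  affinePoint (algebraMap (Polynomial ℝ) (FractionRing (Polynomial ℝ))) (IsLocalRing.closedPoint _)

/-- Every function on the chart t ≠ 0 comes from a polynomial F, and is determined by F(s, 1). -/
lemma awayLift_injective {B : Type} [CommRing B] {ρ : Polynomial ℝ →+* B}
    (hρ : Function.Injective ρ) : Function.Injective
      (awayLift lineGrading (ρ.comp (dehomogenize : _ →+* _)) (t := X 1) (by simp)) := by
  rw [injective_iff_map_eq_zero]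
  intro z hz
  obtain ⟨a, rfl⟩ := dehomog_surjective lineGrading X_one_mem z
  have h1 := awayLift_comp_dehomog lineGrading X_one_mem (ρ.comp (dehomogenize : _ →+* _)) (by simp)
  have h2 : ρ (dehomogenize a) = 0 := Eq.trans congr($h1 a).symm hz
  rw [← map_zero ρ] at h2
  have h3 : dehomog lineGrading X_one_mem =
      (Polynomial.eval₂RingHom ((dehomog lineGrading X_one_mem).comp C)
        (dehomog lineGrading X_one_mem (X 0))).comp (dehomogenize : _ →+* _) := by
    refine MvPolynomial.ringHom_ext (fun r => by simp) (fun i => ?_)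
    fin_cases i <;> simp [dehomog_self]
  rw [h3, RingHom.comp_apply]
  change Polynomial.eval₂RingHom _ _ (dehomogenize a) = 0
  rw [hρ h2, map_zero]

/-- In the chart t ≠ 0 this point is the zero ideal, which contains no other prime. -/
lemma eq_lineGeneric_of_specializes {x : P1} (hx : x ⤳ lineGeneric) : x = lineGeneric := by
  have h1 : x ∈ basicOpen lineGrading (X 1) := hx.mem_open (basicOpen _ _).2 (affinePoint_mem _ _)
  rw [← opensRange_awayι lineGrading (X 1) X_one_mem one_pos] at h1
  obtain ⟨y, rfl⟩ := h1
  set y₀ := Spec.map (CommRingCat.ofHom (awayLift lineGrading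
    ((algebraMap (Polynomial ℝ) (FractionRing (Polynomial ℝ))).comp (dehomogenize : _ →+* _))
      (t := X 1) (by simp))) (IsLocalRing.closedPoint (FractionRing (Polynomial ℝ))) with hy₀
  have e : lineGeneric = awayι lineGrading (X 1) X_one_mem one_pos y₀ := Scheme.Hom.comp_apply _ _ _
  rw [e] at hx ⊢
  rw [(awayι lineGrading (X 1) X_one_mem one_pos).isOpenEmbedding.isInducing.specializes_iff] at hx
  replace hx := (PrimeSpectrum.le_iff_specializes _ _).mpr hx
  congr 1
  refine PrimeSpectrum.ext (le_antisymm hx ?_)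
  refine le_trans ?_ (bot_le (a := y.asIdeal))
  intro z hz
  have h2 : awayLift lineGrading ((algebraMap (Polynomial ℝ) (FractionRing (Polynomial ℝ))).comp
    (dehomogenize : _ →+* _)) (t := X 1) (by simp) z ∈ IsLocalRing.maximalIdeal _ := hz
  rw [IsLocalRing.maximalIdeal_eq_bot, Ideal.mem_bot] at h2
  exact awayLift_injective (IsFractionRing.injective _ _) (h2.trans (map_zero _).symm)

/-- The function field of the projective line. -/
abbrev LineField : Type := P1.residueField lineGeneric

lemma exists_fromSpecResidueField_eq : ∃ ρ : Polynomial ℝ →+* LineField,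
    P1.fromSpecResidueField lineGeneric = affinePoint ρ :=
  exists_eq_affinePoint _ (Eq.substr (p := fun x => x ∈ basicOpen lineGrading (X 1))
    (Scheme.fromSpecResidueField_apply (X := P1) lineGeneric (IsLocalRing.closedPoint LineField))
    (affinePoint_mem _ _))

instance : Algebra (Polynomial ℝ) LineField := exists_fromSpecResidueField_eq.choose.toAlgebra

lemma fromSpecResidueField_eq :
    P1.fromSpecResidueField lineGeneric = affinePoint (algebraMap (Polynomial ℝ) LineField) :=
  exists_fromSpecResidueField_eq.choose_spec

/-- The ℝ(s)-valued point of the line factors through this residue field. The resulting embedding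
into ℝ(s) over ℝ[s] forces every element to be a fraction. -/
instance : IsFractionRing (Polynomial ℝ) LineField := by
  obtain ⟨g, hg⟩ := Scheme.exists_eq_map_fromSpecResidueField
    (affinePoint (algebraMap (Polynomial ℝ) (FractionRing (Polynomial ℝ)))) (x := lineGeneric) rfl
  rw [fromSpecResidueField_eq] at hg
  have h1 := affinePoint_injective (hg.trans (Spec_map_affinePoint _ g))
  have h2 : Function.Injective (algebraMap (Polynomial ℝ) LineField) := by
    have := IsFractionRing.injective (Polynomial ℝ) (FractionRing (Polynomial ℝ))
    rw [h1, RingHom.coe_comp] at this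
    exact this.of_comp
  have : FaithfulSMul (Polynomial ℝ) LineField := (faithfulSMul_iff_algebraMap_injective _ _).mpr h2
  refine IsFractionRing.of_field _ _ fun z => ?_
  obtain ⟨a, b, hb, hab⟩ := IsFractionRing.div_surjective (A := Polynomial ℝ) (g z)
  refine ⟨a, b, g.injective ?_⟩
  rw [← hab, map_div₀, h1]
  rfl

end

end RealConic

namespace RealConic

noncomputable section

open Proj

/-! ### Points of hypersurfaces in weighted projective spaces -/

section HypersurfacePoints

variable {k : Type} [Field k] {n : ℕ} {w : Fin n → ℕ} {F : MvPolynomial (Fin n) k} {m : ℕ}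
variable (hF : F.IsWeightedHomogeneous w m) {B B' : Type} [CommRing B] [CommRing B']

/-- The coordinate ring of a hypersurface. -/
abbrev CoordinateRing : Type := MvPolynomial (Fin n) k ⧸ (hypersurfaceIdeal hF).toIdeal

/-- The coordinate functions. -/
def coordinate (i : Fin n) : CoordinateRing hF :=
  Ideal.Quotient.mk _ (X i)

lemma coordinate_mem (i : Fin n) : coordinate hF i ∈ coordinateGrading hF (w i) :=
  mk_mem_quotientGrading _ _ (isWeightedHomogeneous_X k w i)

/-- The homomorphism from the coordinate ring given by a zero of the equation. -/
def coordinateHom (ρ : k →+* B) (V : Fin n → B) (h : eval₂ ρ V F = 0) : CoordinateRing hF →+* B :=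
  Ideal.Quotient.lift _ (eval₂Hom ρ V) (fun a ha => by
    have h1 : (hypersurfaceIdeal hF).toIdeal ≤ RingHom.ker (eval₂Hom ρ V) :=
      Ideal.span_le.mpr (by rintro _ rfl; exact h)
    exact h1 ha)

variable {ρ : k →+* B} {V : Fin n → B} {h : eval₂ ρ V F = 0}

@[simp] lemma coordinateHom_mk (p : MvPolynomial (Fin n) k) :
    coordinateHom hF ρ V h (Ideal.Quotient.mk _ p) = eval₂ ρ V p := rfl

@[simp] lemma coordinateHom_coordinate (i : Fin n) :
    coordinateHom hF ρ V h (coordinate hF i) = V i := eval₂_X ρ V i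

lemma coordinateHom_comp_algebraMap :
    (coordinateHom hF ρ V h).comp (algebraMap k (CoordinateRing hF)) = ρ := by
  ext r
  exact eval₂_C ρ V r

lemma comp_coordinateHom (g : B →+* B') : g.comp (coordinateHom hF ρ V h) =
    coordinateHom hF (g.comp ρ) (fun i => g (V i))
      (by rw [← hom_eval₂, h, map_zero]) := by
  refine Ideal.Quotient.ringHom_ext (MvPolynomial.ringHom_ext (fun r => ?_) (fun i => ?_))
  · simp
  · simp

lemma eval₂_coordinate_eq_zero (g : CoordinateRing hF →+* B) :
    eval₂ (g.comp (algebraMap k (CoordinateRing hF))) (fun i => g (coordinate hF i)) F = 0 := by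
  have h1 : eval₂Hom (g.comp (algebraMap k (CoordinateRing hF))) (fun i => g (coordinate hF i)) =
      g.comp (Ideal.Quotient.mk _) :=
    MvPolynomial.ringHom_ext (fun r => by simp; rfl) (fun i => by simp; rfl)
  have h2 : Ideal.Quotient.mk (hypersurfaceIdeal hF).toIdeal F = 0 :=
    Ideal.Quotient.eq_zero_iff_mem.mpr (Ideal.mem_span_singleton_self F)
  exact congr($h1 F).trans (by rw [RingHom.comp_apply, h2, map_zero])

lemma eq_coordinateHom (g : CoordinateRing hF →+* B) :
    g = coordinateHom hF (g.comp (algebraMap k (CoordinateRing hF)))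
      (fun i => g (coordinate hF i)) (eval₂_coordinate_eq_zero hF g) :=
  Ideal.Quotient.ringHom_ext
    (MvPolynomial.ringHom_ext (fun r => by simp; rfl) (fun i => by simp; rfl))

/-- The point of a hypersurface with homogeneous coordinates `V`. -/
def hyperPoint (ρ : k →+* B) (V : Fin n → B) (h : eval₂ ρ V F = 0) {i : Fin n} (hi : 0 < w i)
    (hu : IsUnit (V i)) : Spec (.of B) ⟶ Hypersurface hF :=
  point (coordinateGrading hF) (coordinate_mem hF i) hi (coordinateHom hF ρ V h)
    (by simpa using hu)

variable {i : Fin n} (hi : 0 < w i) (hu : IsUnit (V i))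

lemma hyperPoint_projToSpec : hyperPoint hF ρ V h hi hu ≫ projToSpec (coordinateGrading hF) =
    Spec.map (CommRingCat.ofHom ρ) := by
  refine (point_projToSpec _ _ _ _ _).trans ?_
  rw [coordinateHom_comp_algebraMap]

lemma Spec_map_hyperPoint (g : B →+* B') :
    Spec.map (CommRingCat.ofHom g) ≫ hyperPoint hF ρ V h hi hu =
      hyperPoint hF (g.comp ρ) (fun i => g (V i))
        (by rw [← hom_eval₂, h, map_zero]) hi (hu.map g) := by
  refine (Spec_map_point _ _ _ _ _ g).trans ?_
  simp only [comp_coordinateHom]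
  rfl

end HypersurfacePoints

section StandardWeights

variable {k : Type} [Field k] {n : ℕ} {F : MvPolynomial (Fin n) k} {m : ℕ}
variable (hF : F.IsWeightedHomogeneous (1 : Fin n → ℕ) m) {B B' : Type} [CommRing B] [CommRing B']

/-- The ratio of the j-th to the i-th coordinate is a function on the chart, so equal points have
proportional coordinates. The coefficient map is recovered from the structure morphism. -/
lemma hyperPoint_injective {ρ : k →+* B} {V : Fin n → B} {h : eval₂ ρ V F = 0} {i : Fin n}
    {hi : 0 < (1 : Fin n → ℕ) i} {hu : IsUnit (V i)} {ρ' : k →+* B} {V' : Fin n → B}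
    {h' : eval₂ ρ' V' F = 0} {hu' : IsUnit (V' i)}
    (H : hyperPoint hF ρ V h hi hu = hyperPoint hF ρ' V' h' hi hu') :
    ρ = ρ' ∧ ∀ j, V j * V' i = V' j * V i := by
  constructor
  · have h1 := congr($H ≫ projToSpec (coordinateGrading hF))
    rw [hyperPoint_projToSpec, hyperPoint_projToSpec, Spec.map_inj] at h1
    exact congr($(h1).hom)
  · intro j
    rw [hyperPoint, hyperPoint, point, point, cancel_mono, Spec.map_inj] at H
    have hj : coordinate hF j ∈ coordinateGrading hF (1 • (1 : Fin n → ℕ) i) := by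
      simpa using coordinate_mem hF j
    have h1 := awayLift_mk (coordinateGrading hF) (coordinateHom hF ρ V h) (by simpa using hu)
      (coordinate_mem hF i) 1 _ hj
    have h2 := awayLift_mk (coordinateGrading hF) (coordinateHom hF ρ' V' h') (by simpa using hu')
      (coordinate_mem hF i) 1 _ hj
    have h3 := congr($(H).hom (HomogeneousLocalization.Away.mk _ (coordinate_mem hF i) 1 _ hj))
    simp only [CommRingCat.hom_ofHom] at h3
    rw [← h3] at h2
    simp only [pow_one, coordinateHom_coordinate] at h1 h2
    rw [← h1, ← h2]
    ring

/-- A local scheme maps into any chart that contains the image of its closed point, and there one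
coordinate can be normalised to 1. -/
lemma exists_eq_hyperPoint [IsLocalRing B] (f : Spec (.of B) ⟶ Hypersurface hF) :
    ∃ (i : Fin n) (ρ : k →+* B) (V : Fin n → B) (h : eval₂ ρ V F = 0) (h1 : V i = 1),
      f = hyperPoint hF ρ V h one_pos (h1 ▸ isUnit_one) := by
  have h := iSup_basicOpen_eq_top' (coordinateGrading hF) (coordinate hF)
    (fun i => ⟨1, coordinate_mem hF i⟩) (by
      rw [eq_top_iff]
      intro p _
      obtain ⟨p, rfl⟩ := Ideal.Quotient.mk_surjective p
      induction p using MvPolynomial.induction_on with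
      | C a =>
        exact Subalgebra.algebraMap_mem _ (⟨Ideal.Quotient.mk _ (C a),
          mk_mem_quotientGrading _ _ (isWeightedHomogeneous_C _ _)⟩ : coordinateGrading hF 0)
      | add p q hp hq => rw [map_add]; exact add_mem (hp trivial) (hq trivial)
      | mul_X p i hp =>
        rw [map_mul]
        exact mul_mem (hp trivial) (Algebra.subset_adjoin ⟨i, rfl⟩))
  have hb : f (IsLocalRing.closedPoint B) ∈ ⨆ i, basicOpen (coordinateGrading hF)
    (coordinate hF i) := h ▸ trivial
  rw [TopologicalSpace.Opens.mem_iSup] at hb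
  obtain ⟨i, hi⟩ := hb
  obtain ⟨g, h1, rfl⟩ := exists_eq_point (coordinateGrading hF) (coordinate_mem hF i) f
    (Scheme.mem_of_closedPoint_mem f hi)
  refine ⟨i, _, _, eval₂_coordinate_eq_zero hF g, h1, ?_⟩
  rw [hyperPoint]
  congr 1
  exact eq_coordinateHom hF g

end StandardWeights

/-! ### Conics -/

section Conic

variable {k : Type} [Field k] {q : MvPolynomial (Fin 3) k}

lemma eval₂_of_diagonalization {M : Matrix (Fin 3) (Fin 3) k} {w : Fin 3 → k}
    (hw : aeval (fun j => ∑ i, C (M j i) * X i) q =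
      (∑ i, C (w i) * X i ^ 2 : MvPolynomial (Fin 3) k))
    {B : Type} [CommRing B] (ρ : k →+* B) (Y : Fin 3 → B) :
    eval₂ ρ (fun j => ∑ i, ρ (M j i) * Y i) q = ∑ i, ρ (w i) * Y i ^ 2 := by
  have h1 : (eval₂Hom ρ Y).comp (aeval (R := k) (S₁ := MvPolynomial (Fin 3) k)
      (fun j => ∑ i, C (M j i) * X i) : _ →+* _) =
        eval₂Hom ρ (fun j => ∑ i, ρ (M j i) * Y i) :=
    MvPolynomial.ringHom_ext (fun r => by simp) (fun i => by simp)
  refine congr($h1 q).symm.trans ?_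
  rw [RingHom.comp_apply]
  refine (congrArg _ hw).trans ?_
  simp [map_sum]

lemma eval₂_eq_of_diagonalization {M N : Matrix (Fin 3) (Fin 3) k} (hMN : M * N = 1) {w : Fin 3 → k}
    (hw : aeval (fun j => ∑ i, C (M j i) * X i) q =
      (∑ i, C (w i) * X i ^ 2 : MvPolynomial (Fin 3) k))
    {B : Type} [CommRing B] (ρ : k →+* B) (V : Fin 3 → B) :
    eval₂ ρ V q = ∑ i, ρ (w i) * (∑ j, ρ (N i j) * V j) ^ 2 := by
  rw [← eval₂_of_diagonalization hw]
  congr 1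
  ext j
  simp only [Finset.mul_sum, ← mul_assoc, ← map_mul]
  rw [Finset.sum_comm]
  simp only [← Finset.sum_mul, ← map_sum, ← Matrix.mul_apply, hMN, Matrix.one_apply]
  simp

/-- A plane conic has a geometric point. -/
lemma exists_zero_of_isHomogeneous [CharZero k] (hq : q.IsHomogeneous 2) :
    ∃ V : Fin 3 → AlgebraicClosure k, V ≠ 0 ∧ eval₂ (algebraMap k (AlgebraicClosure k)) V q = 0 := by
  obtain ⟨M, N, w, hMN, hNM, hw⟩ := hq.exists_diagonalization
  set ρ := algebraMap k (AlgebraicClosure k)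
  suffices h : ∃ Y : Fin 3 → AlgebraicClosure k, Y ≠ 0 ∧ ∑ i, ρ (w i) * Y i ^ 2 = 0 by
    obtain ⟨Y, hY0, hY⟩ := h
    refine ⟨_, fun h0 => hY0 ?_, (eval₂_of_diagonalization hw ρ Y).trans hY⟩
    have h1 : (M.map ρ).mulVec Y = 0 := h0
    have h2 : (N.map ρ) * (M.map ρ) = 1 := by
      rw [← Matrix.map_mul, hNM, Matrix.map_one _ (map_zero _) (map_one _)]
    rw [← Matrix.one_mulVec Y, ← h2, ← Matrix.mulVec_mulVec, h1, Matrix.mulVec_zero]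
  by_cases h0 : w 0 = 0
  · refine ⟨![1, 0, 0], fun h => ?_, by simp [Fin.sum_univ_three, h0]⟩
    simpa using congr_fun h 0
  · obtain ⟨y, hy⟩ := IsAlgClosed.exists_pow_nat_eq (- ρ (w 1) / ρ (w 0)) two_pos
    refine ⟨![y, 1, 0], fun h => ?_, ?_⟩
    · simpa using congr_fun h 1
    · have : ρ (w 0) ≠ 0 := by simpa [ρ] using h0
      simp [Fin.sum_univ_three, hy]
      field_simp
      ring

/-- Ensures that the generic fibre has a point, from which the dominance of π is deduced. -/
lemma nonempty_conic [CharZero k] (hq : q.IsWeightedHomogeneous (1 : Fin 3 → ℕ) 2) :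
    Nonempty (Hypersurface hq) := by
  obtain ⟨V, hV, h⟩ := exists_zero_of_isHomogeneous hq
  obtain ⟨i, hi⟩ := Function.ne_iff.mp hV
  exact ⟨hyperPoint hq _ V h (i := i) one_pos (IsUnit.mk0 _ hi) (IsLocalRing.closedPoint _)⟩

end Conic

end

end RealConic

namespace RealConic

/-! ### Étale coordinates on smooth surfaces -/

/-- The local rings of a smooth real surface are formally étale over `ℝ[x, y]`. -/
lemma exists_formallyEtale_stalk {S : Scheme.{0}} (sS : S ⟶ Spec (.of ℝ))
    [SmoothOfRelativeDimension 2 sS] (p : S) :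
    ∃ g : MvPolynomial (Fin 2) ℝ →+* S.presheaf.stalk p, g.FormallyEtale ∧
      Spec.map (CommRingCat.ofHom (g.comp C)) = S.fromSpecStalk p ≫ sS := by
  obtain ⟨U, hU, V, hV, hp, e, hf⟩ :=
    SmoothOfRelativeDimension.exists_isStandardSmoothOfRelativeDimension (f := sS) (n := 2) p
  obtain rfl : U = ⊤ := by
    rw [eq_top_iff]
    intro x _
    have : x = sS p := Subsingleton.elim (α := PrimeSpectrum ℝ) _ _
    exact this ▸ e hp
  -- Standard smoothness of relative dimension 2 gives étale coordinates on V. Identifying the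
  -- coefficient ring with ℝ and localising at p both preserve formal étaleness.
  obtain ⟨g, hg, hg'⟩ := hf.exists_etale_mvPolynomial
  let i : ℝ →+* Γ(Spec (.of ℝ), ⊤) := (Scheme.ΓSpecIso (.of ℝ)).inv.hom
  have hi : Function.Bijective i :=
    (ConcreteCategory.isIso_iff_bijective (Scheme.ΓSpecIso (.of ℝ)).inv).mp inferInstance
  refine ⟨(S.presheaf.germ V p hp).hom.comp (g.comp (MvPolynomial.map i)), ?_, ?_⟩
  · refine RingHom.FormallyEtale.comp (RingHom.FormallyEtale.comp (.of_bijective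
      ⟨map_injective i hi.1, map_surjective i hi.2⟩) hg'.formallyEtale) ?_
    let := (S.presheaf.germ V p hp).hom.toAlgebra
    have : IsLocalization.AtPrime (S.presheaf.stalk p) (hV.primeIdealOf ⟨p, hp⟩).asIdeal :=
      hV.isLocalization_stalk ⟨p, hp⟩
    exact Algebra.FormallyEtale.of_isLocalization (Rₘ := S.presheaf.stalk p)
      (hV.primeIdealOf ⟨p, hp⟩).asIdeal.primeCompl
  · have h1 : ((S.presheaf.germ V p hp).hom.comp (g.comp (MvPolynomial.map i))).comp C =
        ((Scheme.ΓSpecIso (.of ℝ)).inv ≫ sS.appLE ⊤ V e ≫ S.presheaf.germ V p hp).hom := by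
      rw [CommRingCat.hom_comp, CommRingCat.hom_comp, ← hg]
      ext r
      simp [i]
    rw [h1, CommRingCat.ofHom_hom, Spec.map_comp, Spec.map_comp, Category.assoc,
      ← hV.fromSpecStalk_eq_fromSpecStalk hp, IsAffineOpen.fromSpecStalk, Category.assoc,
      ← IsAffineOpen.SpecMap_appLE_fromSpec sS (isAffineOpen_top _) hV e,
      IsAffineOpen.fromSpec_top, Scheme.isoSpec_Spec_inv]

end RealConic

/-- Locality makes a tangent vector, a morphism from the spectrum of dual numbers, factor through a
single stalk. -/
instance TrivSqZeroExt.isLocalRing (K M : Type) [Field K] [AddCommGroup M] [Module K M]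
    [Module Kᵐᵒᵖ M] [IsCentralScalar K M] : IsLocalRing (TrivSqZeroExt K M) := by
  refine .of_isUnit_or_isUnit_one_sub_self fun a => ?_
  simp only [TrivSqZeroExt.isUnit_iff_isUnit_fst, TrivSqZeroExt.fst_sub, TrivSqZeroExt.fst_one]
  exact IsLocalRing.isUnit_or_isUnit_one_sub_self a.fst

namespace RealConic

/-! ### Smoothness of the generic fibre -/

section Nondegenerate

variable {K : Type} [Field K] [Algebra (Polynomial ℝ) K] [IsFractionRing (Polynomial ℝ) K]

/-- Moving the variable of `ℝ(s)` in the direction `v`. -/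
lemma exists_deformation (M : Type) [AddCommGroup M] [Module K M] [Module Kᵐᵒᵖ M]
    [IsCentralScalar K M] (v : M) :
    ∃ φ : K →+* TrivSqZeroExt K M, (∀ x, (φ x).fst = x) ∧
      (∀ r, φ (algebraMap (Polynomial ℝ) K (Polynomial.C r)) =
        TrivSqZeroExt.inl (algebraMap (Polynomial ℝ) K (Polynomial.C r))) ∧
      (φ (algebraMap (Polynomial ℝ) K Polynomial.X)).snd = v := by
  set s := algebraMap (Polynomial ℝ) K Polynomial.X
  let g : Polynomial ℝ →+* TrivSqZeroExt K M := Polynomial.eval₂RingHom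
    ((TrivSqZeroExt.inlHom K M).comp ((algebraMap (Polynomial ℝ) K).comp Polynomial.C))
    (TrivSqZeroExt.inl s + TrivSqZeroExt.inr v)
  have hg : (TrivSqZeroExt.fstHom K K M).toRingHom.comp g = algebraMap (Polynomial ℝ) K := by
    refine Polynomial.ringHom_ext (fun r => ?_) ?_
    · simp [g]
    · simp [g, s]
  have hu (y : nonZeroDivisors (Polynomial ℝ)) : IsUnit (g y) := by
    rw [TrivSqZeroExt.isUnit_iff_isUnit_fst]
    have h1 : (g y).fst = algebraMap (Polynomial ℝ) K y := congr($hg y)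
    rw [h1]
    exact IsLocalization.map_units K y
  refine ⟨IsLocalization.lift hu, fun x => ?_, fun r => ?_, ?_⟩
  · have h1 : (TrivSqZeroExt.fstHom K K M).toRingHom.comp (IsLocalization.lift hu) =
        RingHom.id K := by
      refine IsLocalization.ringHom_ext (nonZeroDivisors (Polynomial ℝ)) ?_
      rw [RingHom.comp_assoc, IsLocalization.lift_comp, hg, RingHom.id_comp]
    exact congr($h1 x)
  · rw [IsLocalization.lift_eq]
    simp [g]
  · rw [IsLocalization.lift_eq]
    simp [g]

variable {q : MvPolynomial (Fin 3) K} (hq : q.IsWeightedHomogeneous (1 : Fin 3 → ℕ) 2)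

/-- The generic fibre of a smooth surface over the line is a nondegenerate conic. -/
theorem diagonal_ne_zero {S : Scheme.{0}} (sS : S ⟶ Spec (.of ℝ)) [SmoothOfRelativeDimension 2 sS]
    (ι : Hypersurface hq ⟶ S) [Mono ι]
    (hι : ι ≫ sS = projToSpec (coordinateGrading hq) ≫
      Spec.map (CommRingCat.ofHom ((algebraMap (Polynomial ℝ) K).comp Polynomial.C)))
    {M N : Matrix (Fin 3) (Fin 3) K} {w : Fin 3 → K} (hNM : N * M = 1)
    (hw : aeval (fun j => ∑ i, C (M j i) * X i) q =
      (∑ i, C (w i) * X i ^ 2 : MvPolynomial (Fin 3) K)) (i : Fin 3) : w i ≠ 0 := by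
  intro hwi
  -- If w i = 0, the i-th basis vector is a singular point of the conic. It is deformed in three
  -- independent directions at once: two in the plane of the fibre, and one, indexed by i, along the
  -- base variable s.
  obtain ⟨φ, hφ1, hφC, hφX⟩ := exists_deformation (K := K) (Fin 3 → K) (Pi.single i 1)
  let Y (a : Fin 3) : TrivSqZeroExt K (Fin 3 → K) :=
    if a = i then 1 else TrivSqZeroExt.inr (Pi.single a 1)
  let x (j : Fin 3) : TrivSqZeroExt K (Fin 3 → K) := ∑ a, φ (M j a) * Y a
  -- The i-th term has coefficient zero and the others are squares of infinitesimals.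
  have hx : eval₂ φ x q = 0 := by
    rw [eval₂_of_diagonalization hw]
    refine Finset.sum_eq_zero fun a _ => ?_
    by_cases ha : a = i
    · rw [ha, hwi, map_zero, zero_mul]
    · simp [Y, ha, pow_two]
  have hNx (a : Fin 3) : ∑ j, φ (N a j) * x j = Y a := by
    simp only [x, Finset.mul_sum, ← mul_assoc, ← map_mul]
    rw [Finset.sum_comm]
    simp only [← Finset.sum_mul, ← map_sum, ← Matrix.mul_apply, hNM, Matrix.one_apply]
    simp
  obtain ⟨j, hj⟩ : ∃ j, M j i ≠ 0 := by
    by_contra! h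
    have h1 : (N * M) i i = 1 := by rw [hNM, Matrix.one_apply_eq]
    simp [Matrix.mul_apply, h] at h1
  have hu : IsUnit (x j) := by
    have h1 : (TrivSqZeroExt.fstHom K K (Fin 3 → K)) (x j) = M j i := by
      simp only [x, map_sum, map_mul, TrivSqZeroExt.fstHom_apply, hφ1]
      rw [Finset.sum_eq_single i]
      · simp [Y]
      · intro a _ ha
        simp [Y, ha]
      · simp
    rw [TrivSqZeroExt.isUnit_iff_isUnit_fst]
    exact (show (x j).fst = M j i from h1) ▸ IsUnit.mk0 _ hj
  obtain ⟨Θ, -, hΘ⟩ := Scheme.exists_eq_map_fromSpecStalk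
    (hyperPoint hq φ x hx (i := j) one_pos hu ≫ ι) rfl
  obtain ⟨g, hg, hgC⟩ := exists_formallyEtale_stalk sS
    ((hyperPoint hq φ x hx (i := j) one_pos hu ≫ ι) (IsLocalRing.closedPoint _))
  have hC : (Θ.comp (g.comp C)) = φ.comp ((algebraMap (Polynomial ℝ) K).comp Polynomial.C) := by
    have h1 : Spec.map (CommRingCat.ofHom (Θ.comp (g.comp C))) = Spec.map (CommRingCat.ofHom
        (φ.comp ((algebraMap (Polynomial ℝ) K).comp Polynomial.C))) := by
      rw [CommRingCat.ofHom_comp, Spec.map_comp, hgC, ← Category.assoc, ← hΘ, Category.assoc, hι,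
        ← Category.assoc, hyperPoint_projToSpec, ← Spec.map_comp, ← CommRingCat.ofHom_comp]
    exact congr($(Spec.map_injective h1).hom)
  -- A nonzero functional l cannot be distinguished from 0 after mapping to S. As ι is a
  -- monomorphism, the two deformed points already agree on the conic.
  obtain ⟨l, hl0, hl⟩ := hg.exists_map_comp_eq Θ (fun r => by
    exact congr(($hC r).snd).trans (congr(($(hφC r)).snd).trans (TrivSqZeroExt.snd_inl _ _)))
  set μ := (TrivSqZeroExt.map l).toRingHom
  set ν := (TrivSqZeroExt.map (0 : (Fin 3 → K) →ₗ[K] K)).toRingHom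
  have h1 : Spec.map (CommRingCat.ofHom μ) ≫ hyperPoint hq φ x hx (i := j) one_pos hu =
      Spec.map (CommRingCat.ofHom ν) ≫ hyperPoint hq φ x hx (i := j) one_pos hu := by
    rw [← cancel_mono ι, Category.assoc, Category.assoc, hΘ, ← Spec.map_comp_assoc,
      ← Spec.map_comp_assoc, ← CommRingCat.ofHom_comp, ← CommRingCat.ofHom_comp, hl]
  rw [Spec_map_hyperPoint, Spec_map_hyperPoint] at h1
  obtain ⟨h2, h3⟩ := hyperPoint_injective hq h1
  have h4 (a : Fin 3) : μ (Y a) * ν (x j) = ν (Y a) * μ (x j) := by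
    simp only [← hNx a, map_sum, map_mul, Finset.sum_mul, mul_assoc, h3]
    refine Finset.sum_congr rfl fun b _ => ?_
    congr 1
    exact congr($h2 (N a b))
  refine hl0 (LinearMap.pi_ext' fun a => LinearMap.ext_ring ?_)
  rw [LinearMap.comp_apply, LinearMap.zero_comp, LinearMap.zero_apply, LinearMap.single_apply]
  -- The base direction is killed because the two coefficient maps agree, the fibre directions
  -- because the coordinate ratios do.
  by_cases ha : a = i
  · have h5 : TrivSqZeroExt.snd (μ (φ (algebraMap (Polynomial ℝ) K Polynomial.X))) =
        TrivSqZeroExt.snd (ν (φ (algebraMap (Polynomial ℝ) K Polynomial.X))) := congr(($h2 _).snd)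
    have h6 : l (φ (algebraMap (Polynomial ℝ) K Polynomial.X)).snd = 0 := by
      simpa [μ, ν] using h5
    rwa [hφX, ← ha] at h6
  · have h5 : μ (Y a) = TrivSqZeroExt.inr (l (Pi.single a 1)) := by
      simp [Y, ha, μ]
    have h6 : ν (Y a) = 0 := by
      simp [Y, ha, ν]
    have h7 := h4 a
    rw [h6, zero_mul, (hu.map ν).mul_left_eq_zero, h5] at h7
    exact TrivSqZeroExt.inr_injective (h7.trans (TrivSqZeroExt.inr_zero K).symm)

end Nondegenerate

end RealConic

namespace RealConic

instance : CharZero LineField := by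
  let f := (algebraMap (Polynomial ℝ) LineField).comp Polynomial.C
  exact charZero_of_injective_ringHom f.injective

/-! ### The function field of a conic bundle -/

section GenericFibre

variable {S : Scheme.{0}} {π : S ⟶ P1}

/-- The generic fibre of a conic bundle is a plane conic. -/
lemma IsConicBundle.exists_isPullback (h : IsConicBundle π) :
    ∃ (q : MvPolynomial (Fin 3) LineField) (hq : q.IsWeightedHomogeneous (1 : Fin 3 → ℕ) 2)
      (ι : Hypersurface hq ⟶ S), IsPullback ι (projToSpec (coordinateGrading hq)) π
        (P1.fromSpecResidueField lineGeneric) := by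
  obtain ⟨q, hq, -, e, he⟩ := h lineGeneric
  refine ⟨q, hq, e.inv ≫ π.fiberι _, ?_⟩
  refine IsPullback.of_iso (IsPullback.of_hasPullback π (P1.fromSpecResidueField lineGeneric))
    e (Iso.refl _) (Iso.refl _) (Iso.refl _) ?_ ?_ ?_ ?_
  · exact (Category.comp_id _).trans (e.hom_inv_id_assoc _).symm
  · simpa using! he.symm
  · simp
  · simp

lemma exists_fromSpecStalk_comp_eq_affinePoint (π : S ⟶ P1) (p : S)
    (hp : π p ∈ Proj.basicOpen lineGrading (X 1)) :
    ∃ j : Polynomial ℝ →+* S.presheaf.stalk p, S.fromSpecStalk p ≫ π = affinePoint j := by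
  have : IsLocalRing (S.presheaf.stalk p) := inferInstance
  refine exists_eq_affinePoint _ ?_
  have h1 : (S.fromSpecStalk p ≫ π) (IsLocalRing.closedPoint (S.presheaf.stalk p)) = π p :=
    (Scheme.Hom.comp_apply _ _ _).trans (congrArg _ S.fromSpecStalk_closedPoint)
  exact h1 ▸ hp

variable [IsIntegral S]

/-- The generic point of S specialises to a point of the nonempty generic fibre, and only the
generic point of the line specialises to itself. -/
lemma map_genericPoint {q : MvPolynomial (Fin 3) LineField}
    {hq : q.IsWeightedHomogeneous (1 : Fin 3 → ℕ) 2} {ι : Hypersurface hq ⟶ S}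
    (hι : IsPullback ι (projToSpec (coordinateGrading hq)) π
      (P1.fromSpecResidueField lineGeneric)) : π (genericPoint S) = lineGeneric := by
  obtain ⟨x⟩ := nonempty_conic hq
  refine eq_lineGeneric_of_specializes ?_
  have h1 : π (ι x) = lineGeneric := by
    rw [← Scheme.Hom.comp_apply, hι.w, Scheme.Hom.comp_apply, Scheme.fromSpecResidueField_apply]
  exact h1 ▸ ((genericPoint_spec S).specializes trivial).map π.continuous

/-- The function field of `S` as an extension of the function field of the line. -/
lemma exists_fromSpecStalk_comp_eq (h : π (genericPoint S) = lineGeneric) :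
    ∃ ρ : LineField →+* S.functionField, S.fromSpecStalk (genericPoint S) ≫ π =
      Spec.map (CommRingCat.ofHom ρ) ≫ P1.fromSpecResidueField lineGeneric :=
  Scheme.exists_eq_map_fromSpecResidueField (F := S.functionField)
    (S.fromSpecStalk (genericPoint S) ≫ π) (by
      refine (Scheme.Hom.comp_apply _ _ _).trans (Eq.trans ?_ h)
      exact congrArg _ S.fromSpecStalk_closedPoint)

variable [Algebra LineField S.functionField]
  (hK : S.fromSpecStalk (genericPoint S) ≫ π =
    Spec.map (CommRingCat.ofHom (algebraMap LineField S.functionField)) ≫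
      P1.fromSpecResidueField lineGeneric)

include hK in
lemma fromSpecStalk_genericPoint_comp : S.fromSpecStalk (genericPoint S) ≫ π =
    affinePoint ((algebraMap LineField S.functionField).comp
      (algebraMap (Polynomial ℝ) LineField)) := by
  rw [hK, fromSpecResidueField_eq]
  exact Spec_map_affinePoint _ _

include hK in
/-- The function field is generated by the coordinates of the generic point on the conic. -/
lemma exists_generating_zero {q : MvPolynomial (Fin 3) LineField}
    {hq : q.IsWeightedHomogeneous (1 : Fin 3 → ℕ) 2} {ι : Hypersurface hq ⟶ S}
    (hι : IsPullback ι (projToSpec (coordinateGrading hq)) π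
      (P1.fromSpecResidueField lineGeneric)) :
    ∃ (i : Fin 3) (V : Fin 3 → S.functionField), V i = 1 ∧
      eval₂ (algebraMap LineField S.functionField) V q = 0 ∧
      IntermediateField.adjoin LineField (Set.range V) = ⊤ := by
  let f : Spec (.of S.functionField) ⟶ Hypersurface hq := hι.lift _ _ hK
  have hf1 : f ≫ ι = S.fromSpecStalk (genericPoint S) := hι.lift_fst _ _ _
  have hf2 : f ≫ projToSpec (coordinateGrading hq) = Spec.map (CommRingCat.ofHom
    (algebraMap LineField S.functionField)) := hι.lift_snd _ _ _
  obtain ⟨i, ρ, V, h0, h1, hf⟩ := exists_eq_hyperPoint hq f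
  rw [hf, hyperPoint_projToSpec, Spec.map_inj] at hf2
  obtain rfl : ρ = algebraMap LineField S.functionField := congr($(hf2).hom)
  refine ⟨i, V, h1, h0, ?_⟩
  set M := IntermediateField.adjoin LineField (Set.range V)
  let V' (j : Fin 3) : M := ⟨V j, IntermediateField.subset_adjoin _ _ ⟨j, rfl⟩⟩
  have h0' : eval₂ (algebraMap LineField M) V' q = 0 := by
    apply M.val.injective
    rw [map_zero, ← h0]
    exact hom_eval₂ q (algebraMap LineField M) M.val.toRingHom V'
  have h1' : V' i = 1 := Subtype.ext h1
  -- The generic point of S is already defined over the subfield M generated by the coordinates.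
  -- Comparing stalks gives a map φ from L to M whose composite with the inclusion is the identity
  -- of L, so M = L.
  let m : Spec (.of M) ⟶ S := hyperPoint hq _ V' h0' (i := i) one_pos (h1' ▸ isUnit_one) ≫ ι
  have hm : Spec.map (CommRingCat.ofHom M.val.toRingHom) ≫ m =
      S.fromSpecStalk (genericPoint S) := by
    rw [← hf1, hf, ← Category.assoc, Spec_map_hyperPoint]
    rfl
  have hpt : m (IsLocalRing.closedPoint M) = genericPoint S := by
    have h2 : Spec.map (CommRingCat.ofHom M.val.toRingHom)
      (IsLocalRing.closedPoint S.functionField) = IsLocalRing.closedPoint M :=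
        Subsingleton.elim (α := PrimeSpectrum M) _ _
    rw [← h2]
    refine (Scheme.Hom.comp_apply _ _ _).symm.trans ?_
    rw [hm]
    exact S.fromSpecStalk_closedPoint
  obtain ⟨φ, -, hφ⟩ := Scheme.exists_eq_map_fromSpecStalk m hpt
  have h3 : M.val.toRingHom.comp φ = RingHom.id _ := by
    have h4 : Spec.map (CommRingCat.ofHom (M.val.toRingHom.comp φ)) =
        Spec.map (CommRingCat.ofHom (RingHom.id S.functionField)) := by
      rw [← cancel_mono (S.fromSpecStalk (genericPoint S)), CommRingCat.ofHom_comp, Spec.map_comp,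
        Category.assoc, ← hφ, hm]
      exact (Category.id_comp _).symm.trans (congrArg (· ≫ _) (Spec.map_id _).symm)
    exact congr($(Spec.map_injective h4).hom)
  rw [eq_top_iff]
  intro x _
  have h5 : (φ x : S.functionField) = x := congr($h3 x)
  exact h5 ▸ (φ x).2

include hK in
lemma not_isAlgebraic_functionField {sS : S ⟶ Spec (.of ℝ)} (hπ : π ≫ P1.toSpec = sS)
    [SmoothOfRelativeDimension 2 sS] : ¬ Algebra.IsAlgebraic LineField S.functionField := by
  obtain ⟨g, hg, hgC⟩ := exists_formallyEtale_stalk sS (genericPoint S)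
  refine hg.not_isAlgebraic (K := LineField) (L := S.functionField) fun r => ?_
  rw [← hπ, ← Category.assoc, fromSpecStalk_genericPoint_comp hK, affinePoint_toSpec] at hgC
  exact congr($(Spec.map_injective hgC).hom r)

include hK in
/-- Over a point of the line that lifts to a real point, the quadratic forms `a x² + b y² - z²`
with `a` and `b` negative have no zeros in the function field. -/
lemma eq_zero_of_lift {sS : S ⟶ Spec (.of ℝ)}
    [SmoothOfRelativeDimension 2 sS] [LocallyOfFiniteType sS]
    {s₀ : ℝ} {σ : Spec (.of ℝ) ⟶ S} (hσ : σ ≫ sS = 𝟙 _)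
    (hσ' : σ ≫ π = affinePoint (Polynomial.evalRingHom s₀)) {a b : Polynomial ℝ}
    (ha : a.eval s₀ < 0) (hb : b.eval s₀ < 0) {x y z : S.functionField}
    (h : algebraMap LineField S.functionField (algebraMap (Polynomial ℝ) LineField a) * x ^ 2 +
      algebraMap LineField S.functionField (algebraMap (Polynomial ℝ) LineField b) * y ^ 2 =
        z ^ 2) : x = 0 ∧ y = 0 ∧ z = 0 := by
  have : IsLocallyNoetherian S := LocallyOfFiniteType.isLocallyNoetherian sS
  obtain ⟨p, hp⟩ : ∃ p, σ (IsLocalRing.closedPoint ℝ) = p := ⟨_, rfl⟩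
  obtain ⟨Θ, -, hΘ⟩ := Scheme.exists_eq_map_fromSpecStalk σ hp
  obtain ⟨j, hj⟩ := exists_fromSpecStalk_comp_eq_affinePoint π p (by
    have h1 : π p = affinePoint (Polynomial.evalRingHom s₀) (IsLocalRing.closedPoint ℝ) := by
      rw [← hσ', ← hp]
      exact (Scheme.Hom.comp_apply _ _ _).symm
    exact h1 ▸ affinePoint_mem _ _)
  have hΘj : Θ.comp j = Polynomial.evalRingHom s₀ := by
    apply affinePoint_injective
    rw [← hσ', hΘ, Category.assoc, hj, Spec_map_affinePoint]
  have hρj : (algebraMap (S.presheaf.stalk p) S.functionField).comp j =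
      (algebraMap LineField S.functionField).comp (algebraMap (Polynomial ℝ) LineField) := by
    apply affinePoint_injective
    rw [← fromSpecStalk_genericPoint_comp hK, ← Spec_map_affinePoint, ← hj, ← Category.assoc]
    congr 1
    exact Scheme.SpecMap_stalkSpecializes_fromSpecStalk ((genericPoint_spec S).specializes trivial)
  obtain ⟨g, hg, hgC⟩ := exists_formallyEtale_stalk sS p
  have hgr (r : ℝ) : Θ (g (C r)) = r := by
    have h1 : Spec.map (CommRingCat.ofHom (Θ.comp (g.comp C))) =
        Spec.map (CommRingCat.ofHom (RingHom.id ℝ)) := by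
      rw [CommRingCat.ofHom_comp, Spec.map_comp, hgC, ← Category.assoc, ← hΘ, hσ]
      exact (Spec.map_id _).symm
    exact congr($(Spec.map_injective h1).hom r)
  -- Clearing denominators moves the solution into the local ring at the real point.
  obtain ⟨d, hd⟩ := IsLocalization.exist_integer_multiples
    (nonZeroDivisors (S.presheaf.stalk p)) Finset.univ ![x, y, z]
  obtain ⟨x', hx⟩ := hd 0 (Finset.mem_univ _)
  obtain ⟨y', hy⟩ := hd 1 (Finset.mem_univ _)
  obtain ⟨z', hz⟩ := hd 2 (Finset.mem_univ _)
  simp only [Matrix.cons_val_zero, Matrix.cons_val_one, Matrix.cons_val, Algebra.smul_def] at hx hy hz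
  have hinj := IsFractionRing.injective (S.presheaf.stalk p) S.functionField
  have hd0 : algebraMap (S.presheaf.stalk p) S.functionField d ≠ 0 := fun h0 =>
    nonZeroDivisors.coe_ne_zero d (hinj (h0.trans (map_zero _).symm))
  have key : j a * x' ^ 2 + j b * y' ^ 2 = z' ^ 2 := by
    apply hinj
    have e1 : algebraMap (S.presheaf.stalk p) S.functionField (j a) = _ := congr($hρj a)
    have e2 : algebraMap (S.presheaf.stalk p) S.functionField (j b) = _ := congr($hρj b)
    rw [map_add, map_mul, map_mul, map_pow, map_pow, map_pow, hx, hy, hz, e1, e2, mul_pow, mul_pow,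
      mul_pow, ← h]
    simp only [RingHom.comp_apply]
    ring
  have hja : Θ (j a) < 0 := by
    have : Θ (j a) = _ := congr($hΘj a)
    rw [this]
    exact ha
  have hjb : Θ (j b) < 0 := by
    have : Θ (j b) = _ := congr($hΘj b)
    rw [this]
    exact hb
  obtain ⟨rfl, rfl, rfl⟩ := hg.eq_zero_of_sq_add_sq hgr hja hjb key
  rw [map_zero, eq_comm, mul_eq_zero, or_iff_right hd0] at hx hy hz
  exact ⟨hx, hy, hz⟩

end GenericFibre

end RealConic

/-- Modulo squares, n/m is n m. -/
lemma exists_eq_algebraMap_mul_sq {R K : Type} [CommRing R] [IsDomain R] [Field K] [Algebra R K]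
    [IsFractionRing R K] {u : K} (hu : u ≠ 0) :
    ∃ (a : R) (d : K), a ≠ 0 ∧ d ≠ 0 ∧ u = algebraMap R K a * d ^ 2 := by
  obtain ⟨n, m, hm, rfl⟩ := IsFractionRing.div_surjective (A := R) u
  have hm0 : algebraMap R K m ≠ 0 := by
    simpa using nonZeroDivisors.ne_zero hm
  have hn : n ≠ 0 := by
    rintro rfl
    simp at hu
  refine ⟨n * m, (algebraMap R K m)⁻¹, mul_ne_zero hn (nonZeroDivisors.ne_zero hm),
    inv_ne_zero hm0, ?_⟩
  rw [map_mul]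
  field_simp

/-- Used to compare morphisms from an integral scheme to a separated one at the generic point only.
-/
instance AlgebraicGeometry.Scheme.isDominant_fromSpecStalk_genericPoint (X : Scheme.{0})
    [IrreducibleSpace X] : IsDominant (X.fromSpecStalk (genericPoint X)) := by
  refine ⟨?_⟩
  have h1 : genericPoint X ∈ Set.range (X.fromSpecStalk (genericPoint X)) :=
    ⟨_, X.fromSpecStalk_closedPoint⟩
  have h2 : Dense ({genericPoint X} : Set X) := dense_iff_closure_eq.mpr (genericPoint_spec X)
  exact h2.mono (Set.singleton_subset_iff.mpr h1)

/-! ### The function field as K(t), and the action of the involution on it -/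

namespace RealConic

section Parameter

variable {S : Scheme.{0}} {π : S ⟶ P1} [IsIntegral S] [Algebra LineField S.functionField]
  (hK : S.fromSpecStalk (genericPoint S) ≫ π =
    Spec.map (CommRingCat.ofHom (algebraMap LineField S.functionField)) ≫
      P1.fromSpecResidueField lineGeneric)

include hK in
/-- If all real points of the line lift to real points, then the function field of a conic bundle
is purely transcendental over the function field of the line. -/
theorem exists_adjoin_simple_eq_top {sS : S ⟶ Spec (.of ℝ)} (hπ : π ≫ P1.toSpec = sS)
    [SmoothOfRelativeDimension 2 sS] [LocallyOfFiniteType sS] (hconic : IsConicBundle π)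
    (hσ : ∀ s₀ : ℝ, ∃ σ : Spec (.of ℝ) ⟶ S, σ ≫ sS = 𝟙 _ ∧
      σ ≫ π = affinePoint (Polynomial.evalRingHom s₀)) :
    ∃ t : S.functionField, IntermediateField.adjoin LineField {t} = ⊤ := by
  obtain ⟨q, hq, ι, hι⟩ := hconic.exists_isPullback
  obtain ⟨i, V, hVi, hV, htop⟩ := exists_generating_zero hK hι
  obtain ⟨M, N, w, hMN, hNM, hw⟩ := IsHomogeneous.exists_diagonalization (q := q) hq
  have hmono : Mono ι := by
    refine ⟨fun f g h => hι.hom_ext h ?_⟩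
    rw [← cancel_mono (P1.fromSpecResidueField lineGeneric), Category.assoc, Category.assoc, ← hι.w,
      reassoc_of% h]
  have hne := diagonal_ne_zero hq sS ι (by
    rw [← hπ, ← Category.assoc, hι.w, Category.assoc, fromSpecResidueField_eq]
    congr 1
    exact affinePoint_toSpec _) hNM hw
  set ρ := algebraMap LineField S.functionField
  let Y (j : Fin 3) : S.functionField := ∑ l, ρ (N j l) * V l
  have hVY (j : Fin 3) : ∑ l, ρ (M j l) * Y l = V j := by
    simp only [Y, Finset.mul_sum, ← mul_assoc, ← map_mul]
    rw [Finset.sum_comm]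
    simp only [← Finset.sum_mul, ← map_sum, ← Matrix.mul_apply, hMN, Matrix.one_apply]
    simp
  have hY : ρ (w 0) * Y 0 ^ 2 + ρ (w 1) * Y 1 ^ 2 + ρ (w 2) * Y 2 ^ 2 = 0 := by
    rw [← Fin.sum_univ_three (f := fun l => ρ (w l) * Y l ^ 2),
      ← eval₂_eq_of_diagonalization hMN hw ρ V, hV]
  -- Dividing the diagonal form by -w₂ and absorbing squares into the variables leaves polynomial
  -- coefficients a and b.
  obtain ⟨a, da, ha0, hda0, ha⟩ := exists_eq_algebraMap_mul_sq (R := Polynomial ℝ)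
    (u := -w 0 / w 2) (div_ne_zero (neg_ne_zero.mpr (hne 0)) (hne 2))
  obtain ⟨b, db, hb0, hdb0, hb⟩ := exists_eq_algebraMap_mul_sq (R := Polynomial ℝ)
    (u := -w 1 / w 2) (div_ne_zero (neg_ne_zero.mpr (hne 1)) (hne 2))
  have hda : ρ da ≠ 0 := (map_ne_zero ρ).mpr hda0
  have hdb : ρ db ≠ 0 := (map_ne_zero ρ).mpr hdb0
  have hxyz : ρ (algebraMap (Polynomial ℝ) LineField a) * (ρ da * Y 0) ^ 2 +
      ρ (algebraMap (Polynomial ℝ) LineField b) * (ρ db * Y 1) ^ 2 = Y 2 ^ 2 := by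
    have e1 : ρ (algebraMap (Polynomial ℝ) LineField a) * ρ da ^ 2 = - ρ (w 0) / ρ (w 2) := by
      rw [← map_pow, ← map_mul, ← ha, map_div₀, map_neg]
    have e2 : ρ (algebraMap (Polynomial ℝ) LineField b) * ρ db ^ 2 = - ρ (w 1) / ρ (w 2) := by
      rw [← map_pow, ← map_mul, ← hb, map_div₀, map_neg]
    have h2 : ρ (w 2) ≠ 0 := (map_ne_zero ρ).mpr (hne 2)
    rw [mul_pow, mul_pow, ← mul_assoc, ← mul_assoc, e1, e2]
    field_simp
    linear_combination -hY
  have h0 : ρ da * Y 0 ≠ 0 ∨ ρ db * Y 1 ≠ 0 ∨ Y 2 ≠ 0 := by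
    by_contra! h
    obtain ⟨h0, h1, h2⟩ := h
    have h0' := (mul_eq_zero.mp h0).resolve_left hda
    have h1' := (mul_eq_zero.mp h1).resolve_left hdb
    have := hVY i
    rw [Fin.sum_univ_three, h0', h1', h2, hVi] at this
    simp at this
  -- The coordinates of the generic point are a nontrivial solution in L, which a real point above a
  -- place with a, b < 0 would exclude.
  have hiso : IsotropicDiag a b := by
    refine isotropicDiag_of_forall_eval ha0 hb0 fun s₀ hs => ?_
    obtain ⟨σ, hσ1, hσ2⟩ := hσ s₀
    obtain ⟨e0, e1, e2⟩ := eq_zero_of_lift hK hσ1 hσ2 hs.1 hs.2 hxyz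
    tauto
  have hinj := IsFractionRing.injective (Polynomial ℝ) LineField
  have hiso' : IsotropicDiag (algebraMap (Polynomial ℝ) LineField a)
      (algebraMap (Polynomial ℝ) LineField b) := by
    obtain ⟨x, y, z, h, h'⟩ := hiso
    refine ⟨algebraMap _ _ x, algebraMap _ _ y, algebraMap _ _ z, ?_, ?_⟩
    · simpa only [ne_eq, map_eq_zero_iff _ hinj] using h
    · simp only [← map_pow, ← map_mul, ← map_add, h']
  obtain ⟨t, c, hc, h1, h2, h3⟩ := hiso'.exists_parameter
    ((map_ne_zero_iff _ hinj).mpr ha0) ((map_ne_zero_iff _ hinj).mpr hb0) h0 hxyz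
  set T := IntermediateField.adjoin LineField {t}
  have hYT (j : Fin 3) : Y j / c ∈ T := by
    have e0 : Y 0 / c = ρ da⁻¹ * (ρ da * Y 0 / c) := by rw [map_inv₀]; field_simp
    have e1 : Y 1 / c = ρ db⁻¹ * (ρ db * Y 1 / c) := by rw [map_inv₀]; field_simp
    fin_cases j
    · exact e0 ▸ mul_mem (T.algebraMap_mem _) h1
    · exact e1 ▸ mul_mem (T.algebraMap_mem _) h2
    · exact h3
  have hVT (j : Fin 3) : V j / c ∈ T := by
    rw [← hVY, Finset.sum_div]
    refine sum_mem fun l _ => ?_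
    rw [mul_div_assoc]
    exact mul_mem (T.algebraMap_mem _) (hYT l)
  refine ⟨t, eq_top_iff.mpr (htop ▸ IntermediateField.adjoin_le_iff.mpr ?_)⟩
  rintro _ ⟨j, rfl⟩
  -- The parametrisation controls coordinates only up to the factor c, which cancels because V i =
  -- 1.
  have e : V j = (V j / c) / (V i / c) := by rw [hVi]; field_simp
  exact e ▸ div_mem (hVT j) (hVT i)

lemma transcendental_of_adjoin_eq_top {K L : Type} [Field K] [Field L] [Algebra K L]
    (h : ¬ Algebra.IsAlgebraic K L) {t : L} (ht : IntermediateField.adjoin K {t} = ⊤) :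
    Transcendental K t := by
  intro hal
  have h1 := IntermediateField.isAlgebraic_adjoin_simple hal.isIntegral
  rw [ht] at h1
  exact h ((IntermediateField.topEquiv (F := K) (E := L)).isAlgebraic_iff.mp h1)

/-- The action of an involution on the function field. -/
lemma exists_algEquiv_functionField [S.IsSeparated] (hK : S.fromSpecStalk (genericPoint S) ≫ π =
    Spec.map (CommRingCat.ofHom (algebraMap LineField S.functionField)) ≫
      P1.fromSpecResidueField lineGeneric) (τ : S ≅ S) (hτ_ne : τ.hom ≠ 𝟙 S)
    (hτ_inv : τ.hom ≫ τ.hom = 𝟙 S) (hτ_base : τ.hom ≫ π = π) :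
    ∃ e : S.functionField ≃ₐ[LineField] S.functionField, (∀ x, e (e x) = x) ∧ (∃ x, e x ≠ x) ∧
      S.fromSpecStalk (genericPoint S) ≫ τ.hom =
        Spec.map (CommRingCat.ofHom (e : S.functionField →+* S.functionField)) ≫
          S.fromSpecStalk (genericPoint S) := by
  obtain ⟨φ, hφ⟩ : ∃ φ : S.functionField →+* S.functionField,
      S.fromSpecStalk (genericPoint S) ≫ τ.hom =
        Spec.map (CommRingCat.ofHom φ) ≫ S.fromSpecStalk (genericPoint S) := by
    have h0 : (S.fromSpecStalk (genericPoint S) ≫ τ.hom) (IsLocalRing.closedPoint _) =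
        genericPoint S := by
      refine (Scheme.Hom.comp_apply _ _ _).trans (Eq.trans (congrArg _ S.fromSpecStalk_closedPoint)
        (genericPoint_eq_of_isOpenImmersion τ.hom))
    obtain ⟨φ, -, h⟩ := @Scheme.exists_eq_map_fromSpecStalk S S.functionField _
      (inferInstanceAs (IsLocalRing (S.presheaf.stalk (genericPoint S)))) _ _ h0
    exact ⟨φ, h⟩
  have hid : S.fromSpecStalk (genericPoint S) =
      Spec.map (CommRingCat.ofHom (RingHom.id S.functionField)) ≫
        S.fromSpecStalk (genericPoint S) :=
    (Category.id_comp _).symm.trans (congrArg (· ≫ _) (Spec.map_id _).symm)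
  have hφφ : φ.comp φ = RingHom.id _ := by
    have h1 : Spec.map (CommRingCat.ofHom (φ.comp φ)) =
        Spec.map (CommRingCat.ofHom (RingHom.id S.functionField)) := by
      rw [← cancel_mono (S.fromSpecStalk (genericPoint S)), ← hid, CommRingCat.ofHom_comp,
        Spec.map_comp, Category.assoc]
      refine (congrArg (_ ≫ ·) hφ.symm).trans ?_
      rw [← Category.assoc]
      refine (congrArg (· ≫ _) hφ.symm).trans ?_
      rw [Category.assoc, hτ_inv, Category.comp_id]
    exact congr($(Spec.map_injective h1).hom)
  have hφK : φ.comp (algebraMap LineField S.functionField) =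
      algebraMap LineField S.functionField := by
    have h1 : Spec.map (CommRingCat.ofHom (φ.comp (algebraMap LineField S.functionField))) =
        Spec.map (CommRingCat.ofHom (algebraMap LineField S.functionField)) := by
      rw [← cancel_mono (P1.fromSpecResidueField lineGeneric), ← hK, CommRingCat.ofHom_comp,
        Spec.map_comp, Category.assoc]
      refine (congrArg (_ ≫ ·) hK.symm).trans ?_
      rw [← Category.assoc]
      refine (congrArg (· ≫ _) hφ.symm).trans ?_
      rw [Category.assoc, hτ_base]
    exact congr($(Spec.map_injective h1).hom)
  let φ' : S.functionField →ₐ[LineField] S.functionField :=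
    { φ with commutes' := fun r => congr($hφK r) }
  have hφ' : φ'.comp φ' = AlgHom.id _ _ := AlgHom.ext fun x => congr($hφφ x)
  refine ⟨AlgEquiv.ofAlgHom φ' φ' hφ' hφ', fun x => congr($hφφ x), ?_, hφ⟩
  by_contra! h
  have h1 : φ = RingHom.id _ := RingHom.ext h
  rw [h1, ← hid] at hφ
  -- A morphism that is the identity at the generic point is the identity, so τ acts nontrivially on
  -- L.
  refine hτ_ne ?_
  refine ext_of_isDominant (S.fromSpecStalk (genericPoint S)) ?_
  rw [hφ, Category.comp_id]

end Parameter

end RealConic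

/-! ### Birational maps from isomorphisms of function fields -/

namespace AlgebraicGeometry.Scheme

/-- An isomorphism of function fields extends to an isomorphism of nonempty open subschemes. -/
theorem exists_isOpenImmersion_of_functionField {X Y B : Scheme.{0}} [IsIntegral X] [IsIntegral Y]
    [X.IsSeparated] [Y.IsSeparated] (sX : X ⟶ B) (sY : Y ⟶ B) [LocallyOfFiniteType sX]
    [LocallyOfFiniteType sY] (e : Spec X.functionField ≅ Spec Y.functionField)
    (he : e.hom ≫ Y.fromSpecStalk (genericPoint Y) ≫ sY =
      X.fromSpecStalk (genericPoint X) ≫ sX) :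
    ∃ (W : Scheme.{0}) (j : W ⟶ X) (k : W ⟶ Y) (q : Spec X.functionField ⟶ W),
      IsOpenImmersion j ∧ IsOpenImmersion k ∧ q ≫ j = X.fromSpecStalk (genericPoint X) ∧
        q ≫ k = e.hom ≫ Y.fromSpecStalk (genericPoint Y) := by
  -- Both directions of the isomorphism extend to morphisms f and g on open neighbourhoods of the
  -- generic points.
  obtain ⟨U, hξ, f, hf, -⟩ := spread_out_of_isGermInjective' sX sY
    (x := genericPoint X) (e.hom ≫ Y.fromSpecStalk (genericPoint Y)) (by rw [Category.assoc, he])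
  obtain ⟨V, hη, g, hg, -⟩ := spread_out_of_isGermInjective' sY sX
    (x := genericPoint Y) (e.inv ≫ X.fromSpecStalk (genericPoint X))
    (by rw [Category.assoc, ← he, e.inv_hom_id_assoc])
  set r₀ := U.fromSpecStalkOfMem (genericPoint X) hξ with hr₀
  set v := V.fromSpecStalkOfMem (genericPoint Y) hη with hv
  have hr₀ι : r₀ ≫ U.ι = X.fromSpecStalk (genericPoint X) := by simp [hr₀]
  have hvι : v ≫ V.ι = Y.fromSpecStalk (genericPoint Y) := by simp [hv]
  have hr₀f : r₀ ≫ f = (e.hom ≫ v) ≫ V.ι := by rw [← hf, Category.assoc, hvι]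
  set r : Spec X.functionField ⟶ (f ⁻¹ᵁ V).toScheme := IsOpenImmersion.lift (f ⁻¹ᵁ V).ι r₀ (by
    rintro _ ⟨x, rfl⟩
    rw [Scheme.Opens.range_ι]
    change f (r₀ x) ∈ V
    rw [← Scheme.Hom.comp_apply, hr₀f, Scheme.Hom.comp_apply]
    exact ((e.hom ≫ v) x).2)
  have hr : r ≫ (f ⁻¹ᵁ V).ι = r₀ := IsOpenImmersion.lift_fac _ _ _
  set j := (f ⁻¹ᵁ V).ι ≫ U.ι
  have hrj : r ≫ j = X.fromSpecStalk (genericPoint X) := by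
    rw [← hr₀ι, ← hr, Category.assoc]
  have hrp : r ≫ (f ∣_ V) = e.hom ≫ v := by
    rw [← cancel_mono V.ι, Category.assoc, morphismRestrict_ι, ← Category.assoc, hr, hr₀f]
  have hrdom : IsDominant r :=
    have : IsDominant (r ≫ j) := by rw [hrj]; infer_instance
    .of_comp_of_isOpenImmersion (g := j) r
  have hpg : (f ∣_ V) ≫ g = j := by
    refine ext_of_isDominant r ?_
    rw [hrj, ← Category.assoc, hrp, Category.assoc, ← hg, e.hom_inv_id_assoc]
  -- On this smaller open set g lands where f is defined with values in V. Both composites are then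
  -- identities, since they are so at the generic points.
  let V₁ := g ⁻¹ᵁ j.opensRange
  let p₁ : (f ⁻¹ᵁ V).toScheme ⟶ V₁.toScheme := IsOpenImmersion.lift V₁.ι (f ∣_ V) (by
    rintro _ ⟨x, rfl⟩
    rw [Scheme.Opens.range_ι]
    change g ((f ∣_ V) x) ∈ j.opensRange
    rw [← Scheme.Hom.comp_apply, hpg]
    exact ⟨x, rfl⟩)
  have hp₁ : p₁ ≫ V₁.ι = f ∣_ V := IsOpenImmersion.lift_fac _ _ _
  let g₁ : V₁.toScheme ⟶ (f ⁻¹ᵁ V).toScheme := IsOpenImmersion.lift j (V₁.ι ≫ g) (by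
    rintro _ ⟨x, rfl⟩
    rw [Scheme.Hom.comp_apply]
    exact x.2)
  have hg₁ : g₁ ≫ j = V₁.ι ≫ g := IsOpenImmersion.lift_fac _ _ _
  have hpg₁ : p₁ ≫ g₁ = 𝟙 _ := by
    rw [← cancel_mono j, Category.assoc, hg₁, ← Category.assoc, hp₁, hpg, Category.id_comp]
  have hvr : v = e.inv ≫ r ≫ p₁ ≫ V₁.ι := by
    rw [hp₁, hrp, e.inv_hom_id_assoc]
  have hq : (e.inv ≫ r ≫ p₁) ≫ V₁.ι ≫ V.ι = Y.fromSpecStalk (genericPoint Y) := by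
    rw [← hvι, hvr]; simp
  have hqdom : IsDominant (e.inv ≫ r ≫ p₁) :=
    have : IsDominant ((e.inv ≫ r ≫ p₁) ≫ V₁.ι ≫ V.ι) := by rw [hq]; infer_instance
    .of_comp_of_isOpenImmersion (g := V₁.ι ≫ V.ι) _
  have hgp₁ : g₁ ≫ p₁ = 𝟙 _ := by
    rw [← cancel_mono (V₁.ι ≫ V.ι)]
    refine ext_of_isDominant (e.inv ≫ r ≫ p₁) ?_
    simp only [Category.assoc, Category.id_comp, reassoc_of% hpg₁]
  have : IsIso p₁ := ⟨g₁, hpg₁, hgp₁⟩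
  refine ⟨_, j, p₁ ≫ V₁.ι ≫ V.ι, r, inferInstance, inferInstance, hrj, ?_⟩
  rw [reassoc_of% hp₁, reassoc_of% hrp, hvι]

end AlgebraicGeometry.Scheme

/-! ### From data at the generic point to an equivariant birational map -/

namespace RealConic

/-- W is integral and q is dominant, so both required identities of morphisms may be checked after
composing with q. -/
lemma isDeJonquieres_of_isOpenImmersion {S : Scheme.{0}} [IsIntegral S] {π : S ⟶ P1} {τ : S ≅ S}
    {d : ℕ} {F : MvPolynomial (Fin 2) ℝ} (hF : F.IsHomogeneous (2 * d)) (hsq : Squarefree F)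
    [IrreducibleSpace (Model hF)] {W : Scheme.{0}} (j : W ⟶ S) (k : W ⟶ modelChart hF)
    [IsOpenImmersion j] [IsOpenImmersion k] (q : Spec S.functionField ⟶ W)
    (hq : q ≫ j = S.fromSpecStalk (genericPoint S))
    (ε : Spec S.functionField ⟶ Spec S.functionField)
    (hε : S.fromSpecStalk (genericPoint S) ≫ τ.hom = ε ≫ S.fromSpecStalk (genericPoint S))
    (hτ : j.opensRange ≤ τ.hom ⁻¹ᵁ j.opensRange)
    (hswap : ε ≫ q ≫ k ≫ (modelChart hF).ι = q ≫ k ≫ (modelChart hF).ι ≫ modelSwap hF)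
    (hproj : q ≫ k ≫ modelProj hF = q ≫ j ≫ π) : IsDeJonquieres π τ := by
  have : Nonempty W := ⟨q (IsLocalRing.closedPoint _)⟩
  have hqdom : IsDominant q :=
    have : IsDominant (q ≫ j) := by rw [hq]; infer_instance
    .of_comp_of_isOpenImmersion (g := j) q
  have : IsIntegral W := isIntegral_of_isOpenImmersion j
  let k' : W ⟶ Model hF := k ≫ (modelChart hF).ι
  have hY : k'.opensRange ≤ modelChart hF := by
    rintro _ ⟨x, rfl⟩
    rw [Scheme.Hom.comp_apply]
    exact (k x).2
  let φ : S.PartialIso (Model hF) :=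
    { source := j.opensRange
      dense_source := j.opensRange.2.dense (Set.range_nonempty _)
      target := k'.opensRange
      dense_target := k'.opensRange.2.dense (Set.range_nonempty _)
      iso := j.isoOpensRange.symm ≪≫ k'.isoOpensRange }
  have hφ : φ.iso.hom ≫ φ.target.ι = j.isoOpensRange.inv ≫ k' := by
    change (j.isoOpensRange.inv ≫ k'.isoOpensRange.hom) ≫ k'.opensRange.ι = _
    rw [Category.assoc, Scheme.Hom.isoOpensRange_hom_ι]
  refine ⟨d, F, hF, hsq, φ, hτ, hY, ?_, ?_⟩
  · rw [reassoc_of% hφ, hφ, ← cancel_epi j.isoOpensRange.hom]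
    have h1 : q ≫ j.isoOpensRange.hom ≫ τ.hom.resLE j.opensRange j.opensRange hτ =
        ε ≫ q ≫ j.isoOpensRange.hom := by
      rw [← cancel_mono j.opensRange.ι]
      simp only [Category.assoc, Scheme.Hom.resLE_comp_ι, Scheme.Hom.isoOpensRange_hom_ι,
        Scheme.Hom.isoOpensRange_hom_ι_assoc]
      rw [hq, reassoc_of% hq, hε]
    refine ext_of_isDominant q ?_
    have h2 := congr($h1 ≫ j.isoOpensRange.inv ≫ k')
    simp only [Category.assoc, Iso.hom_inv_id_assoc] at h2 ⊢
    exact h2.trans hswap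
  · rw [← cancel_epi j.isoOpensRange.hom]
    have h1 : φ.iso.hom ≫ (Model hF).homOfLE hY = j.isoOpensRange.inv ≫ k := by
      rw [← cancel_mono (modelChart hF).ι, Category.assoc, Scheme.homOfLE_ι]
      exact hφ.trans (Category.assoc _ _ _).symm
    refine ext_of_isDominant q ?_
    rw [reassoc_of% h1, Iso.hom_inv_id_assoc, hproj]
    change _ = q ≫ j.isoOpensRange.hom ≫ j.opensRange.ι ≫ π
    rw [Scheme.Hom.isoOpensRange_hom_ι_assoc]

/-- A birational map to the model, given by open immersions `j` and `k`, that has the right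
properties at the generic point. -/
theorem isDeJonquieres_of_genericPoint {S : Scheme.{0}} [IsIntegral S] {π : S ⟶ P1} {τ : S ≅ S}
    (hτ_inv : τ.hom ≫ τ.hom = 𝟙 S)
    {d : ℕ} {F : MvPolynomial (Fin 2) ℝ} (hF : F.IsHomogeneous (2 * d)) (hsq : Squarefree F)
    [IrreducibleSpace (Model hF)] {W : Scheme.{0}} (j : W ⟶ S) (k : W ⟶ modelChart hF)
    [IsOpenImmersion j] [IsOpenImmersion k] (q : Spec S.functionField ⟶ W)
    (hq : q ≫ j = S.fromSpecStalk (genericPoint S))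
    (ε : Spec S.functionField ⟶ Spec S.functionField)
    (hε : S.fromSpecStalk (genericPoint S) ≫ τ.hom = ε ≫ S.fromSpecStalk (genericPoint S))
    (hswap : ε ≫ q ≫ k ≫ (modelChart hF).ι = q ≫ k ≫ (modelChart hF).ι ≫ modelSwap hF)
    (hproj : q ≫ k ≫ modelProj hF = q ≫ j ≫ π) : IsDeJonquieres π τ := by
  -- Intersecting the image of j with its preimage under τ gives a τ-stable open set, since τ² = 1.
  let W' : W.Opens := j ⁻¹ᵁ τ.hom ⁻¹ᵁ j.opensRange
  let q' : Spec S.functionField ⟶ W'.toScheme := IsOpenImmersion.lift W'.ι q (by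
    rintro _ ⟨x, rfl⟩
    rw [Scheme.Opens.range_ι]
    change τ.hom (j (q x)) ∈ j.opensRange
    rw [← Scheme.Hom.comp_apply, ← Scheme.Hom.comp_apply, reassoc_of% hq, hε, ← hq,
      ← Category.assoc, Scheme.Hom.comp_apply]
    exact ⟨_, rfl⟩)
  have hq' : q' ≫ W'.ι = q := IsOpenImmersion.lift_fac _ _ _
  refine isDeJonquieres_of_isOpenImmersion hF hsq (W'.ι ≫ j) (W'.ι ≫ k) q'
    (by rw [reassoc_of% hq', hq]) ε hε ?_ ?_ ?_
  · rintro _ ⟨x, rfl⟩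
    obtain ⟨y, hy⟩ := x.2
    have hy' : j y = τ.hom (j x.1) := hy
    refine ⟨⟨y, ?_⟩, ?_⟩
    · change τ.hom (j y) ∈ j.opensRange
      rw [hy', ← Scheme.Hom.comp_apply, hτ_inv]
      exact ⟨x.1, rfl⟩
    · exact hy'
  · simpa only [Category.assoc, reassoc_of% hq'] using hswap
  · simpa only [Category.assoc, reassoc_of% hq'] using hproj

end RealConic

/-! ### Functoriality of `Proj` on points, and integrality -/

namespace AlgebraicGeometry.Proj

open HomogeneousLocalization

section

variable {k A A' B : Type} [CommRing k] [CommRing A] [Algebra k A] [CommRing A'] [Algebra k A']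
  [CommRing B] (𝒜 : ℕ → Submodule k A) [GradedAlgebra 𝒜] (ℬ : ℕ → Submodule k A') [GradedAlgebra ℬ]

lemma awayLift_comp_map (φ : 𝒜 →+*ᵍ ℬ) (h : A' →+* B) {m : ℕ} {t : A} (ht : t ∈ 𝒜 m)
    (hu : IsUnit (h (φ t))) : (awayLift ℬ h hu).comp (Away.map φ t) =
      awayLift 𝒜 (h.comp φ.toRingHom) (t := t) hu := by
  rw [awayLift_eq_iff 𝒜 _ _ ht]
  intro n x hx
  rw [RingHom.comp_apply, Away.map_mk]
  exact awayLift_mk ℬ h hu (φ.map_mem ht) n _ _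

lemma point_map (φ : 𝒜 →+*ᵍ ℬ) (hφ) (h : A' →+* B) {m : ℕ} {t : A} (ht : t ∈ 𝒜 m) (hm : 0 < m)
    (hu : IsUnit (h (φ t))) : point ℬ (φ.map_mem ht) hm h hu ≫ Proj.map φ hφ =
      point 𝒜 ht hm (h.comp φ.toRingHom) hu := by
  refine (Category.assoc _ _ _).trans ((congrArg (_ ≫ ·) (awayι_comp_map φ hφ hm t ht)).trans ?_)
  rw [← Spec.map_comp_assoc, ← CommRingCat.ofHom_comp]
  exact congrArg (fun g => Spec.map (CommRingCat.ofHom g) ≫ _) (awayLift_comp_map 𝒜 ℬ φ h ht hu)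

/-- `Proj` of an integral domain is irreducible. -/
lemma irreducibleSpace [IsDomain A] {m : ℕ} {t : A} (ht : t ∈ 𝒜 m) (hm : 0 < m) (h0 : t ≠ 0) :
    IrreducibleSpace (Proj 𝒜) := by
  let η : ProjectiveSpectrum 𝒜 :=
    { asHomogeneousIdeal := ⊥
      isPrime := Ideal.isPrime_bot
      not_irrelevant_le := fun h => h0 (h (HomogeneousIdeal.mem_irrelevant_of_mem _ hm ht)) }
  have h1 : closure {η} = Set.univ := by
    refine Set.eq_univ_of_forall fun x => ?_
    rw [← ProjectiveSpectrum.le_iff_mem_closure]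
    exact bot_le (a := x.asHomogeneousIdeal)
  have h2 : IsIrreducible (Set.univ : Set (ProjectiveSpectrum 𝒜)) := h1 ▸ isIrreducible_singleton.closure
  have h3 : IrreducibleSpace (ProjectiveSpectrum 𝒜) :=
    { isPreirreducible_univ := h2.2
      toNonempty := ⟨η⟩ }
  exact h3

lemma away_isDomain [IsDomain A] {t : A} (h0 : t ≠ 0) : IsDomain (Away 𝒜 t) := by
  have := IsLocalization.isDomain_localization (M := Submonoid.powers t)
    (powers_le_nonZeroDivisors_of_noZeroDivisors h0)
  exact (val_injective (𝒜 := 𝒜) (Submonoid.powers t)).isDomain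
    (algebraMap (Away 𝒜 t) (Localization (Submonoid.powers t)))

end

end AlgebraicGeometry.Proj

/-! ### Points of the model x y = F(z, t) in the chart t ≠ 0 -/

namespace RealConic

noncomputable section

open Proj HomogeneousLocalization

section ModelPoints

variable {d : ℕ} {F : MvPolynomial (Fin 2) ℝ} (hF : F.IsHomogeneous (2 * d))

/-- The coordinate ring of the model. -/
abbrev ModelRing : Type := CoordinateRing (modelPoly_isWeightedHomogeneous hF)

/-- The coordinate ring of the affine chart `t ≠ 0` of the model. -/
abbrev ModelChartRing : Type := Away (modelGrading hF) (lineToModel hF (X 1))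

variable {B B' : Type} [CommRing B] [CommRing B'] (ρ : Polynomial ℝ →+* B) {x y : B}
  (h : x * y = ρ (dehomogenize F))

lemma lineToModel_X_one_mem : lineToModel hF (X 1) ∈ modelGrading hF 1 :=
  (lineToModel hF).map_mem X_one_mem

/-- The homomorphism from the coordinate ring of the model given by the point `[x : y : ρ(X) : 1]`. -/
def modelHom : ModelRing hF →+* B :=
  coordinateHom _ (ρ.comp Polynomial.C) ![x, y, ρ Polynomial.X, 1] (by
    have h1 : (eval₂Hom (ρ.comp Polynomial.C) ![x, y, ρ Polynomial.X, 1]).comp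
        (rename ![2, 3] : MvPolynomial (Fin 2) ℝ →ₐ[ℝ] MvPolynomial (Fin 4) ℝ).toRingHom =
        ρ.comp (dehomogenize : _ →+* _) := by
      refine MvPolynomial.ringHom_ext (fun r => by simp) (fun i => ?_)
      fin_cases i <;> simp
    have h2 := congr($h1 F)
    simp only [AlgHom.toRingHom_eq_coe, RingHom.comp_apply, RingHom.coe_coe, coe_eval₂Hom] at h2
    simp [modelPoly, h2, h])

lemma modelHom_lineToModel (p : MvPolynomial (Fin 2) ℝ) :
    modelHom hF ρ h (lineToModel hF p) = ρ (dehomogenize p) := by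
  have h1 : (modelHom hF ρ h).comp (lineToModel hF).toRingHom =
      ρ.comp (dehomogenize : _ →+* _) := by
    refine MvPolynomial.ringHom_ext (fun r => ?_) (fun i => ?_)
    · simp [lineToModel, modelHom]
    · fin_cases i <;> simp [lineToModel, modelHom]
  exact congr($h1 p)

lemma modelHom_lineToModel_one : modelHom hF ρ h (lineToModel hF (X 1)) = 1 := by
  rw [modelHom_lineToModel]
  simp

@[simp] lemma modelHom_coordinate (i : Fin 4) :
    modelHom hF ρ h (coordinate _ i) = (![x, y, ρ Polynomial.X, 1] : Fin 4 → B) i :=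
  coordinateHom_coordinate _ i

lemma comp_modelHom (g : B →+* B') : g.comp (modelHom hF ρ h) =
    modelHom hF (g.comp ρ) (x := g x) (y := g y) (by rw [← map_mul, h]; rfl) := by
  rw [modelHom, comp_coordinateHom, modelHom]
  congr 1
  ext i
  fin_cases i <;> simp

lemma modelHom_comp_modelRingSwap : (modelHom hF ρ h).comp (modelRingSwap hF).toRingHom =
    modelHom hF ρ (x := y) (y := x) (by rw [mul_comm, h]) := by
  refine Ideal.Quotient.ringHom_ext (MvPolynomial.ringHom_ext (fun r => ?_) (fun i => ?_))
  · simp [modelRingSwap, quotientMap, polySwap, modelHom]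
  · fin_cases i <;> simp [modelRingSwap, quotientMap, polySwap, modelHom, Equiv.swap_apply_def]

/-- The homomorphism from the coordinate ring of the chart given by the point
`[x : y : ρ(X) : 1]`. -/
def modelChartHom : ModelChartRing hF →+* B :=
  awayLift (modelGrading hF) (modelHom hF ρ h) (t := lineToModel hF (X 1))
    (by simp [modelHom_lineToModel_one])

lemma modelChartHom_dehomog (p : ModelRing hF) :
    modelChartHom hF ρ h (dehomog (modelGrading hF) (lineToModel_X_one_mem hF) p) =
      modelHom hF ρ h p :=
  congr($(awayLift_comp_dehomog (modelGrading hF) (lineToModel_X_one_mem hF) (modelHom hF ρ h)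
    (modelHom_lineToModel_one hF ρ h)) p)

/-- The chart `t ≠ 0` is affine. -/
def modelChartIso : (modelChart hF).toScheme ≅ Spec (.of (ModelChartRing hF)) :=
  Proj.basicOpenIsoSpec (modelGrading hF) (lineToModel hF (X 1)) (lineToModel_X_one_mem hF) one_pos

lemma modelChartIso_inv_modelProj : Spec.map (CommRingCat.ofHom (modelChartHom hF ρ h)) ≫
    (modelChartIso hF).inv ≫ modelProj hF = affinePoint ρ := by
  have h1 : (modelHom hF ρ h).comp (lineToModel hF).toRingHom = ρ.comp (dehomogenize : _ →+* _) :=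
    RingHom.ext (modelHom_lineToModel hF ρ h)
  have h2 : (modelChartIso hF).inv ≫ modelProj hF =
      Spec.map (CommRingCat.ofHom (Away.map (lineToModel hF) (X 1))) ≫
        Proj.awayι lineGrading (X 1) X_one_mem one_pos :=
    Iso.inv_hom_id_assoc (Proj.basicOpenIsoSpec (modelGrading hF) (lineToModel hF (X 1))
      (lineToModel_X_one_mem hF) one_pos) _
  rw [h2, ← Spec.map_comp_assoc, ← CommRingCat.ofHom_comp]
  have h3 := awayLift_comp_map _ _ (lineToModel hF) (modelHom hF ρ h) X_one_mem
    (by simp [modelHom_lineToModel_one])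
  refine congrArg (fun g => Spec.map (CommRingCat.ofHom g) ≫ _) (h3.trans ?_)
  simp only [h1]

/-- Equivariance at a point. A ring endomorphism g that exchanges x and y and fixes the base
parameter acts on the coordinates exactly as the swap does; g will be the involution of the function
field. -/
lemma modelChartIso_inv_modelSwap (g : B →+* B) (hg : g.comp ρ = ρ) (hx : g x = y) (hy : g y = x) :
    Spec.map (CommRingCat.ofHom g) ≫ Spec.map (CommRingCat.ofHom (modelChartHom hF ρ h)) ≫
      (modelChartIso hF).inv ≫ (modelChart hF).ι =
    Spec.map (CommRingCat.ofHom (modelChartHom hF ρ h)) ≫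
      (modelChartIso hF).inv ≫ (modelChart hF).ι ≫ modelSwap hF := by
  have h1 : Spec.map (CommRingCat.ofHom (modelChartHom hF ρ h)) ≫
      (modelChartIso hF).inv ≫ (modelChart hF).ι =
      point (modelGrading hF) (lineToModel_X_one_mem hF) one_pos (modelHom hF ρ h)
        (by simp [modelHom_lineToModel_one]) := rfl
  have h2 : modelRingSwap hF (lineToModel hF (X 1)) = lineToModel hF (X 1) := by
    change Ideal.Quotient.mk _ (rename swapXY (rename ![2, 3] (X 1))) =
      Ideal.Quotient.mk _ (rename ![2, 3] (X 1))
    simp [Equiv.swap_apply_def]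
  have h3 := point_map (modelGrading hF) (modelGrading hF) (modelRingSwap hF)
    (by
      rw [HomogeneousIdeal.irrelevant_le]
      intro i hi a ha
      have h' := Ideal.mem_map_of_mem (modelRingSwap hF)
        (HomogeneousIdeal.mem_irrelevant_of_mem _ hi ((modelRingSwap hF).map_mem ha) :
          modelRingSwap hF a ∈ (HomogeneousIdeal.irrelevant (modelGrading hF)))
      rwa [modelRingSwap_modelRingSwap] at h') (modelHom hF ρ h)
    (lineToModel_X_one_mem hF) one_pos (by simp [h2, modelHom_lineToModel_one])
  have h4 : g.comp (modelHom hF ρ h) = (modelHom hF ρ h).comp (modelRingSwap hF).toRingHom := by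
    rw [comp_modelHom, modelHom_comp_modelRingSwap]
    simp only [hg, hx, hy]
  rw [← Category.assoc (modelChartIso hF).inv,
    ← Category.assoc (Spec.map (CommRingCat.ofHom (modelChartHom hF ρ h))) _ (modelSwap hF), h1,
    Spec_map_point, modelSwap]
  simp only [h4]
  rw [← h3]
  congr 1
  exact point_congr _ _ _ _ _ _ _ _

end ModelPoints

end

end RealConic

/-! ### Integrality and function field of the chart -/

namespace RealConic

noncomputable section

open Proj HomogeneousLocalization

section ModelChart

variable {d : ℕ} {F : MvPolynomial (Fin 2) ℝ}

/-- The polynomial is linear in y with leading coefficient x, which is coprime to F because F is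
nonzero and does not involve x. -/
lemma irreducible_modelPoly (hF0 : F ≠ 0) : Irreducible (modelPoly F) := by
  have hcomp : (![2, 3] : Fin 2 → Fin 4).Injective := by decide
  have hv (i : Fin 4) (hi : i = 0 ∨ i = 1) : i ∉ (rename (R := ℝ) ![2, 3] F).vars := by
    intro h
    obtain ⟨j, -, hj⟩ := Finset.mem_image.mp (vars_rename _ _ h)
    fin_cases j <;> rcases hi with rfl | rfl <;> simp at hj
  have h := irreducible_mul_X_add (X 0 : MvPolynomial (Fin 4) ℝ) (-rename ![2, 3] F) 1
    (X_ne_zero 0) (by simp) (by rw [vars_neg]; exact hv 1 (.inr rfl)) ?_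
  · rwa [← sub_eq_add_neg] at h
  · rw [IsRelPrime.neg_right_iff,
      (X_prime (R := ℝ) (i := (0 : Fin 4))).irreducible.isRelPrime_iff_not_dvd]
    intro hdvd
    -- Setting x = 0 kills x but leaves F unchanged.
    have h1 := map_dvd (aeval (Function.update X 0 0) :
      MvPolynomial (Fin 4) ℝ →ₐ[ℝ] MvPolynomial (Fin 4) ℝ) hdvd
    have h2 : (Function.update X 0 0 : Fin 4 → MvPolynomial (Fin 4) ℝ) ∘ ![2, 3] =
        X ∘ ![2, 3] := by
      ext1 i
      fin_cases i <;> simp [Function.update]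
    rw [aeval_X, Function.update_self, aeval_rename, h2, zero_dvd_iff] at h1
    refine hF0 (rename_injective _ hcomp (Eq.trans ?_ (h1.trans (map_zero _).symm)))
    exact (aeval_X_left_apply _).symm.trans (aeval_rename _ _ _)

variable (hF : F.IsHomogeneous (2 * d))

lemma isDomain_modelRing (hF0 : F ≠ 0) : IsDomain (ModelRing hF) := by
  have h1 : (hypersurfaceIdeal (modelPoly_isWeightedHomogeneous hF)).toIdeal.IsPrime :=
    (Ideal.span_singleton_prime (irreducible_modelPoly hF0).ne_zero).mpr
      (irreducible_modelPoly hF0).prime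
  exact Ideal.Quotient.isDomain _

lemma lineToModel_X_one_ne_zero : lineToModel hF (X 1) ≠ 0 := by
  intro h
  -- Any real point of the chart serves; here [1 : F(0, 1) : 0 : 1].
  have h1 := modelHom_lineToModel_one hF (Polynomial.evalRingHom (0 : ℝ)) (one_mul _)
  rw [h, map_zero] at h1
  exact zero_ne_one h1

lemma irreducibleSpace_model (hF0 : F ≠ 0) : IrreducibleSpace (Model hF) :=
  have := isDomain_modelRing hF hF0
  Proj.irreducibleSpace (modelGrading hF) (lineToModel_X_one_mem hF) one_pos
    (lineToModel_X_one_ne_zero hF)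

lemma isDomain_modelChartRing (hF0 : F ≠ 0) : IsDomain (ModelChartRing hF) :=
  have := isDomain_modelRing hF hF0
  Proj.away_isDomain (modelGrading hF) (lineToModel_X_one_ne_zero hF)

/-- Up to powers of `x`, the functions on the model are polynomials in `x`. -/
lemma exists_pow_mul_modelHom_eq (p : ModelRing hF) : ∃ (N : ℕ) (P : Polynomial (Polynomial ℝ)),
    ∀ {B : Type} [CommRing B] (ρ : Polynomial ℝ →+* B) {x y : B}
      (h : x * y = ρ (dehomogenize F)), x ^ N * modelHom hF ρ h p = P.eval₂ ρ x := by
  obtain ⟨p, rfl⟩ := Ideal.Quotient.mk_surjective p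
  induction p using MvPolynomial.induction_on with
  | C r =>
    refine ⟨0, Polynomial.C (Polynomial.C r), fun ρ x y h => ?_⟩
    simp [modelHom]
  | add p q hp hq =>
    obtain ⟨N, P, hP⟩ := hp
    obtain ⟨M, Q, hQ⟩ := hq
    refine ⟨N + M, Polynomial.X ^ M * P + Polynomial.X ^ N * Q, fun ρ x y h => ?_⟩
    simp only [Polynomial.eval₂_add, Polynomial.eval₂_mul, Polynomial.eval₂_pow, Polynomial.eval₂_X,
      ← hP ρ h, ← hQ ρ h, map_add]
    ring
  | mul_X p i hp =>
    obtain ⟨N, P, hP⟩ := hp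
    have key {B : Type} [CommRing B] (ρ : Polynomial ℝ →+* B) {x y : B}
        (h : x * y = ρ (dehomogenize F)) : modelHom hF ρ h (Ideal.Quotient.mk _ (p * X i)) =
        modelHom hF ρ h (Ideal.Quotient.mk _ p) *
          (![x, y, ρ Polynomial.X, 1] : Fin 4 → B) i := by
      rw [← modelHom_coordinate hF ρ h, map_mul, map_mul, coordinate]
    obtain ⟨M, Q, hQ⟩ : ∃ (M : ℕ) (Q : Polynomial (Polynomial ℝ)),
        ∀ {B : Type} [CommRing B] (ρ : Polynomial ℝ →+* B) {x y : B}
          (_ : x * y = ρ (dehomogenize F)),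
          x ^ M * (![x, y, ρ Polynomial.X, 1] : Fin 4 → B) i = Q.eval₂ ρ x := by
      fin_cases i
      · exact ⟨0, Polynomial.X, fun ρ x y h => by simp⟩
      · exact ⟨1, Polynomial.C (dehomogenize F), fun ρ x y h =>
          (congrArg (· * y) (pow_one x)).trans (h.trans (Polynomial.eval₂_C _ _).symm)⟩
      · exact ⟨0, Polynomial.C Polynomial.X, fun ρ x y h => by simp⟩
      · exact ⟨0, 1, fun ρ x y h => by simp⟩
    refine ⟨N + M, P * Q, fun ρ x y h => ?_⟩
    rw [key, Polynomial.eval₂_mul, ← hP ρ h, ← hQ ρ h]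
    ring

/-- The tautological point of the chart. -/
lemma exists_dehomog_eq_modelHom : ∃ (ρ : Polynomial ℝ →+* ModelChartRing hF)
    (x y : ModelChartRing hF) (h : x * y = ρ (dehomogenize F)),
    dehomog (modelGrading hF) (lineToModel_X_one_mem hF) = modelHom hF ρ h := by
  set D := dehomog (modelGrading hF) (lineToModel_X_one_mem hF)
  let ρ : Polynomial ℝ →+* ModelChartRing hF := Polynomial.eval₂RingHom
    (D.comp (algebraMap ℝ (ModelRing hF))) (D (coordinate _ 2))
  have hX0 : lineToModel hF (X 0) = coordinate _ 2 :=
    congrArg (Ideal.Quotient.mk _) (rename_X ![(2 : Fin 4), 3] 0)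
  have hX1 : lineToModel hF (X 1) = coordinate _ 3 :=
    congrArg (Ideal.Quotient.mk _) (rename_X ![(2 : Fin 4), 3] 1)
  have hD3 : D (coordinate _ 3) = 1 :=
    (congrArg D hX1).symm.trans (dehomog_self (modelGrading hF) (lineToModel_X_one_mem hF))
  have h1 : (D.comp (lineToModel hF).toRingHom) = ρ.comp (dehomogenize : _ →+* _) := by
    refine MvPolynomial.ringHom_ext (fun r => ?_) (fun i => ?_)
    · have e1 : lineToModel hF (C r) = algebraMap ℝ (ModelRing hF) r :=
        congrArg (Ideal.Quotient.mk _) (rename_C _ _)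
      have e2 : ρ (dehomogenize (C r)) = D (algebraMap ℝ (ModelRing hF) r) := by simp [ρ]
      exact (congrArg D e1).trans e2.symm
    · fin_cases i
      · have e2 : ρ (dehomogenize (X 0)) = D (coordinate _ 2) := by simp [ρ]
        exact (congrArg D hX0).trans e2.symm
      · have e2 : ρ (dehomogenize (X 1)) = 1 := by simp [ρ]
        exact (congrArg D hX1).trans (hD3.trans e2.symm)
  have h2 : coordinate (modelPoly_isWeightedHomogeneous hF) 0 *
      coordinate (modelPoly_isWeightedHomogeneous hF) 1 = lineToModel hF F := by
    have h3 : Ideal.Quotient.mk (hypersurfaceIdeal (modelPoly_isWeightedHomogeneous hF)).toIdeal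
        (X 0 * X 1 - rename ![2, 3] F) = 0 :=
      Ideal.Quotient.eq_zero_iff_mem.mpr (Ideal.mem_span_singleton_self _)
    rw [map_sub, map_mul, sub_eq_zero] at h3
    exact h3
  refine ⟨ρ, D (coordinate _ 0), D (coordinate _ 1), ?_, ?_⟩
  · rw [← map_mul, h2]
    exact congr($h1 F)
  · refine Ideal.Quotient.ringHom_ext (MvPolynomial.ringHom_ext (fun r => ?_) (fun i => ?_))
    · simp [modelHom, ρ]
      rfl
    · have h5 : ρ Polynomial.X = D (coordinate _ 2) := by simp [ρ]
      have h6 := modelHom_coordinate hF ρ (x := D (coordinate _ 0)) (y := D (coordinate _ 1))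
        (by rw [← map_mul, h2]; exact congr($h1 F)) i
      refine Eq.trans ?_ h6.symm
      change D (coordinate _ i) = _
      fin_cases i
      · rfl
      · rfl
      · exact h5.symm
      · exact hD3

/-- A nonzero function on the chart is, up to powers of `x`, a nonzero polynomial in `x`. -/
lemma exists_pow_mul_modelChartHom_eq (hF0 : F ≠ 0) {a : ModelChartRing hF} (ha : a ≠ 0) :
    ∃ (N : ℕ) (P : Polynomial (Polynomial ℝ)), P ≠ 0 ∧
      ∀ {B : Type} [CommRing B] (ρ : Polynomial ℝ →+* B) {x y : B}
        (h : x * y = ρ (dehomogenize F)), x ^ N * modelChartHom hF ρ h a = P.eval₂ ρ x := by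
  have := isDomain_modelChartRing hF hF0
  obtain ⟨p, rfl⟩ := dehomog_surjective (modelGrading hF) (lineToModel_X_one_mem hF) a
  obtain ⟨N, P, hP⟩ := exists_pow_mul_modelHom_eq hF p
  refine ⟨N, P, ?_, fun ρ x y h => by rw [modelChartHom_dehomog, hP]⟩
  rintro rfl
  -- If P were zero, the tautological point would give xᴺ a = 0 and hence x = 0 in the domain of
  -- functions on the chart. A real point with x = 1 excludes this.
  obtain ⟨ρ, x, y, h, hD⟩ := exists_dehomog_eq_modelHom hF
  have h1 := hP ρ h
  rw [← hD, Polynomial.eval₂_zero, mul_eq_zero, or_iff_left ha] at h1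
  have h2 := modelChartHom_dehomog hF (Polynomial.evalRingHom (0 : ℝ)) (one_mul _)
    (coordinate _ 0)
  rw [hD, modelHom_coordinate, modelHom_coordinate, Matrix.cons_val_zero, Matrix.cons_val_zero,
    eq_zero_of_pow_eq_zero h1, map_zero] at h2
  exact zero_ne_one h2

lemma modelChartHom_injective (hF0 : F ≠ 0) {B : Type} [CommRing B] {ρ : Polynomial ℝ →+* B}
    {x y : B} (h : x * y = ρ (dehomogenize F))
    (hx : ∀ P : Polynomial (Polynomial ℝ), P ≠ 0 → P.eval₂ ρ x ≠ 0) :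
    Function.Injective (modelChartHom hF ρ h) := by
  rw [injective_iff_map_eq_zero]
  intro a ha
  by_contra ha0
  obtain ⟨N, P, hP0, hP⟩ := exists_pow_mul_modelChartHom_eq hF hF0 ha0
  refine hx P hP0 ?_
  rw [← hP ρ h, ha, mul_zero]

lemma finiteType_algebraMap_modelChartRing :
    ((dehomog (modelGrading hF) (lineToModel_X_one_mem hF)).comp
      (algebraMap ℝ (ModelRing hF))).FiniteType := by
  refine RingHom.FiniteType.comp (RingHom.FiniteType.of_surjective _ (dehomog_surjective _ _)) ?_
  have h1 : algebraMap ℝ (ModelRing hF) =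
    (Ideal.Quotient.mk _).comp (C : ℝ →+* MvPolynomial (Fin 4) ℝ) := rfl
  rw [h1]
  refine RingHom.FiniteType.comp
    (RingHom.FiniteType.of_surjective _ Ideal.Quotient.mk_surjective) ?_
  exact RingHom.finiteType_algebraMap.mpr
    (inferInstanceAs (Algebra.FiniteType ℝ (MvPolynomial (Fin 4) ℝ)))

/-- The function field of the chart. -/
lemma isFractionRing_modelChartRing (hF0 : F ≠ 0) {K L : Type} [Field K] [Field L]
    [Algebra (Polynomial ℝ) K] [IsFractionRing (Polynomial ℝ) K] [Algebra K L] {x y : L}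
    (hx : IntermediateField.adjoin K {x} = ⊤) (hx' : Transcendental K x)
    (h : x * y = (algebraMap K L).comp (algebraMap (Polynomial ℝ) K) (dehomogenize F)) :
    let := (modelChartHom hF ((algebraMap K L).comp (algebraMap (Polynomial ℝ) K)) h).toAlgebra
    IsFractionRing (ModelChartRing hF) L := by
  have := isDomain_modelChartRing hF hF0
  set ρ := (algebraMap K L).comp (algebraMap (Polynomial ℝ) K)
  let ψ := modelChartHom hF ρ h
  let := ψ.toAlgebra
  have hinj : Function.Injective ψ := by
    refine modelChartHom_injective hF hF0 h fun P hP h0 => ?_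
    have h1 : Polynomial.aeval x (P.map (algebraMap (Polynomial ℝ) K)) = 0 := by
      rw [Polynomial.aeval_def, Polynomial.eval₂_map]
      exact h0
    have h2 := (transcendental_iff.mp hx') _ h1
    exact hP ((Polynomial.map_eq_zero_iff (IsFractionRing.injective (Polynomial ℝ) K)).mp h2)
  have : FaithfulSMul (ModelChartRing hF) L := (faithfulSMul_iff_algebraMap_injective _ _).mpr hinj
  -- The image of θ is a subfield containing ℝ[s], hence K, and also the generator x. It is
  -- therefore all of L.
  let θ : FractionRing (ModelChartRing hF) →+* L := IsFractionRing.lift (g := ψ) hinj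
  have hθ (a : ModelChartRing hF) : ψ a ∈ θ.fieldRange :=
    ⟨algebraMap _ _ a, IsFractionRing.lift_algebraMap hinj a⟩
  have hρ (p : Polynomial ℝ) : ρ p ∈ θ.fieldRange := by
    induction p using Polynomial.induction_on with
    | C r =>
      have h1 := modelChartHom_dehomog hF ρ h (algebraMap ℝ (ModelRing hF) r)
      have h2 : modelHom hF ρ h (algebraMap ℝ (ModelRing hF) r) = ρ (Polynomial.C r) := by
        rw [modelHom, ← RingHom.comp_apply, coordinateHom_comp_algebraMap]
        rfl
      rw [← h2, ← h1]
      exact hθ _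
    | add p q hp hq => rw [map_add]; exact add_mem hp hq
    | monomial n r hr =>
      have h1 := modelChartHom_dehomog hF ρ h (coordinate _ 2)
      rw [modelHom_coordinate] at h1
      replace h1 : _ = ρ Polynomial.X := h1
      rw [pow_succ, ← mul_assoc, map_mul]
      exact mul_mem hr (h1 ▸ hθ _)
  have hK (z : K) : algebraMap K L z ∈ θ.fieldRange := by
    obtain ⟨a, b, -, rfl⟩ := IsFractionRing.div_surjective (A := Polynomial ℝ) z
    rw [map_div₀]
    exact div_mem (hρ a) (hρ b)
  have htop : (⊤ : IntermediateField K L) ≤ θ.fieldRange.toIntermediateField hK := by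
    rw [← hx]
    refine IntermediateField.adjoin_le_iff.mpr (Set.singleton_subset_iff.mpr ?_)
    have h1 := modelChartHom_dehomog hF ρ h (coordinate _ 0)
    rw [modelHom_coordinate] at h1
    replace h1 : _ = x := h1
    have h2 : x ∈ θ.fieldRange := h1 ▸ hθ _
    exact h2
  refine IsFractionRing.of_field _ _ fun z => ?_
  obtain ⟨w, rfl⟩ : z ∈ θ.fieldRange := htop (IntermediateField.mem_top (x := z))
  obtain ⟨a, b, -, rfl⟩ := IsFractionRing.div_surjective (A := ModelChartRing hF) w
  exact ⟨a, b, by rw [map_div₀, IsFractionRing.lift_algebraMap, IsFractionRing.lift_algebraMap]; rfl⟩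

end ModelChart

end

end RealConic

/-! ### Lifts of real points give a de Jonquières involution -/

lemma AlgebraicGeometry.exists_iso_functionField_spec (A : CommRingCat.{0}) [IsDomain A]
    (L : Type) [Field L] [Algebra A L] [IsFractionRing A L] :
    ∃ e : Spec (.of L) ≅ Spec (Spec A).functionField,
      e.hom ≫ (Spec A).fromSpecStalk (genericPoint (Spec A)) =
        Spec.map (CommRingCat.ofHom (algebraMap A L)) := by
  let α : (Spec A).functionField ≃ₐ[A] L := IsLocalization.algEquiv (nonZeroDivisors A) _ _
  refine ⟨Scheme.Spec.mapIso (RingEquiv.toCommRingCatIso (R := (Spec A).functionField)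
    (S := CommRingCat.of L) α.toRingEquiv).op, ?_⟩
  rw [Spec.fromSpecStalk_eq']
  refine (Spec.map_comp _ _).symm.trans ?_
  congr 1
  ext a
  exact α.commutes a

namespace RealConic

/-- If all real points of the line lift to real points of the conic bundle `S`, then `S` with its
involution is birational to a model `x y = F(z, t)`. -/
theorem isDeJonquieres_of_forall_exists_lift {S : Scheme.{0}} [IsIntegral S]
    {sS : S ⟶ Spec (.of ℝ)} [IsProper sS] [SmoothOfRelativeDimension 2 sS] {π : S ⟶ P1}
    (hπ : π ≫ P1.toSpec = sS) (hconic : IsConicBundle π) {τ : S ≅ S} (hτ_ne : τ.hom ≠ 𝟙 S)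
    (hτ_inv : τ.hom ≫ τ.hom = 𝟙 S) (hτ_base : τ.hom ≫ π = π)
    (hσ : ∀ s₀ : ℝ, ∃ σ : Spec (.of ℝ) ⟶ S, σ ≫ sS = 𝟙 _ ∧
      σ ≫ π = affinePoint (Polynomial.evalRingHom s₀)) : IsDeJonquieres π τ := by
  have hsep : S.IsSeparated :=
    ⟨by rw [← Limits.terminal.comp_from sS]; infer_instance⟩
  obtain ⟨q, hq, ι, hι⟩ := hconic.exists_isPullback
  obtain ⟨ρ, hK⟩ := exists_fromSpecStalk_comp_eq (map_genericPoint hι)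
  let : Algebra LineField S.functionField := ρ.toAlgebra
  obtain ⟨t, ht⟩ := exists_adjoin_simple_eq_top hK hπ hconic hσ
  have hnal := not_isAlgebraic_functionField hK hπ
  obtain ⟨e, hee, hne, he⟩ := exists_algEquiv_functionField hK τ hτ_ne hτ_inv hτ_base
  obtain ⟨x, f, hx, hf0, hxe⟩ := exists_generator_mul_apply_eq
    (transcendental_of_adjoin_eq_top hnal ht) ht e hee hne
  obtain ⟨a, c, ha0, hc0, rfl⟩ := exists_eq_algebraMap_mul_sq (R := Polynomial ℝ) hf0
  obtain ⟨p, r, rfl, hp, hr0⟩ := Polynomial.exists_eq_squarefree_mul_sq a ha0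
  obtain ⟨d, F, hF, hsq, rfl⟩ := exists_squarefree_homogenization hp
  have hF0 : F ≠ 0 := hsq.ne_zero
  -- Now f = F(s, 1) (r c)², so dividing the generator x by r c makes its product with its conjugate
  -- equal to F(s, 1).
  set u : LineField := (algebraMap (Polynomial ℝ) LineField r * c)⁻¹ with hu
  have hr : algebraMap (Polynomial ℝ) LineField r ≠ 0 :=
    (map_ne_zero_iff _ (IsFractionRing.injective (Polynomial ℝ) LineField)).mpr hr0
  have hu0 : algebraMap (Polynomial ℝ) LineField r * c ≠ 0 :=
    mul_ne_zero hr hc0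
  set z : S.functionField := algebraMap LineField S.functionField u * x with hz
  have hztop : IntermediateField.adjoin LineField {z} = ⊤ := by
    rw [eq_top_iff, ← hx]
    refine IntermediateField.adjoin_le_iff.mpr (Set.singleton_subset_iff.mpr ?_)
    have h1 : x = algebraMap LineField S.functionField u⁻¹ * z := by
      rw [hz, ← mul_assoc, ← map_mul, inv_mul_cancel₀ (inv_ne_zero hu0), map_one, one_mul]
    rw [h1]
    exact mul_mem (IntermediateField.algebraMap_mem _ _)
      (IntermediateField.mem_adjoin_simple_self _ _)
  have hze : z * e z = (algebraMap LineField S.functionField).comp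
      (algebraMap (Polynomial ℝ) LineField) (dehomogenize F) := by
    rw [hz, map_mul, e.commutes, mul_mul_mul_comm, hxe, ← map_mul, ← map_mul, RingHom.comp_apply]
    congr 1
    rw [hu, map_mul, map_pow]
    field_simp
  have hdom := isDomain_modelChartRing hF hF0
  have hirr := irreducibleSpace_model hF hF0
  -- The coordinates x and y of the model are sent to z and its conjugate e z.
  have hfrac := isFractionRing_modelChartRing hF hF0 hztop
    (transcendental_of_adjoin_eq_top hnal hztop) hze
  set ρL := (algebraMap LineField S.functionField).comp (algebraMap (Polynomial ℝ) LineField)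
  let : Algebra (ModelChartRing hF) S.functionField := (modelChartHom hF ρL hze).toAlgebra
  obtain ⟨E, hE⟩ := exists_iso_functionField_spec (.of (ModelChartRing hF)) S.functionField
  replace hE : _ = Spec.map (CommRingCat.ofHom (modelChartHom hF ρL hze)) := hE
  have hπK := fromSpecStalk_genericPoint_comp hK
  set g := (Proj.dehomog (modelGrading hF) (lineToModel_X_one_mem hF)).comp
    (algebraMap ℝ (ModelRing hF)) with hg
  have hlft : LocallyOfFiniteType (Spec.map (CommRingCat.ofHom g)) := by
    rw [HasRingHomProperty.Spec_iff (P := @LocallyOfFiniteType)]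
    exact finiteType_algebraMap_modelChartRing hF
  obtain ⟨W, j, k, q₀, hj, hk, hqj, hqk⟩ := Scheme.exists_isOpenImmersion_of_functionField sS
    (Spec.map (CommRingCat.ofHom g)) E (by
      rw [reassoc_of% hE, ← Spec.map_comp, ← CommRingCat.ofHom_comp, ← hπ, reassoc_of% hπK,
        affinePoint_toSpec]
      congr 2
      refine RingHom.ext fun r => ?_
      refine (modelChartHom_dehomog hF ρL hze (algebraMap ℝ (ModelRing hF) r)).trans ?_
      rw [modelHom, ← RingHom.comp_apply, coordinateHom_comp_algebraMap])
  rw [hE] at hqk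
  refine isDeJonquieres_of_genericPoint hτ_inv hF hsq j (k ≫ (modelChartIso hF).inv) q₀ hqj
    (Spec.map (CommRingCat.ofHom (e : S.functionField →+* S.functionField))) he ?_ ?_
  · simp only [Category.assoc, reassoc_of% hqk]
    exact modelChartIso_inv_modelSwap hF ρL hze _ (RingHom.ext fun p => e.commutes _) rfl (hee z)
  · simp only [Category.assoc, reassoc_of% hqk, reassoc_of% hqj]
    rw [modelChartIso_inv_modelProj, hπK]

end RealConic

/-! ### A de Jonquières involution gives lifts of real points -/

/-- A rational section of a proper morphism over the affine line extends to every real point. -/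
lemma AlgebraicGeometry.exists_lift_of_isProper {S Y : Scheme.{0}} {π : S ⟶ Y} [IsProper π]
    (β : Spec (.of (Polynomial ℝ)) ⟶ Y) (m : Spec (.of (FractionRing (Polynomial ℝ))) ⟶ S)
    (hm : m ≫ π = Spec.map (CommRingCat.ofHom
      (algebraMap (Polynomial ℝ) (FractionRing (Polynomial ℝ)))) ≫ β) (s₀ : ℝ) :
    ∃ s : Spec (.of ℝ) ⟶ S,
      s ≫ π = Spec.map (CommRingCat.ofHom (Polynomial.evalRingHom s₀)) ≫ β := by
  let p : Ideal (Polynomial ℝ) := RingHom.ker (Polynomial.evalRingHom s₀)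
  have hp : p.IsPrime := RingHom.ker_isPrime _
  have hp0 : p ≠ ⊥ := by
    intro h
    have h1 : Polynomial.X - Polynomial.C s₀ ∈ p := by simp [p]
    rw [h, Ideal.mem_bot] at h1
    exact Polynomial.X_sub_C_ne_zero s₀ h1
  let V := Localization.AtPrime p
  -- The local ring of the affine line at s₀ is a valuation ring of ℝ(s) that evaluation at s₀ maps
  -- onto ℝ. The section extends over it and is then evaluated.
  have hdvr : IsDiscreteValuationRing V :=
    IsLocalization.AtPrime.isDiscreteValuationRing_of_dedekind_domain _ hp0 _
  let r : V →+* ℝ := IsLocalization.lift (M := p.primeCompl) (g := Polynomial.evalRingHom s₀)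
    (fun q => isUnit_iff_ne_zero.mpr q.2)
  have hr : r.comp (algebraMap (Polynomial ℝ) V) = Polynomial.evalRingHom s₀ :=
    IsLocalization.lift_comp _
  let sq : ValuativeCommSq π :=
    { R := V
      K := FractionRing (Polynomial ℝ)
      i₁ := m
      i₂ := Spec.map (CommRingCat.ofHom (algebraMap (Polynomial ℝ) V)) ≫ β
      commSq := ⟨by
        rw [hm, ← Spec.map_comp_assoc, ← CommRingCat.ofHom_comp, ← IsScalarTower.algebraMap_eq]⟩ }
  have hval : ValuativeCriterion π := by
    have h1 : IsProper π := inferInstance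
    rw [IsProper.eq_valuativeCriterion] at h1
    exact h1.1.1.1
  obtain ⟨⟨l, -, hl⟩⟩ := (hval.existence sq).exists_lift
  refine ⟨Spec.map (CommRingCat.ofHom r) ≫ l, ?_⟩
  rw [Category.assoc]
  refine (congrArg (_ ≫ ·) hl).trans ?_
  rw [← Spec.map_comp_assoc, ← CommRingCat.ofHom_comp, hr]

namespace RealConic

lemma Spec_map_affinePoint_id {B : Type} [CommRing B] (ρ : Polynomial ℝ →+* B) :
    Spec.map (CommRingCat.ofHom ρ) ≫ affinePoint (RingHom.id _) = affinePoint ρ := by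
  rw [Spec_map_affinePoint, RingHom.comp_id]

lemma Spec_map_affinePointZero_id {B : Type} [CommRing B] (ρ : Polynomial ℝ →+* B) :
    Spec.map (CommRingCat.ofHom ρ) ≫ affinePointZero (RingHom.id _) = affinePointZero ρ := by
  rw [Spec_map_affinePointZero, RingHom.comp_id]

lemma exists_comp_algebraMap_eq {K : Type} [Field K] {θ : Polynomial ℝ →+* K}
    (hθ : Function.Injective θ) :
    ∃ κ : LineField →+* K, κ.comp (algebraMap (Polynomial ℝ) LineField) = θ :=
  ⟨IsFractionRing.lift hθ, RingHom.ext fun p => IsFractionRing.lift_algebraMap hθ p⟩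

lemma eq_evalRingHom_of_Spec_map_eq_id {ρ : Polynomial ℝ →+* ℝ}
    (h : Spec.map (CommRingCat.ofHom (ρ.comp Polynomial.C)) = 𝟙 _) :
    ρ = Polynomial.evalRingHom (ρ Polynomial.X) := by
  have h1 : ρ.comp Polynomial.C = RingHom.id ℝ :=
    congr($(Spec.map_injective (h.trans (Spec.map_id (.of ℝ)).symm)).hom)
  exact Polynomial.ringHom_ext (fun r => (RingHom.congr_fun h1 r).trans (by simp)) (by simp)

/-- The substitution s ↦ 1/s, needed to treat the point at infinity like a finite one. -/
lemma exists_injective_map_X_mul_eq_one : ∃ θ : Polynomial ℝ →+* FractionRing (Polynomial ℝ),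
    Function.Injective θ ∧
      (∀ r, θ (Polynomial.C r) = algebraMap (Polynomial ℝ) _ (Polynomial.C r)) ∧
      θ Polynomial.X * algebraMap (Polynomial ℝ) _ Polynomial.X = 1 := by
  let x : FractionRing (Polynomial ℝ) := algebraMap (Polynomial ℝ) _ Polynomial.X
  have hx : Function.Injective (Polynomial.aeval (R := ℝ) x) := by
    have h1 : Polynomial.aeval (R := ℝ) x =
        IsScalarTower.toAlgHom ℝ (Polynomial ℝ) (FractionRing (Polynomial ℝ)) := by
      ext
      simp [x]
    rw [h1]
    exact IsFractionRing.injective (Polynomial ℝ) (FractionRing (Polynomial ℝ))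
  refine ⟨(Polynomial.aeval (R := ℝ) x⁻¹).toRingHom, ?_, fun r => ?_, ?_⟩
  · rw [← transcendental_iff_injective] at hx
    refine transcendental_iff_injective.mp ?_
    rwa [Transcendental, IsAlgebraic.inv_iff]
  · refine (Polynomial.aeval_C _ _).trans ?_
    rw [IsScalarTower.algebraMap_apply ℝ (Polynomial ℝ)]
    rfl
  · have h3 : x ≠ 0 := by simp [x]
    change Polynomial.aeval x⁻¹ Polynomial.X * x = 1
    rw [Polynomial.aeval_X, inv_mul_cancel₀ h3]

/-- Real points of the line lift along a proper morphism that has a rational section. -/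
lemma exists_comp_eq_of_rational_section {S : Scheme.{0}} {π : S ⟶ P1} [IsProper π]
    (m : Spec (.of LineField) ⟶ S) (hm : m ≫ π = affinePoint (algebraMap (Polynomial ℝ) LineField))
    (b : Spec (.of ℝ) ⟶ P1) (hb : b ≫ P1.toSpec = 𝟙 _) : ∃ s : Spec (.of ℝ) ⟶ S, s ≫ π = b := by
  rcases exists_mem_basicOpen (b (IsLocalRing.closedPoint ℝ)) with h | h
  · obtain ⟨ρ, rfl⟩ := exists_eq_affinePointZero b h
    rw [affinePointZero_toSpec] at hb
    rw [eq_evalRingHom_of_Spec_map_eq_id hb, ← Spec_map_affinePointZero_id]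
    -- The section is reparametrised so that it lies over the generic point written in the
    -- coordinate of the chart z ≠ 0.
    obtain ⟨θ, hθ, hC, hX⟩ := exists_injective_map_X_mul_eq_one
    obtain ⟨κ, rfl⟩ := exists_comp_algebraMap_eq hθ
    refine exists_lift_of_isProper _ (Spec.map (CommRingCat.ofHom κ) ≫ m) ?_ _
    rw [Category.assoc, hm, Spec_map_affinePoint, Spec_map_affinePointZero_id]
    exact affinePoint_eq_affinePointZero _ _ hC hX
  · obtain ⟨ρ, rfl⟩ := exists_eq_affinePoint b h
    rw [affinePoint_toSpec] at hb
    rw [eq_evalRingHom_of_Spec_map_eq_id hb, ← Spec_map_affinePoint_id]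
    obtain ⟨κ, hκ⟩ := exists_comp_algebraMap_eq
      (IsFractionRing.injective (Polynomial ℝ) (FractionRing (Polynomial ℝ)))
    refine exists_lift_of_isProper _ (Spec.map (CommRingCat.ofHom κ) ≫ m) ?_ _
    rw [Category.assoc, hm, Spec_map_affinePoint, Spec_map_affinePoint_id, hκ]

/-- The model has rational sections through every nonempty open subset of its chart. -/
lemma exists_rational_section_model {d : ℕ} {F : MvPolynomial (Fin 2) ℝ}
    (hF : F.IsHomogeneous (2 * d)) (hF0 : F ≠ 0) (O : (Model hF).Opens)
    (hO : (O : Set (Model hF)).Nonempty)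
    (hOY : O ≤ modelChart hF) :
    ∃ n : Spec (.of LineField) ⟶ O, n ≫ (Model hF).homOfLE hOY ≫ modelProj hF =
      affinePoint (algebraMap (Polynomial ℝ) LineField) := by
  let k : Spec (.of (ModelChartRing hF)) ⟶ Model hF := (modelChartIso hF).inv ≫ (modelChart hF).ι
  obtain ⟨x, hx⟩ := hO
  obtain ⟨y, rfl⟩ : ∃ y, k y = x := by
    obtain ⟨y, hy⟩ := (modelChartIso hF).inv.surjective ⟨x, hOY hx⟩
    exact ⟨y, (Scheme.Hom.comp_apply _ _ _).trans (congrArg _ hy)⟩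
  obtain ⟨_, ⟨g, rfl⟩, hyg, hg⟩ :=
    PrimeSpectrum.isTopologicalBasis_basic_opens.exists_subset_of_mem_open (show y ∈ (k ⁻¹ᵁ O : Set _) from hx) (k ⁻¹ᵁ O).2
  have hg0 : g ≠ 0 := by
    rintro rfl
    exact hyg (Ideal.zero_mem _)
  obtain ⟨N, P, hP0, hP⟩ := exists_pow_mul_modelChartHom_eq hF hF0 hg0
  -- The section x = c, y = F/c must meet the open set g ≠ 0. A nonzero P has only finitely many
  -- constant roots; the extra factor X also excludes c = 0.
  obtain ⟨c, hc⟩ : ∃ c : ℝ, (P * Polynomial.X).eval (Polynomial.C c) ≠ 0 := by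
    by_contra! h
    refine mul_ne_zero hP0 Polynomial.X_ne_zero
      (Polynomial.eq_zero_of_infinite_isRoot _ (Set.Infinite.mono ?_
        (Set.infinite_range_of_injective (Polynomial.C_injective (R := ℝ)))))
    rintro _ ⟨c, rfl⟩
    exact h c
  rw [Polynomial.eval_mul, Polynomial.eval_X, mul_ne_zero_iff] at hc
  set ρ := algebraMap (Polynomial ℝ) LineField
  have hρ : Function.Injective ρ := IsFractionRing.injective _ _
  have hxy : ρ (Polynomial.C c) * (ρ (dehomogenize F) / ρ (Polynomial.C c)) = ρ (dehomogenize F) :=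
    mul_div_cancel₀ _ ((map_ne_zero_iff _ hρ).mpr hc.2)
  have hgne : modelChartHom hF ρ hxy g ≠ 0 := by
    intro h0
    have h1 := hP ρ hxy
    rw [h0, mul_zero, Polynomial.eval₂_at_apply, eq_comm, map_eq_zero_iff _ hρ] at h1
    exact hc.1 h1
  set w := Spec.map (CommRingCat.ofHom (modelChartHom hF ρ hxy))
  let n : Spec (.of LineField) ⟶ O := IsOpenImmersion.lift O.ι (w ≫ k) (by
    rintro _ ⟨z, rfl⟩
    rw [Scheme.Opens.range_ι, Scheme.Hom.comp_apply]
    refine hg (show w z ∈ PrimeSpectrum.basicOpen g from ?_)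
    intro h
    have h1 : modelChartHom hF ρ hxy g ∈ z.asIdeal := h
    exact z.2.ne_top (Ideal.eq_top_of_isUnit_mem _ h1 (isUnit_iff_ne_zero.mpr hgne)))
  have hn : n ≫ O.ι = w ≫ k := IsOpenImmersion.lift_fac _ _ _
  refine ⟨n, ?_⟩
  have h1 : n ≫ (Model hF).homOfLE hOY = w ≫ (modelChartIso hF).inv := by
    rw [← cancel_mono (modelChart hF).ι, Category.assoc, Scheme.homOfLE_ι, hn, Category.assoc]
  rw [reassoc_of% h1]
  exact modelChartIso_inv_modelProj hF ρ hxy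

/-- A de Jonquières involution forces all real points of the line to lift. -/
theorem IsDeJonquieres.image_realPoints {S : Scheme.{0}} {sS : S ⟶ Spec (.of ℝ)} [IsProper sS]
    {π : S ⟶ P1} (hπ : π ≫ P1.toSpec = sS) {τ : S ≅ S} (h : IsDeJonquieres π τ) :
    (fun s => s ≫ π) '' realPoints sS = realPoints P1.toSpec := by
  have hprop : IsProper π := by
    have : IsProper (π ≫ P1.toSpec) := by rw [hπ]; infer_instance
    exact .of_comp π P1.toSpec
  obtain ⟨d, F, hF, hsq, φ, hτ, hY, -, hφ⟩ := h
  have hirr := irreducibleSpace_model hF hsq.ne_zero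
  obtain ⟨n, hn⟩ := exists_rational_section_model hF hsq.ne_zero φ.target φ.dense_target.nonempty hY
  refine Set.Subset.antisymm ?_ fun b hb => ?_
  · rintro _ ⟨s, hs, rfl⟩
    change (s ≫ π) ≫ P1.toSpec = 𝟙 _
    rw [Category.assoc, hπ]
    exact hs
  · obtain ⟨s, rfl⟩ := exists_comp_eq_of_rational_section (n ≫ φ.iso.inv ≫ φ.source.ι)
      (by rw [Category.assoc, Category.assoc, ← hφ, Iso.inv_hom_id_assoc, hn]) b hb
    refine ⟨s, ?_, rfl⟩
    change s ≫ sS = 𝟙 _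
    rw [← hπ, ← Category.assoc]
    exact hb

end RealConic

/-! ### The equivalence -/

theorem mainTheorem5 {S : Scheme.{0}} (sS : S ⟶ Spec (.of ℝ)) [IsIntegral S] [IsProper sS]
    [SmoothOfRelativeDimension 2 sS] [Scheme.IsRationalOver sS]
    (π : S ⟶ RealConic.P1) (hπ : π ≫ RealConic.P1.toSpec = sS)
    (hconic : RealConic.IsConicBundle π)
    (τ : S ≅ S) (hτ_ne : τ.hom ≠ 𝟙 S) (hτ_inv : τ.hom ≫ τ.hom = 𝟙 S) (hτ_base : τ.hom ≫ π = π)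
    (hPic : Nonempty (Additive (RealConic.invariantPic τ) ≃+ ℤ × ℤ)) :
    RealConic.IsDeJonquieres π τ ↔
      (fun s => s ≫ π) '' RealConic.realPoints sS = RealConic.realPoints RealConic.P1.toSpec := by
  refine ⟨fun h => h.image_realPoints hπ, fun h => ?_⟩
  refine RealConic.isDeJonquieres_of_forall_exists_lift hπ hconic hτ_ne hτ_inv hτ_base fun s₀ => ?_
  -- For this direction it is enough to lift the points [s₀ : 1].
  have h1 : RealConic.affinePoint (Polynomial.evalRingHom s₀) ∈
      RealConic.realPoints RealConic.P1.toSpec := by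
    refine (RealConic.affinePoint_toSpec _).trans (Eq.trans ?_ (Spec.map_id (.of ℝ)))
    congr 2
    ext
    simp
  rw [← h] at h1
  exact h1
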